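/- **Setting.** A *GPT* $T$ is a tomographically local generalized probabilistic theory with finite-dimensional systems and a unique deterministic effect for every system, closed under sequential and parallel composition, permutation of systems and classical control, and containing classical probability theory (CPT): between classical systems its deterministic processes are exactly the stochastic maps. A *symmetry* of $T$ is a representation $F$ of a finite group $G$ on the systems of $T$, trivial on classical systems, whose collective (tensor-product) action takes valid processes of $T$ to valid processes. The symmetrized theory $sT$ consists of the processes of $T$ that are covariant under the collective action; it is called a swirled world if the symmetry is nonphysical, i.e. if some $F_g$ is not a process of $T$. The symmetry is *strongly nonphysical* if adding some $F_g$ to $T$ would yield a number outside $[0,1]$ in place of a probability. The symmetry *admits a perfect reference frame* if some system of $T$ has a state $\omega$ such that a measurement of $T$ perfectly distinguishes the states in the orbit $\{F_g\,\omega\}_{g\in G}$, and $F_g\,\omega=F_h\,\omega$ only if $F_g=F_h$ on all systems. A *causal structure* is a finite acyclic circuit shape (with unrestricted gates) with classical observed variables (some of them open inputs) and latent wires. Its $T$-realizable correlations are the families $P(\mathbf{o}\mid \mathbf{i})$, with any finite alphabets, that arise when the latent wires carry systems of $T$ and the gates are processes of $T$. It *admits of a $T'$–$T$ gap* if its set of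 $T'$-realizable correlations is a proper subset of its set of $T$-realizable correlations. It is *algebraic* if its CPT-realizable correlations are exactly the conditional distributions that satisfy some set of polynomial equations. Its *districts* are the sub-structures on the sets of gates that latent wires connect. A multipartite state acts as a *shared reference frame state* if, for every bipartition of the parties, its average over the collective action of $G$ is not invariant under the action of $G$ on one side only. A causal structure *allows for the preparation of a shared reference frame state among all latent GPT systems* if, in some circuit of $sT$ on it, tokens emitted along with the latent GPT wires, one for each wire by the gate that emits the wire, are jointly in such a state (observed outputs being disregarded). **PBR structure.** Two independent sources with settings $X$ and $Y$ each send a latent system to one measurement with setting $Z$ and outcome $A$. **Double Bell structure.** The open input is $A$, and the outcomes are $B,C,D,E$. The gate of $B$ reads $A$, that of $C$ reads $B$, that of $D$ reads $C$, and that of $E$ reads $D$. One source sends latent systems to the gates of $B$ and $D$, an independent source to those of $C$ and $E$. **Theorem.** 1. The PBR structure is algebraic. For every GPT $T$ and every symmetry of $T$, it does not allow for the preparation of a shared reference frame state among all latent GPT systems, and it does not admit of an $sT$–$T$ gap: the $sT$-realizable and the $T$-realizable correlations coincide. 2. The double Bell structure has exactly two districts, and each of them is a Bell scenario. For every GPT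 $T$ and every symmetry of $T$, it does not allow for the preparation of a shared reference frame state among all latent GPT systems, and it admits of a CPT–$T$ gap if and only if the Bell scenario does. If the symmetry admits a perfect reference frame, then the double Bell structure does not admit of an $sT$–$T$ gap: the $sT$-realizable and the $T$-realizable correlations coincide. 3. Quantum theory (QT) is a GPT, and time reversal (complex conjugation) is a symmetry of it that is strongly nonphysical and admits a perfect reference frame; the double Bell structure admits of a CPT–QT gap. Consequently, not allowing for the preparation of a shared reference frame state among all latent GPT systems is not a sufficient condition for a causal structure to admit of a swirled–nonswirled gap, even for strongly nonphysical symmetries; and it is still not sufficient for causal structures that admit of a CPT–$T$ gap. -/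

import Mathlib

universe u v

noncomputable section

open scoped Classical

namespace Swirl

/-! ### Systems, processes, theories -/

/-- The nonclassical elementary systems of a theory.  The vector space of the system `q` is
`Idx q → ℝ`. -/
structure Systems where
  Q : Type u
  Idx : Q → Type
  [fintypeIdx : ∀ q, Fintype (Idx q)]

attribute [instance] Systems.fintypeIdx

/-- Elementary systems: the classical system with `n + 1` values, and the nonclassical ones. -/
inductive Systems.Sys (S : Systems.{u}) : Type u
  | cl (n : ℕ) : Systems.Sys S
  | gpt (q : S.Q) : Systems.Sys S

/-- Index set of the coordinates of an elementary system.  A classical system has the simplex of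
probability vectors on its values as its state space. -/
def Systems.Sys.Ix {S : Systems.{u}} : S.Sys → Type
  | .cl n => Fin (n + 1)
  | .gpt q => S.Idx q

instance {S : Systems.{u}} (a : S.Sys) : Fintype a.Ix :=
  match a with
  | .cl n => inferInstanceAs (Fintype (Fin (n + 1)))
  | .gpt q => S.fintypeIdx q

/-- Coordinates of the composite of the family `s` of systems: the vector space `Bas s → ℝ` is the
tensor product of the vector spaces of the components (tomographic locality). -/
abbrev Bas {S : Systems.{u}} {ι : Type} (s : ι → S.Sys) : Type := ∀ i, (s i).Ix

/-- Linear maps from the composite of `s` to the composite of `t`, as real matrices. -/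
abbrev Proc {S : Systems.{u}} {ι κ : Type} (s : ι → S.Sys) (t : κ → S.Sys) : Type :=
  Matrix (Bas t) (Bas s) ℝ

/-- The trivial system (empty composite). -/
abbrev Systems.triv (S : Systems.{u}) : Empty → S.Sys := fun e => e.elim

/-- The composite that consists of a single elementary system. -/
abbrev one {S : Systems.{u}} (a : S.Sys) : Unit → S.Sys := fun _ => a

/-- Sequential composition: first `M`, then `N`. -/
def Proc.comp {S : Systems.{u}} {ι κ μ : Type} [Fintype κ] {s : ι → S.Sys} {t : κ → S.Sys}
    {r : μ → S.Sys} (N : Proc t r) (M : Proc s t) : Proc s r := N * M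

/-- Parallel composition (Kronecker product). -/
def Proc.par {S : Systems.{u}} {ι κ ι' κ' : Type} {s : ι → S.Sys} {t : κ → S.Sys}
    {s' : ι' → S.Sys} {t' : κ' → S.Sys} (M : Proc s t) (N : Proc s' t') :
    Proc (Sum.elim s s') (Sum.elim t t') :=
  fun b a => M (fun k => b (.inl k)) (fun i => a (.inl i)) *
    N (fun k => b (.inr k)) (fun i => a (.inr i))

/-- Identity wires, up to relabelling (permutations of systems). -/
def Proc.relabel {S : Systems.{u}} {ι κ : Type} (e : κ ≃ ι) (s : ι → S.Sys) :
    Proc s (fun k => s (e k)) :=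
  fun b a => if (∀ k, b k = a (e k)) then 1 else 0

/-- The process that applies `E x` when the control, a classical system, has value `x`. -/
def Proc.control {S : Systems.{u}} {ι κ : Type} {s : ι → S.Sys} {t : κ → S.Sys} {n : ℕ}
    (E : Fin (n + 1) → Proc s t) : Proc (Sum.elim (one (.cl n)) s) t :=
  fun b a => E (a (.inl ())) b (fun i => a (.inr i))

/-- Column-stochastic matrices: nonnegative entries and columns that sum to one. -/
def Stochastic {α β : Type} [Fintype β] (M : Matrix β α ℝ) : Prop :=
  (∀ b a, 0 ≤ M b a) ∧ ∀ a, ∑ b, M b a = 1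

/-- The data of a theory: its systems, and for any two composite systems the set of valid
deterministic (normalized) processes between them.  A state of `s` is a process from the trivial
system to `s`.  Measurements and operations that yield outcomes are processes with classical
outputs, and settings are classical inputs. -/
structure Theory extends Systems.{u} where
  Chan : ∀ {ι κ : Type} [Fintype ι] [Fintype κ] (s : ι → toSystems.Sys) (t : κ → toSystems.Sys),
    Set (Proc s t)

/-- The theory is a tomographically local generalized probabilistic theory that contains classical
probability theory. -/
structure IsGPT (T : Theory.{u}) : Prop where
  relabel : ∀ {ι κ : Type} [Fintype ι] [Fintype κ] (e : κ ≃ ι) (s : ι → T.Sys),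
    Proc.relabel e s ∈ T.Chan s (fun k => s (e k))
  comp : ∀ {ι κ μ : Type} [Fintype ι] [Fintype κ] [Fintype μ] (s : ι → T.Sys) (t : κ → T.Sys)
    (r : μ → T.Sys), ∀ M ∈ T.Chan s t, ∀ N ∈ T.Chan t r, Proc.comp N M ∈ T.Chan s r
  par : ∀ {ι κ ι' κ' : Type} [Fintype ι] [Fintype κ] [Fintype ι'] [Fintype κ']
    (s : ι → T.Sys) (t : κ → T.Sys) (s' : ι' → T.Sys) (t' : κ' → T.Sys),
    ∀ M ∈ T.Chan s t, ∀ N ∈ T.Chan s' t',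
      Proc.par M N ∈ T.Chan (Sum.elim s s') (Sum.elim t t')
  /-- Between classical systems, the valid processes are exactly the stochastic maps. -/
  classical : ∀ {ι κ : Type} [Fintype ι] [Fintype κ] (n : ι → ℕ) (m : κ → ℕ),
    T.Chan (fun i => .cl (n i)) (fun k => .cl (m k)) = {M | Stochastic M}
  control : ∀ {ι κ : Type} [Fintype ι] [Fintype κ] (s : ι → T.Sys) (t : κ → T.Sys) (n : ℕ)
    (E : Fin (n + 1) → Proc s t), (∀ x, E x ∈ T.Chan s t) →
      Proc.control E ∈ T.Chan (Sum.elim (one (.cl n)) s) t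
  /-- Every system has exactly one deterministic effect (the unit effect). -/
  discard : ∀ {ι : Type} [Fintype ι] (s : ι → T.Sys), ∃! U : Proc s T.triv, U ∈ T.Chan s T.triv
  /-- The states of a system span its vector space. -/
  states_span : ∀ q : T.Q, Submodule.span ℝ {v : T.Idx q → ℝ |
    ∃ M ∈ T.Chan T.triv (one (.gpt q)), ∀ j, v j = M (fun _ => j) (fun e => e.elim)} = ⊤
  /-- The effects on a system span the dual space; with `Bas`, this is tomographic locality. -/
  effects_span : ∀ q : T.Q, Submodule.span ℝ {v : T.Idx q → ℝ |
    ∃ (n : ℕ) (y : Fin (n + 1)), ∃ M ∈ T.Chan (one (.gpt q)) (one (.cl n)),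
      ∀ j, v j = M (fun _ => y) (fun _ => j)} = ⊤

/-! ### Symmetries and symmetrized theories -/

/-- Action of a symmetry on an elementary system; classical systems carry the trivial
representation. -/
def sysAct {S : Systems.{u}} {G : Type} (F : G → ∀ q : S.Q, Matrix (S.Idx q) (S.Idx q) ℝ) (g : G) :
    ∀ a : S.Sys, Matrix a.Ix a.Ix ℝ
  | .cl n => (1 : Matrix (Fin (n + 1)) (Fin (n + 1)) ℝ)
  | .gpt q => F g q

/-- Collective action of a symmetry on a composite system (the tensor product of the actions). -/
def act {S : Systems.{u}} {G : Type} (F : G → ∀ q : S.Q, Matrix (S.Idx q) (S.Idx q) ℝ) (g : G)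
    {ι : Type} [Fintype ι] (s : ι → S.Sys) : Proc s s :=
  fun b a => ∏ i, sysAct F g (s i) (b i) (a i)

/-- `F` is a symmetry of `T`: a representation of `G` on every system whose collective action takes
valid processes (in particular, states and effects) to valid processes. -/
structure IsSymmetry (T : Theory.{u}) {G : Type} [Group G]
    (F : G → ∀ q : T.Q, Matrix (T.Idx q) (T.Idx q) ℝ) : Prop where
  map_one : ∀ q, F 1 q = 1
  map_mul : ∀ (g h : G) (q : T.Q), F (g * h) q = F g q * F h q
  conj : ∀ (g : G) {ι κ : Type} [Fintype ι] [Fintype κ] (s : ι → T.Sys) (t : κ → T.Sys),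
    ∀ M ∈ T.Chan s t, Proc.comp (act F g t) (Proc.comp M (act F g⁻¹ s)) ∈ T.Chan s t

/-- The symmetrized theory: the processes of `T` that are covariant under the collective action
(for states and effects: invariant).  It is a swirled world if the symmetry is nonphysical. -/
def symmetrized (T : Theory.{u}) {G : Type}
    (F : G → ∀ q : T.Q, Matrix (T.Idx q) (T.Idx q) ℝ) : Theory.{u} where
  toSystems := T.toSystems
  Chan s t := {M | M ∈ T.Chan s t ∧ ∀ g, Proc.comp (act F g t) M = Proc.comp M (act F g s)}

/-- The processes generated by those of `T` and one further process `N`. -/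
inductive Extended (T : Theory.{u}) {ι₀ κ₀ : Type} [Fintype ι₀] [Fintype κ₀]
    {s₀ : ι₀ → T.Sys} {t₀ : κ₀ → T.Sys} (N : Proc s₀ t₀) :
    ∀ {ι κ : Type} [Fintype ι] [Fintype κ] (s : ι → T.Sys) (t : κ → T.Sys), Proc s t → Prop
  | new : Extended T N s₀ t₀ N
  | base {ι κ : Type} [Fintype ι] [Fintype κ] (s : ι → T.Sys) (t : κ → T.Sys) (M : Proc s t) :
      M ∈ T.Chan s t → Extended T N s t M
  | comp {ι κ μ : Type} [Fintype ι] [Fintype κ] [Fintype μ] (s : ι → T.Sys) (t : κ → T.Sys)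
      (r : μ → T.Sys) (M : Proc s t) (M' : Proc t r) :
      Extended T N s t M → Extended T N t r M' → Extended T N s r (Proc.comp M' M)
  | par {ι κ ι' κ' : Type} [Fintype ι] [Fintype κ] [Fintype ι'] [Fintype κ']
      (s : ι → T.Sys) (t : κ → T.Sys) (s' : ι' → T.Sys) (t' : κ' → T.Sys)
      (M : Proc s t) (M' : Proc s' t') :
      Extended T N s t M → Extended T N s' t' M' →
        Extended T N (Sum.elim s s') (Sum.elim t t') (Proc.par M M')

/-- Adding `N` to `T` never yields a number outside `[0, 1]` in place of a probability. -/
def LogicallyPossible (T : Theory.{u}) {ι₀ κ₀ : Type} [Fintype ι₀] [Fintype κ₀]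
    {s₀ : ι₀ → T.Sys} {t₀ : κ₀ → T.Sys} (N : Proc s₀ t₀) : Prop :=
  ∀ {κ : Type} [Fintype κ] (m : κ → ℕ) (M : Proc T.triv (fun k => (.cl (m k) : T.Sys))),
    Extended T N T.triv (fun k => .cl (m k)) M → ∀ b a, 0 ≤ M b a ∧ M b a ≤ 1

/-- Some symmetry transformation is not logically possible in `T`. -/
def StronglyNonphysical (T : Theory.{u}) {G : Type}
    (F : G → ∀ q : T.Q, Matrix (T.Idx q) (T.Idx q) ℝ) : Prop :=
  ∃ (g : G) (q : T.Q), ¬ LogicallyPossible T (act F g (one (.gpt q : T.Sys)))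

/-- Some (possibly composite) system has a state `ω` such that a measurement of `T` perfectly
distinguishes the states in the orbit of `ω`, and the state `F g ω` determines the action `F g`. -/
def HasPerfectReferenceFrame (T : Theory.{u}) {G : Type}
    (F : G → ∀ q : T.Q, Matrix (T.Idx q) (T.Idx q) ℝ) : Prop :=
  ∃ (k : ℕ) (r : Fin k → T.Sys) (n : ℕ) (label : G → Fin (n + 1)),
    ∃ ω ∈ T.Chan T.triv r, ∃ M ∈ T.Chan r (one (.cl n)),
      (∀ (g : G) (y : Fin (n + 1)),
        Proc.comp M (Proc.comp (act F g r) ω) (fun _ => y) (fun e => e.elim) =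
          if y = label g then 1 else 0) ∧
      ∀ g h : G, label g = label h → F g = F h

/-! ### Causal structures and realizable correlations -/

/-- A causal structure with unrestricted gates.  Gates are joined by latent wires, some of which may
be stipulated to be classical.  Observed variables are classical: the variable `o : Out` is produced
by the gate `origin o`, the variable `i : In` is an open input, and `v ∈ reads g` says that a copy of
`v` is fed into the gate `g`. -/
structure CausalStructure where
  Gate : Type
  Latent : Type
  Out : Type
  In : Type
  [fGate : Fintype Gate]
  [fLatent : Fintype Latent]
  [fOut : Fintype Out]
  [fIn : Fintype In]
  src : Latent → Gate
  tgt : Latent → Gate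
  stipulatedClassical : Set Latent
  origin : Out → Gate
  reads : Gate → Set (Out ⊕ In)
  acyclic : ∃ rank : Gate → ℕ, (∀ w, rank (src w) < rank (tgt w)) ∧
    ∀ g o, Sum.inl o ∈ reads g → rank (origin o) < rank g

attribute [instance] CausalStructure.fGate CausalStructure.fLatent CausalStructure.fOut
  CausalStructure.fIn

namespace CausalStructure

variable (C : CausalStructure)

/-- Values of the output variables, where the variable `v` takes `card v + 1` values. -/
abbrev OutVals (card : C.Out ⊕ C.In → ℕ) : Type := ∀ o : C.Out, Fin (card (.inl o) + 1)

/-- Values of the open input variables. -/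
abbrev InVals (card : C.Out ⊕ C.In → ℕ) : Type := ∀ i : C.In, Fin (card (.inr i) + 1)

/-- Joint values of all observed variables. -/
def vals {C : CausalStructure} {card : C.Out ⊕ C.In → ℕ} (o : C.OutVals card)
    (i : C.InVals card) : ∀ v : C.Out ⊕ C.In, Fin (card v + 1)
  | .inl v => o v
  | .inr v => i v

/-- A family of numbers `P o i` (meant as `P(o | i)`), with any finite alphabets. -/
abbrev Corr : Type := Σ card : C.Out ⊕ C.In → ℕ, (C.OutVals card → C.InVals card → ℝ)

end CausalStructure

/-- A circuit of theory `T` on the causal structure `C`: every latent wire carries a composite system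
of `T`, and every gate is a valid process of `T`. -/
structure Circuit (T : Theory.{u}) (C : CausalStructure) (card : C.Out ⊕ C.In → ℕ) where
  len : C.Latent → ℕ
  sys : ∀ w, Fin (len w) → T.Sys
  classical : ∀ w ∈ C.stipulatedClassical, ∀ j, ∃ n, sys w j = .cl n
  gate : ∀ g : C.Gate, Proc
    (Sum.elim (fun v : {v // v ∈ C.reads g} => (.cl (card v.1) : T.Sys))
      (fun p : Σ w : {w // C.tgt w = g}, Fin (len w.1) => sys p.1.1 p.2))
    (Sum.elim (fun o : {o // C.origin o = g} => (.cl (card (.inl o.1)) : T.Sys))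
      (fun p : Σ w : {w // C.src w = g}, Fin (len w.1) => sys p.1.1 p.2))
  valid : ∀ g, gate g ∈ T.Chan _ _

/-- The probability `P(o | i)` that the circuit yields: contract all latent wires. -/
def Circuit.prob {T : Theory.{u}} {C : CausalStructure} {card : C.Out ⊕ C.In → ℕ}
    (K : Circuit T C card) (o : C.OutVals card) (i : C.InVals card) : ℝ :=
  ∑ l : (∀ w, Bas (K.sys w)), ∏ g,
    K.gate g
      (fun | .inl v => o v.1
           | .inr p => l p.1.1 p.2)
      (fun | .inl v => CausalStructure.vals o i v.1
           | .inr p => l p.1.1 p.2)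

/-- The correlations that are `T`-realizable in `C`. -/
def realizable (T : Theory.{u}) (C : CausalStructure) : Set C.Corr :=
  {P | ∃ K : Circuit T C P.1, ∀ o i, P.2 o i = K.prob o i}

/-- `C` admits of a `T'`-`T` gap. -/
def AdmitsGap (T' : Theory.{v}) (T : Theory.{u}) (C : CausalStructure) : Prop :=
  realizable T' C ⊂ realizable T C

/-! ### Shared reference frame states -/

section SharedReferenceFrame

variable {S : Systems.{u}} {G W : Type} [Fintype W] {len : W → ℕ}

/-- The action of `g` on the parties in `A`, and the identity on the other parties. -/
def partialAct (F : G → ∀ q : S.Q, Matrix (S.Idx q) (S.Idx q) ℝ)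
    (sys : ∀ w, Fin (len w) → S.Sys) (A : Set W) (g : G) :
    Matrix (∀ w, Bas (sys w)) (∀ w, Bas (sys w)) ℝ :=
  fun b a => ∏ w, if w ∈ A then act F g (sys w) (b w) (a w) else if b w = a w then 1 else 0

/-- The symmetrization (collective action, averaged over the group) of a multipartite state. -/
def symmetrizeState [Fintype G] (F : G → ∀ q : S.Q, Matrix (S.Idx q) (S.Idx q) ℝ)
    (sys : ∀ w, Fin (len w) → S.Sys) (τ : (∀ w, Bas (sys w)) → ℝ) : (∀ w, Bas (sys w)) → ℝ :=
  (Fintype.card G : ℝ)⁻¹ • ∑ g, (partialAct F sys Set.univ g).mulVec τ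

/-- A state acts as a shared reference frame state among all the parties if, for every bipartition
of the parties, its symmetrization is not invariant under the relational group action (the group
acting on one of the two sides only). -/
def IsSharedReferenceFrame [Fintype G] (F : G → ∀ q : S.Q, Matrix (S.Idx q) (S.Idx q) ℝ)
    (sys : ∀ w, Fin (len w) → S.Sys) (τ : (∀ w, Bas (sys w)) → ℝ) : Prop :=
  ∀ A : Set W, A.Nonempty → A ≠ Set.univ →
    ∃ g, (partialAct F sys A g).mulVec (symmetrizeState F sys τ) ≠ symmetrizeState F sys τ

end SharedReferenceFrame

/-- A circuit on `C` in which the gate that emits a latent GPT wire `w` also emits a token, a system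
associated with `w` that is left open. -/
structure TokenCircuit (T : Theory.{u}) (C : CausalStructure) (card : C.Out ⊕ C.In → ℕ) where
  len : C.Latent → ℕ
  sys : ∀ w, Fin (len w) → T.Sys
  classical : ∀ w ∈ C.stipulatedClassical, ∀ j, ∃ n, sys w j = .cl n
  tokLen : {w // w ∉ C.stipulatedClassical} → ℕ
  tok : ∀ w, Fin (tokLen w) → T.Sys
  gate : ∀ g : C.Gate, Proc
    (Sum.elim (fun v : {v // v ∈ C.reads g} => (.cl (card v.1) : T.Sys))
      (fun p : Σ w : {w // C.tgt w = g}, Fin (len w.1) => sys p.1.1 p.2))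
    (Sum.elim (fun o : {o // C.origin o = g} => (.cl (card (.inl o.1)) : T.Sys))
      (Sum.elim (fun p : Σ w : {w // C.src w = g}, Fin (len w.1) => sys p.1.1 p.2)
        (fun p : Σ w : {w : {w // w ∉ C.stipulatedClassical} // C.src w.1 = g},
          Fin (tokLen w.1) => tok p.1.1 p.2)))
  valid : ∀ g, gate g ∈ T.Chan _ _

/-- The joint state of all the tokens, when the open inputs have the values `i` and the observed
outputs are disregarded. -/
def TokenCircuit.state {T : Theory.{u}} {C : CausalStructure} {card : C.Out ⊕ C.In → ℕ}
    (K : TokenCircuit T C card) (i : C.InVals card) (x : ∀ w, Bas (K.tok w)) : ℝ :=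
  ∑ o : C.OutVals card, ∑ l : (∀ w, Bas (K.sys w)), ∏ g,
    K.gate g
      (fun | .inl v => o v.1
           | .inr (.inl p) => l p.1.1 p.2
           | .inr (.inr p) => x p.1.1 p.2)
      (fun | .inl v => CausalStructure.vals o i v.1
           | .inr p => l p.1.1 p.2)

/-- In the symmetrized theory, the causal structure allows for the preparation of a shared reference
frame state among all its latent GPT systems. -/
def AllowsSharedReferenceFrame (T : Theory.{u}) {G : Type} [Fintype G]
    (F : G → ∀ q : T.Q, Matrix (T.Idx q) (T.Idx q) ℝ) (C : CausalStructure) : Prop :=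
  ∃ (card : C.Out ⊕ C.In → ℕ) (K : TokenCircuit (symmetrized T F) C card) (i : C.InVals card),
    IsSharedReferenceFrame (S := T.toSystems) F K.tok (K.state i)

/-! ### Classical probability theory, quantum theory, time reversal -/

/-- Classical probability theory. -/
def CPT : Theory.{0} where
  Q := Empty
  Idx := fun e => e.elim
  fintypeIdx := fun e => e.elim
  Chan _ _ := {M | Stochastic M}

/-- The Hilbert space of the quantum system `n : ℕ` is `ℂ ^ (n + 1)`; the real vector space of its
Hermitian operators has dimension `(n + 1) ^ 2`. -/
def quantumSystems : Systems.{0} where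
  Q := ℕ
  Idx n := Fin (n + 1) × Fin (n + 1)

/-- Dimension, minus one, of the Hilbert space of a system; a classical system is embedded as the
diagonal operators. -/
def hdim : quantumSystems.Sys → ℕ
  | .cl n => n
  | .gpt q => q

/-- Basis of the Hermitian (for classical systems: diagonal) operators, orthonormal for the inner
product `tr (A B)`: for quantum systems, `(1 + i)/2 |x⟩⟨y| + (1 - i)/2 |y⟩⟨x|`. -/
def herm : ∀ a : quantumSystems.Sys, a.Ix → Matrix (Fin (hdim a + 1)) (Fin (hdim a + 1)) ℂ
  | .cl _, x => Matrix.single x x 1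
  | .gpt _, x => ((1 + Complex.I) / 2) • Matrix.single x.1 x.2 1 +
      ((1 - Complex.I) / 2) • Matrix.single x.2 x.1 1

/-- Index set of the standard basis of the Hilbert space of a composite system. -/
abbrev HBas {ι : Type} (s : ι → quantumSystems.Sys) : Type := ∀ i, Fin (hdim (s i) + 1)

/-- Product basis of the Hermitian operators of a composite system. -/
def hermProd {ι : Type} [Fintype ι] (s : ι → quantumSystems.Sys) (b : Bas s) :
    Matrix (HBas s) (HBas s) ℂ :=
  fun x y => ∏ i, herm (s i) (b i) (x i) (y i)

/-- Quantum theory: the valid processes are the completely positive trace-preserving maps (given by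
Kraus operators), written as real matrices in the bases `hermProd`. -/
def QT : Theory.{0} where
  toSystems := quantumSystems
  Chan s t := {M | ∃ (m : ℕ) (K : Fin m → Matrix (HBas t) (HBas s) ℂ),
    ∑ k, (K k).conjTranspose * K k = 1 ∧
    ∀ b a, (M b a : ℂ) =
      ∑ k, (hermProd t b * (K k * hermProd s a * (K k).conjTranspose)).trace}

/-- Time reversal: the nontrivial element acts as complex conjugation of Hermitian operators, which
exchanges the coordinates `(x, y)` and `(y, x)`.  Symmetrization yields real quantum theory. -/
def timeReversal (g : Multiplicative (ZMod 2)) (q : QT.Q) : Matrix (QT.Idx q) (QT.Idx q) ℝ :=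
  fun b a => if b = (if g = 1 then a else (a.2, a.1)) then 1 else 0

/-! ### Algebraic causal structures, districts -/

/-- The classically realizable correlations are those conditional distributions that satisfy some
set of polynomial equations (no inequality constraints). -/
def Algebraic (C : CausalStructure) : Prop :=
  ∀ card : C.Out ⊕ C.In → ℕ, ∃ E : Set (MvPolynomial (C.OutVals card × C.InVals card) ℝ),
    ∀ P : C.OutVals card → C.InVals card → ℝ,
      (⟨card, P⟩ : C.Corr) ∈ realizable CPT C ↔
        (((∀ o i, 0 ≤ P o i) ∧ ∀ i, ∑ o, P o i = 1) ∧
          ∀ p ∈ E, MvPolynomial.eval (fun x => P x.1 x.2) p = 0)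

namespace CausalStructure

/-- Two gates are in the same fragment if latent wires connect them. -/
def fragments (C : CausalStructure) : Setoid C.Gate :=
  Relation.EqvGen.setoid (fun g h => ∃ w, C.src w = g ∧ C.tgt w = h)

/-- The sub-structure on a set of gates: the latent wires between them, the variables that they
produce, and as open inputs those variables that they read but do not produce. -/
def restrict (C : CausalStructure) (D : Set C.Gate) : CausalStructure where
  Gate := {g // g ∈ D}
  Latent := {w // C.src w ∈ D ∧ C.tgt w ∈ D}
  Out := {o // C.origin o ∈ D}
  In := {v : C.Out ⊕ C.In // (∃ g ∈ D, v ∈ C.reads g) ∧ ∀ o, v = .inl o → C.origin o ∉ D}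
  src w := ⟨C.src w.1, w.2.1⟩
  tgt w := ⟨C.tgt w.1, w.2.2⟩
  stipulatedClassical := {w | w.1 ∈ C.stipulatedClassical}
  origin o := ⟨C.origin o.1, o.2⟩
  reads g := {v | Sum.elim (fun o => Sum.inl o.1) (fun i => i.1) v ∈ C.reads g.1}
  acyclic := by
    obtain ⟨rank, h1, h2⟩ := C.acyclic
    exact ⟨fun g => rank g.1, fun w => h1 w.1, fun g o h => h2 g.1 o.1 h⟩

/-- The district of a fragment. -/
def district (C : CausalStructure) (d : Quotient C.fragments) : CausalStructure :=
  C.restrict {g | Quotient.mk C.fragments g = d}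

/-- Isomorphisms of causal structures. -/
structure Iso (C D : CausalStructure) where
  gate : C.Gate ≃ D.Gate
  latent : C.Latent ≃ D.Latent
  out : C.Out ≃ D.Out
  inp : C.In ≃ D.In
  src : ∀ w, D.src (latent w) = gate (C.src w)
  tgt : ∀ w, D.tgt (latent w) = gate (C.tgt w)
  stipulatedClassical : ∀ w, latent w ∈ D.stipulatedClassical ↔ w ∈ C.stipulatedClassical
  origin : ∀ o, D.origin (out o) = gate (C.origin o)
  reads : ∀ g v, Sum.map out inp v ∈ D.reads (gate g) ↔ v ∈ C.reads g

end CausalStructure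

/-! ### The three causal structures; all latent systems are GPT systems -/

/-- The PBR scenario.  Gates: two sources `0` and `1`, with settings `X = 0` and `Y = 1`; each sends
a latent system to the measurement `2`, which has the setting `Z = 2` and the only outcome `A`. -/
def PBR : CausalStructure where
  Gate := Fin 3
  Latent := Fin 2
  Out := Fin 1
  In := Fin 3
  src := ![0, 1]
  tgt := ![2, 2]
  stipulatedClassical := ∅
  origin := ![2]
  reads := ![{.inr 0}, {.inr 1}, {.inr 2}]
  acyclic := by
    refine ⟨![0, 0, 1], by decide, ?_⟩
    intro g o
    fin_cases g <;> simp

/-- The Bell scenario: the source `0` sends latent systems to the measurements `1` and `2`, each with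
its own setting and outcome. -/
def Bell : CausalStructure where
  Gate := Fin 3
  Latent := Fin 2
  Out := Fin 2
  In := Fin 2
  src := ![0, 0]
  tgt := ![1, 2]
  stipulatedClassical := ∅
  origin := ![1, 2]
  reads := ![∅, {.inr 0}, {.inr 1}]
  acyclic := by
    refine ⟨![0, 1, 1], by decide, ?_⟩
    intro g o
    fin_cases g <;> simp

/-- The structure with two districts.  The open input is `A`; the outputs are `B = 0`, `C = 1`,
`D = 2`, `E = 3`, produced in this order by the gates `2`, `3`, `4`, `5`, where each gate reads the
variable that precedes its own.  The source `0` sends latent systems to the gates of `C` and `E`,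
and the source `1` to the gates of `B` and `D`. -/
def DoubleBell : CausalStructure where
  Gate := Fin 6
  Latent := Fin 4
  Out := Fin 4
  In := Fin 1
  src := ![0, 0, 1, 1]
  tgt := ![3, 5, 2, 4]
  stipulatedClassical := ∅
  origin := ![2, 3, 4, 5]
  reads := ![∅, ∅, {.inr 0}, {.inl 0}, {.inl 1}, {.inl 2}]
  acyclic := by
    refine ⟨![0, 0, 1, 2, 3, 4], by decide, ?_⟩
    intro g o
    fin_cases g <;> fin_cases o <;> simp

end Swirl

end

open Swirl

/-! Shared reference frames. In both structures the tokens come from two independent sources. Once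
the observed outcomes are summed over, every measurement becomes a unit effect; in the double Bell
structure the sums are carried out against the order of influence, E, D, C, B. The state of the
tokens in the symmetrized theory is then a product of two invariant states, one for each source.
Acting with the group on the tokens of one source only changes nothing, so the bipartition into the
two sources defeats the condition (`partialAct_mulVec_two`, `partialAct_mulVec_four`).

PBR. If the latent wires carry classical copies of X and Y, the measurement knows all three settings
and can sample its outcome from any conditional distribution. Hence every theory realizes all of
them (`mem_realizable_pbr_iff`): no equations are needed, and no two theories differ.

Double Bell, no gap. Contracting a circuit gives P(b,c,d,e | a) = Q₁(c,e | b,d) Q₂(b,d | a,c), with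
both factors realizable in a Bell scenario, and every such product arises
(`mem_realizable_doubleBell_iff`). It therefore suffices to simulate a single Bell scenario in the
symmetrized theory (`BellForm.symmetrized`). The source attaches a perfect reference frame to each
of its two systems and averages the whole over the group; each party reads its frame and undoes the
group element before measuring. A frame shared within each district is enough, although no frame is
shared by all the wires.

Double Bell, classical gap. If every Bell correlation is classical, so are both factors. Conversely,
a Bell correlation Q is tested by putting Q in one district and the uniform distribution in the
other: absence of signalling forces the first factor of any factorization of this product to be Q
(`eq_of_mul_eq`).

Quantum theory. Channels are written as real matrices in a trace-orthonormal basis of Hermitian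
operators that is permuted by transposition. The axioms follow from Kraus representations
(`isGPT_QT`), and conjugating the Kraus operators shows that time reversal is a symmetry. Applied to
half of a maximally entangled pair, time reversal gives a singlet outcome the value -1/2
(`stronglyNonphysical_timeReversal`). It exchanges the two eigenstates of the imaginary Pauli
matrix, which are thus a perfect reference frame. Finally, a qubit pair reaches the CHSH value 14/5,
above the classical bound 2, which gives the classical gap in the Bell scenario and hence in the
double Bell structure. -/

noncomputable section

open scoped Classical

namespace Swirl

/-! ### Process theories and reindexing -/

/-- Closure properties that generalized probabilistic theories share with their
symmetrizations. -/
structure IsProcessTheory (T : Theory.{u}) : Prop where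
  relabel : ∀ {ι κ : Type} [Fintype ι] [Fintype κ] (e : κ ≃ ι) (s : ι → T.Sys),
    Proc.relabel e s ∈ T.Chan s (fun k => s (e k))
  comp : ∀ {ι κ μ : Type} [Fintype ι] [Fintype κ] [Fintype μ] {s : ι → T.Sys} {t : κ → T.Sys}
    {r : μ → T.Sys} {M : Proc s t} {N : Proc t r}, N ∈ T.Chan t r → M ∈ T.Chan s t →
      Proc.comp N M ∈ T.Chan s r
  par : ∀ {ι κ ι' κ' : Type} [Fintype ι] [Fintype κ] [Fintype ι'] [Fintype κ']
    {s : ι → T.Sys} {t : κ → T.Sys} {s' : ι' → T.Sys} {t' : κ' → T.Sys}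
    {M : Proc s t} {N : Proc s' t'}, M ∈ T.Chan s t → N ∈ T.Chan s' t' →
      Proc.par M N ∈ T.Chan (Sum.elim s s') (Sum.elim t t')
  classical : ∀ {ι κ : Type} [Fintype ι] [Fintype κ] (n : ι → ℕ) (m : κ → ℕ),
    T.Chan (fun i => .cl (n i)) (fun k => .cl (m k)) = {M | Stochastic M}
  control : ∀ {ι κ : Type} [Fintype ι] [Fintype κ] {s : ι → T.Sys} {t : κ → T.Sys} {n : ℕ}
    {E : Fin (n + 1) → Proc s t}, (∀ x, E x ∈ T.Chan s t) →
      Proc.control E ∈ T.Chan (Sum.elim (one (.cl n)) s) t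

theorem IsGPT.isProcessTheory {T : Theory.{u}} (hT : IsGPT T) : IsProcessTheory T where
  relabel := hT.relabel
  comp hN hM := hT.comp _ _ _ _ hM _ hN
  par hM hN := hT.par _ _ _ _ _ hM _ hN
  classical := hT.classical
  control hE := hT.control _ _ _ _ hE

/-- An identification of the composite `s` with the composite `s'`, which have the same
components up to a bijection of the index types. -/
structure Reindex {S : Systems.{u}} {ι ι' : Type} (s : ι → S.Sys) (s' : ι' → S.Sys) where
  idx : ι' → ι
  bij : Function.Bijective idx
  sys_eq : ∀ i, s' i = s (idx i)
  map : Bas s → Bas s'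
  heq : ∀ b i, HEq (map b i) (b (idx i))

namespace Reindex

variable {S : Systems.{u}} {ι ι' κ κ' : Type} {s : ι → S.Sys} {s' : ι' → S.Sys}

/-- The identity reindexing. -/
protected def refl (s : ι → S.Sys) : Reindex s s :=
  ⟨id, Function.bijective_id, fun _ => rfl, id, fun _ _ => HEq.rfl⟩

theorem map_bijective (φ : Reindex s s') : Function.Bijective φ.map := by
  constructor
  · intro b c h
    funext i
    obtain ⟨j, rfl⟩ := φ.bij.2 i
    exact eq_of_heq ((φ.heq b j).symm.trans ((heq_of_eq (congrFun h j)).trans (φ.heq c j)))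
  · intro b'
    let e := Equiv.ofBijective φ.idx φ.bij
    have hs : ∀ i, s' (e.symm i) = s i := fun i =>
      (φ.sys_eq _).trans (congrArg s (e.apply_symm_apply i))
    refine ⟨fun i => cast (congrArg Systems.Sys.Ix (hs i)) (b' (e.symm i)), ?_⟩
    funext i
    refine eq_of_heq ((φ.heq _ i).trans ((cast_heq _ _).trans ?_))
    exact congr_arg_heq b' (e.symm_apply_apply i)

/-- The inverse reindexing. -/
protected def symm (φ : Reindex s s') : Reindex s' s where
  idx := (Equiv.ofBijective φ.idx φ.bij).symm
  bij := Equiv.bijective _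
  sys_eq i := ((φ.sys_eq _).trans
    (congrArg s ((Equiv.ofBijective φ.idx φ.bij).apply_symm_apply i))).symm
  map := (Equiv.ofBijective φ.map φ.map_bijective).symm
  heq b i := by
    obtain ⟨b, rfl⟩ := φ.map_bijective.2 b
    obtain ⟨i, rfl⟩ := φ.bij.2 i
    rw [Equiv.ofBijective_symm_apply_apply φ.map, Equiv.ofBijective_symm_apply_apply φ.idx]
    exact (φ.heq b i).symm

end Reindex

/-! ### Composition of processes as matrix multiplication. -/

section Algebra

variable {S : Systems.{u}} {ι κ μ ν : Type} {s : ι → S.Sys} {t : κ → S.Sys}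
  {r : μ → S.Sys} {q : ν → S.Sys}

theorem sum_univ_congr {α : Type} (i j : Fintype α) (f : α → ℝ) :
    @Finset.sum α ℝ _ (@Finset.univ α i) f = @Finset.sum α ℝ _ (@Finset.univ α j) f := by
  rw [Subsingleton.elim i j]

theorem comp_apply [Fintype κ] [i : Fintype (Bas t)] (N : Proc t r) (M : Proc s t) (b : Bas r)
    (a : Bas s) : Proc.comp N M b a = ∑ c, N b c * M c a :=
  sum_univ_congr _ _ _

theorem proc_ext {M N : Proc s t} (h : ∀ b a, M b a = N b a) : M = N :=
  funext fun b => funext fun a => h b a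

theorem comp_assoc [Fintype κ] [Fintype μ] (L : Proc r q) (N : Proc t r) (M : Proc s t) :
    Proc.comp L (Proc.comp N M) = Proc.comp (Proc.comp L N) M :=
  (Matrix.mul_assoc _ _ _).symm

theorem comp_sum [Fintype κ] {G : Type} [Fintype G] (N : Proc t r) (M : G → Proc s t) :
    Proc.comp N (∑ g, M g) = ∑ g, Proc.comp N (M g) := Matrix.mul_sum _ _ _

theorem sum_comp [Fintype κ] {G : Type} [Fintype G] (N : G → Proc t r) (M : Proc s t) :
    Proc.comp (∑ g, N g) M = ∑ g, Proc.comp (N g) M := Matrix.sum_mul _ _ _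

theorem comp_smul [Fintype κ] (N : Proc t r) (c : ℝ) (M : Proc s t) :
    Proc.comp N (c • M) = c • Proc.comp N M := Matrix.mul_smul _ _ _

theorem smul_comp [Fintype κ] (N : Proc t r) (c : ℝ) (M : Proc s t) :
    Proc.comp (c • N) M = c • Proc.comp N M := Matrix.smul_mul _ _ _

/-- The identity process. -/
def idProc {S : Systems.{u}} {ι : Type} (s : ι → S.Sys) : Proc s s :=
  fun b a => if b = a then 1 else 0

theorem id_comp [Fintype κ] (M : Proc s t) : Proc.comp (idProc t) M = M := by
  refine proc_ext fun b a => ?_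
  simp [comp_apply, idProc]

theorem comp_id [Fintype ι] (M : Proc s t) : Proc.comp M (idProc s) = M := by
  refine proc_ext fun b a => ?_
  simp [comp_apply, idProc]

end Algebra

theorem Theory.mem_of_eq {T : Theory.{u}} {ι κ : Type} [Fintype ι] [Fintype κ] {s : ι → T.Sys}
    {t : κ → T.Sys} {M N : Proc s t} (hM : M ∈ T.Chan s t) (h : ∀ b a, N b a = M b a) :
    N ∈ T.Chan s t := by
  rwa [proc_ext h]

/-! ### Closure of a process theory under reindexing, ancillas and mixtures. -/

section Closure

variable {T : Theory.{u}} {ι ι' κ κ' : Type} [Fintype ι] [Fintype ι'] [Fintype κ] [Fintype κ']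
  {s : ι → T.Sys} {s' : ι' → T.Sys} {t : κ → T.Sys} {t' : κ' → T.Sys}

/-- A form of `relabel` for composites whose components agree only up to a propositional equality;
coordinates are therefore compared by `HEq`. -/
theorem IsProcessTheory.relabel_mem (hT : IsProcessTheory T) (e : κ ≃ ι)
    (h : ∀ k, t k = s (e k)) (M : Proc s t)
    (hM : ∀ b a, M b a = if ∀ k, HEq (b k) (a (e k)) then 1 else 0) : M ∈ T.Chan s t := by
  obtain rfl : t = fun k => s (e k) := funext h
  convert hT.relabel e s
  ext b a
  simp [hM, Proc.relabel]

/-- Compose with a permutation of systems on either side: each permutation matrix leaves one term of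
the sum. -/
theorem IsProcessTheory.pullback_mem (hT : IsProcessTheory T) (φ : Reindex s s')
    (ψ : Reindex t t') {M : Proc s' t'} (hM : M ∈ T.Chan s' t') :
    (fun b a => M (ψ.map b) (φ.map a) : Proc s t) ∈ T.Chan s t := by
  have h1 : (fun b a => if b = φ.map a then 1 else 0 : Proc s s') ∈ T.Chan s s' := by
    refine hT.relabel_mem (Equiv.ofBijective φ.idx φ.bij) φ.sys_eq _ fun b a => ?_
    congr 1
    rw [eq_iff_iff, funext_iff]
    refine forall_congr' fun i => ?_
    rw [← heq_iff_eq]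
    exact ⟨fun h => h.trans (φ.heq a i), fun h => h.trans (φ.heq a i).symm⟩
  have h2 : (fun b a => if a = ψ.map b then 1 else 0 : Proc t' t) ∈ T.Chan t' t := by
    refine hT.relabel_mem (Equiv.ofBijective ψ.symm.idx ψ.symm.bij) ψ.symm.sys_eq _
      fun b a => ?_
    congr 1
    have h3 : a = ψ.map b ↔ b = ψ.symm.map a :=
      eq_comm.trans (Equiv.eq_symm_apply (Equiv.ofBijective ψ.map ψ.map_bijective)).symm
    rw [eq_iff_iff, h3, funext_iff]
    refine forall_congr' fun i => ?_
    rw [← heq_iff_eq]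
    exact ⟨fun h => h.trans (ψ.symm.heq a i), fun h => h.trans (ψ.symm.heq a i).symm⟩
  refine T.mem_of_eq (hT.comp h2 (hT.comp hM h1)) fun b a => ?_
  refine Eq.symm ((comp_apply _ _ _ _).trans ?_)
  rw [Finset.sum_eq_single (ψ.map b) (fun c _ hc => by rw [if_neg hc, zero_mul])
    (fun h => absurd (Finset.mem_univ _) h), if_pos rfl, one_mul]
  refine (comp_apply _ _ _ _).trans ?_
  rw [Finset.sum_eq_single (φ.map a) (fun c _ hc => by rw [if_neg hc, mul_zero])
    (fun h => absurd (Finset.mem_univ _) h), if_pos rfl, mul_one]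

/-- Pulling back along the inverse reindexings transports a process in the opposite direction. With
`pullback_mem`, this lets gates be replaced by processes between convenient composites, and
conversely. -/
theorem IsProcessTheory.exists_pullback (hT : IsProcessTheory T) (φ : Reindex s s')
    (ψ : Reindex t t') {M : Proc s t} (hM : M ∈ T.Chan s t) :
    ∃ M' ∈ T.Chan s' t', ∀ b a, M b a = M' (ψ.map b) (φ.map a) := by
  refine ⟨_, hT.pullback_mem φ.symm ψ.symm hM, fun b a => ?_⟩
  change _ = M ((Equiv.ofBijective ψ.map ψ.map_bijective).symm (ψ.map b))
    ((Equiv.ofBijective φ.map φ.map_bijective).symm (φ.map a))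
  rw [Equiv.ofBijective_symm_apply_apply ψ.map, Equiv.ofBijective_symm_apply_apply φ.map]

theorem IsProcessTheory.id_mem (hT : IsProcessTheory T) (s : ι → T.Sys) :
    idProc s ∈ T.Chan s s := by
  refine hT.relabel_mem (Equiv.refl _) (fun _ => rfl) _ fun b a => ?_
  simp [idProc, funext_iff]

theorem IsProcessTheory.mem_of_stochastic (hT : IsProcessTheory T) [Fintype (Bas t)]
    (hs : ∀ i, ∃ n, s i = .cl n) (ht : ∀ i, ∃ n, t i = .cl n) {M : Proc s t}
    (h0 : ∀ b a, 0 ≤ M b a) (h1 : ∀ a, ∑ b, M b a = 1) : M ∈ T.Chan s t := by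
  choose n hn using hs
  choose m hm using ht
  obtain rfl : s = fun i => .cl (n i) := funext hn
  obtain rfl : t = fun i => .cl (m i) := funext hm
  rw [hT.classical]
  exact ⟨h0, fun a => (sum_univ_congr _ _ _).trans (h1 a)⟩

theorem IsProcessTheory.stochastic_of_mem (hT : IsProcessTheory T) [Fintype (Bas t)]
    (hs : ∀ i, ∃ n, s i = .cl n) (ht : ∀ i, ∃ n, t i = .cl n) {M : Proc s t}
    (hM : M ∈ T.Chan s t) : (∀ b a, 0 ≤ M b a) ∧ ∀ a, ∑ b, M b a = 1 := by
  choose n hn using hs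
  choose m hm using ht
  obtain rfl : s = fun i => .cl (n i) := funext hn
  obtain rfl : t = fun i => .cl (m i) := funext hm
  rw [hT.classical] at hM
  exact ⟨hM.1, fun a => (sum_univ_congr _ _ _).trans (hM.2 a)⟩

/-- The joint coordinate of a composite of two composites. -/
def joinBas {S : Systems.{u}} {ι κ : Type} {s : ι → S.Sys} {t : κ → S.Sys} (a : Bas s)
    (b : Bas t) : Bas (Sum.elim s t)
  | .inl i => a i
  | .inr j => b j

/-- Coordinates of a composite of two composites. -/
def joinEquiv {S : Systems.{u}} {ι κ : Type} (s : ι → S.Sys) (t : κ → S.Sys) :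
    Bas s × Bas t ≃ Bas (Sum.elim s t) where
  toFun p := joinBas p.1 p.2
  invFun c := (fun i => c (.inl i), fun j => c (.inr j))
  left_inv _ := rfl
  right_inv c := by
    funext i
    cases i <;> rfl

theorem sum_joinBas {S : Systems.{u}} {ι κ : Type} {s : ι → S.Sys} {t : κ → S.Sys}
    [Fintype (Bas (Sum.elim s t))] [Fintype (Bas s)] [Fintype (Bas t)]
    (f : Bas (Sum.elim s t) → ℝ) : ∑ c, f c = ∑ a : Bas s, ∑ b : Bas t, f (joinBas a b) := by
  rw [← Fintype.sum_prod_type', ← (joinEquiv s t).sum_comp]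
  rfl

theorem forall_joinBas {S : Systems.{u}} {ι κ : Type} {s : ι → S.Sys} {t : κ → S.Sys}
    {p : Bas (Sum.elim s t) → Prop} : (∀ c, p c) ↔ ∀ a b, p (joinBas a b) :=
  ⟨fun h _ _ => h _, fun h c => by
    have := h ((joinEquiv s t).symm c).1 ((joinEquiv s t).symm c).2
    rwa [show joinBas _ _ = c from (joinEquiv s t).apply_symm_apply c] at this⟩

/-- The coordinate of the trivial system. -/
def trivBas {S : Systems.{u}} : Bas S.triv := fun e => e.elim

theorem eq_trivBas {S : Systems.{u}} (b : Bas S.triv) : b = trivBas := funext fun e => e.elim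

instance {S : Systems.{u}} : Unique (Bas S.triv) := ⟨⟨trivBas⟩, eq_trivBas⟩

theorem sum_triv {S : Systems.{u}} [Fintype (Bas S.triv)] (f : Bas S.triv → ℝ) :
    ∑ b, f b = f trivBas :=
  Fintype.sum_unique f

theorem par_joinBas {S : Systems.{u}} {ι κ ι' κ' : Type} {s : ι → S.Sys} {t : κ → S.Sys}
    {s' : ι' → S.Sys} {t' : κ' → S.Sys} (M : Proc s t) (N : Proc s' t') (b b' a a') :
    Proc.par M N (joinBas b b') (joinBas a a') = M b a * N b' a' := rfl

theorem par_comp_par {S : Systems.{u}} {ι κ ι' κ' μ μ' : Type} [Fintype κ] [Fintype κ']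
    {s : ι → S.Sys} {t : κ → S.Sys}
    {s' : ι' → S.Sys} {t' : κ' → S.Sys} {r : μ → S.Sys} {r' : μ' → S.Sys} (M : Proc s t)
    (N : Proc s' t') (M' : Proc t r) (N' : Proc t' r') :
    Proc.comp (Proc.par M' N') (Proc.par M N) =
      Proc.par (Proc.comp M' M) (Proc.comp N' N) := by
  refine proc_ext fun b a => ?_
  refine (comp_apply _ _ _ _).trans ((sum_joinBas _).trans (Eq.symm ?_))
  refine (congrArg₂ (· * ·) (comp_apply _ _ _ _) (comp_apply _ _ _ _)).trans ?_
  refine Finset.sum_mul_sum _ _ _ _ |>.trans ?_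
  exact Finset.sum_congr rfl fun x _ => Finset.sum_congr rfl fun y _ => mul_mul_mul_comm _ _ _ _

/-- The trivial system is a unit for composition of systems. -/
def Reindex.trivSum {S : Systems.{u}} {ι : Type} (s : ι → S.Sys) :
    Reindex s (Sum.elim S.triv s) where
  idx := Sum.elim (fun e => e.elim) id
  bij := ⟨by rintro (⟨⟨⟩⟩ | i) (⟨⟨⟩⟩ | j) h; exact congrArg _ h, fun i => ⟨.inr i, rfl⟩⟩
  sys_eq := by rintro (⟨⟨⟩⟩ | i); rfl
  map b := joinBas trivBas b
  heq b := by rintro (⟨⟨⟩⟩ | i); exact HEq.rfl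

/-- Adjoin the state `ω`. -/
def ancilla {S : Systems.{u}} {ι κ : Type} {r : κ → S.Sys} (ω : Proc S.triv r) (s : ι → S.Sys) :
    Proc s (Sum.elim r s) :=
  fun b a => ω (fun i => b (.inl i)) trivBas * idProc s (fun j => b (.inr j)) a

theorem IsProcessTheory.ancilla_mem (hT : IsProcessTheory T) {ω : Proc T.triv t}
    (hω : ω ∈ T.Chan T.triv t) (s : ι → T.Sys) : ancilla ω s ∈ T.Chan s (Sum.elim t s) :=
  T.mem_of_eq (hT.pullback_mem (Reindex.trivSum s) (Reindex.refl _) (hT.par hω (hT.id_mem s)))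
    fun b a => by
      refine congrArg₂ (· * ·) ?_ rfl
      exact congrArg (ω _) (eq_trivBas _).symm

theorem comp_ancilla_apply {S : Systems.{u}} {ι κ ι' : Type} [Fintype ι] [Fintype κ]
    {r : κ → S.Sys} {s : ι → S.Sys} {t : ι' → S.Sys}
    [Fintype (Bas r)] (M : Proc (Sum.elim r s) t) (ω : Proc S.triv r) (b : Bas t) (a : Bas s) :
    Proc.comp M (ancilla ω s) b a = ∑ c, M b (joinBas c a) * ω c trivBas := by
  refine (comp_apply _ _ _ _).trans ((sum_joinBas _).trans (Finset.sum_congr rfl fun c _ => ?_))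
  rw [Finset.sum_eq_single a]
  · exact congrArg _ (by simp [ancilla, idProc, joinBas])
  · intro x _ hx
    simp [ancilla, idProc, joinBas, hx]
  · exact fun h => absurd (Finset.mem_univ _) h

/-- The probability distribution `p`, as a state of a classical system. -/
def distState {S : Systems.{u}} {n : ℕ} (p : Fin (n + 1) → ℝ) :
    Proc S.triv (one (.cl n : S.Sys)) := fun b _ => p (b ())

theorem sum_one {S : Systems.{u}} {n : ℕ} [Fintype (Bas (one (.cl n : S.Sys)))]
    (f : Bas (one (.cl n : S.Sys)) → ℝ) :
    ∑ b, f b = ∑ x : Fin (n + 1), f fun _ => x :=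
  (sum_univ_congr _ (inferInstanceAs (Fintype (Unit → Fin (n + 1)))) f).trans
    (Fintype.sum_equiv (Equiv.funUnique Unit (Fin (n + 1))) _ (fun x => f fun _ => x) fun _ => rfl)

theorem IsProcessTheory.distState_mem (hT : IsProcessTheory T) {n : ℕ} {p : Fin (n + 1) → ℝ}
    (hp : ∀ x, 0 ≤ p x) (hp1 : ∑ x, p x = 1) :
    distState p ∈ T.Chan T.triv (one (.cl n)) := by
  exact hT.mem_of_stochastic (fun e => e.elim) (fun _ => ⟨n, rfl⟩) (fun b _ => hp _)
    fun a => (sum_one (S := T.toSystems) fun b => p (b ())).trans hp1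

/-- Fix the value of a classical input. -/
theorem IsProcessTheory.fix_mem (hT : IsProcessTheory T) {n : ℕ}
    {M : Proc (Sum.elim (one (.cl n)) s) t} (hM : M ∈ T.Chan _ _) (x : Fin (n + 1)) :
    (fun b a => M b (joinBas (fun _ => x) a) : Proc s t) ∈ T.Chan s t := by
  -- The value is fixed by feeding the point distribution at `x` into the classical input.
  refine T.mem_of_eq (hT.comp hM (hT.ancilla_mem
    (hT.distState_mem (p := Pi.single x 1) ?_ ?_) s)) fun b a => ?_
  · intro y
    by_cases h : y = x <;> simp [h]
  · simp [Pi.single_apply]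
  · rw [comp_ancilla_apply, sum_one, Finset.sum_eq_single x] <;> simp +contextual [distState]

/-- The valid processes are closed under convex mixtures. -/
theorem IsProcessTheory.mix_mem (hT : IsProcessTheory T) {n : ℕ} {E : Fin (n + 1) → Proc s t}
    (hE : ∀ x, E x ∈ T.Chan s t) {p : Fin (n + 1) → ℝ} (hp : ∀ x, 0 ≤ p x)
    (hp1 : ∑ x, p x = 1) : ∑ x, p x • E x ∈ T.Chan s t := by
  -- A controlled process whose control is in the state `p` is the mixture with the weights `p`.
  refine T.mem_of_eq (hT.comp (hT.control hE) (hT.ancilla_mem (hT.distState_mem hp hp1) s))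
    fun b a => ?_
  rw [comp_ancilla_apply, sum_one, Matrix.sum_apply]
  refine Finset.sum_congr rfl fun x _ => ?_
  rw [Matrix.smul_apply, smul_eq_mul, mul_comm]
  rfl

/-- The valid processes are closed under uniform mixtures. -/
theorem IsProcessTheory.average_mem (hT : IsProcessTheory T) {G : Type} [Fintype G] [Nonempty G]
    {E : G → Proc s t} (hE : ∀ x, E x ∈ T.Chan s t) :
    (Fintype.card G : ℝ)⁻¹ • ∑ g, E g ∈ T.Chan s t := by
  -- Classical systems have `n + 1` values, so `G` has to be enumerated by `Fin (n + 1)`; this is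
  -- where nonemptiness enters.
  obtain ⟨n, hn⟩ := Nat.exists_eq_succ_of_ne_zero (Fintype.card_ne_zero (α := G))
  let e : Fin (n + 1) ≃ G := (finCongr hn.symm).trans (Fintype.equivFin G).symm
  convert hT.mix_mem (p := fun _ => (Fintype.card G : ℝ)⁻¹) (fun x => hE (e x))
    (fun _ => by positivity) ?_
  · rw [← Finset.smul_sum, e.sum_comp]
  · simp only [Finset.sum_const, Finset.card_univ, Fintype.card_fin, nsmul_eq_mul]
    rw [hn]
    field_simp

end Closure

/-! ### Symmetrized theories -/

section Act

variable {S : Systems.{u}} {G : Type} {F : G → ∀ q : S.Q, Matrix (S.Idx q) (S.Idx q) ℝ}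
  {ι κ : Type} [Fintype ι] [Fintype κ] {s : ι → S.Sys} {t : κ → S.Sys}

theorem act_elim (g : G) : act F g (Sum.elim s t) = Proc.par (act F g s) (act F g t) :=
  proc_ext fun _ _ => Fintype.prod_sum_type _

theorem act_of_sysAct_one (g : G) (h : ∀ i, sysAct F g (s i) = 1) : act F g s = idProc s := by
  refine proc_ext fun b a => ?_
  by_cases hab : b = a
  · subst hab
    rw [idProc, if_pos rfl]
    refine Finset.prod_eq_one fun i _ => ?_
    rw [h]
    exact Matrix.one_apply_eq _
  · obtain ⟨i, hi⟩ := Function.ne_iff.1 hab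
    rw [idProc, if_neg hab]
    refine Finset.prod_eq_zero (Finset.mem_univ i) ?_
    rw [h]
    exact Matrix.one_apply_ne hi

theorem sysAct_cl (g : G) {a : S.Sys} (h : ∃ n, a = .cl n) : sysAct F g a = 1 := by
  obtain ⟨n, rfl⟩ := h
  change (1 : Matrix (Fin (n + 1)) (Fin (n + 1)) ℝ) = _
  ext i j
  by_cases hij : i = j
  · subst hij
    rw [Matrix.one_apply_eq]
    exact (Matrix.one_apply_eq (n := (Systems.Sys.cl n : S.Sys).Ix) i).symm
  · rw [Matrix.one_apply_ne hij]
    exact (Matrix.one_apply_ne (n := (Systems.Sys.cl n : S.Sys).Ix) hij).symm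

theorem act_classical (g : G) (h : ∀ i, ∃ n, s i = .cl n) : act F g s = idProc s :=
  act_of_sysAct_one g fun i => sysAct_cl g (h i)

theorem act_triv (g : G) : act F g S.triv = idProc S.triv :=
  act_of_sysAct_one g fun e => e.elim

end Act

theorem comp_par_id_left {S : Systems.{u}} {ι κ μ : Type} [Fintype ι] [Fintype κ]
    {s : ι → S.Sys} {t : κ → S.Sys} {r : μ → S.Sys} (M : Proc (Sum.elim t s) r)
    (N : Proc s s) (b : Bas r) (x : Bas t) (a : Bas s) :
    Proc.comp M (Proc.par (idProc t) N) b (joinBas x a) =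
      Proc.comp (fun b a => M b (joinBas x a) : Proc s r) N b a := by
  refine (comp_apply _ _ _ _).trans ((sum_joinBas _).trans ?_)
  rw [Finset.sum_eq_single x]
  · refine Eq.trans ?_ (comp_apply _ _ _ _).symm
    refine Finset.sum_congr rfl fun c _ => congrArg _ ?_
    rw [par_joinBas, idProc, if_pos rfl, one_mul]
  · intro y _ hy
    refine Finset.sum_eq_zero fun c _ => ?_
    rw [par_joinBas, idProc, if_neg hy, zero_mul, mul_zero]
  · exact fun h => absurd (Finset.mem_univ _) h

/-! ### Stability of covariance under the operations of a process theory. -/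

section Covariance

variable {S : Systems.{u}} {G : Type} {F : G → ∀ q : S.Q, Matrix (S.Idx q) (S.Idx q) ℝ}
  {ι κ ι' κ' μ : Type} [Fintype ι] [Fintype κ] [Fintype ι'] [Fintype κ'] [Fintype μ]
  {s : ι → S.Sys} {t : κ → S.Sys} {s' : ι' → S.Sys} {t' : κ' → S.Sys} {r : μ → S.Sys}

/-- The process `M` commutes with the collective action. -/
def Covariant (F : G → ∀ q : S.Q, Matrix (S.Idx q) (S.Idx q) ℝ) (M : Proc s t) : Prop :=
  ∀ g, Proc.comp (act F g t) M = Proc.comp M (act F g s)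

theorem Covariant.comp {N : Proc t r} {M : Proc s t} (hN : Covariant F N) (hM : Covariant F M) :
    Covariant F (Proc.comp N M) := fun g => by
  rw [comp_assoc, hN g, ← comp_assoc, hM g, comp_assoc]

theorem Covariant.par {M : Proc s t} {N : Proc s' t'} (hM : Covariant F M)
    (hN : Covariant F N) : Covariant F (Proc.par M N) := fun g => by
  rw [act_elim, act_elim, par_comp_par, par_comp_par, hM g, hN g]

theorem covariant_classical (hs : ∀ i, ∃ n, s i = .cl n) (ht : ∀ i, ∃ n, t i = .cl n)
    (M : Proc s t) : Covariant F M := fun g => by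
  rw [act_classical g hs, act_classical g ht, id_comp, comp_id]

/-- The group acts trivially on the control, so covariance can be checked for each of its values
separately. -/
theorem Covariant.control {n : ℕ} {E : Fin (n + 1) → Proc s t} (hE : ∀ x, Covariant F (E x)) :
    Covariant F (Proc.control E) := fun g => by
  refine proc_ext fun b => forall_joinBas.2 fun x a => ?_
  rw [act_elim, act_classical g (fun i => ⟨n, rfl⟩)]
  refine Eq.trans ?_ (comp_par_id_left _ _ _ _ _).symm
  refine Eq.trans ?_ (congrFun (congrFun (hE (x ()) g) b) a)
  exact (comp_apply _ _ _ _).trans (comp_apply _ _ _ _).symm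

/-- One term survives on each side, and the two survivors are the same product of matrix entries,
taken in a different order. -/
theorem covariant_relabel (e : κ ≃ ι) : Covariant F (Proc.relabel e s) := fun g => by
  refine proc_ext fun b a => ?_
  let φ : Reindex s (fun k => s (e k)) := ⟨e, e.bijective, fun _ => rfl, fun b k => b (e k),
    fun _ _ => HEq.rfl⟩
  obtain ⟨b, rfl⟩ := φ.map_bijective.2 b
  refine (comp_apply _ _ _ _).trans (Eq.trans ?_ (comp_apply _ _ _ _).symm)
  rw [Finset.sum_eq_single (φ.map a), Finset.sum_eq_single b]
  · rw [Proc.relabel, Proc.relabel, if_pos fun _ => rfl, if_pos fun _ => rfl, mul_one, one_mul]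
    exact e.prod_comp fun i => sysAct F g (s i) (b i) (a i)
  · intro c _ hc
    rw [Proc.relabel, if_neg, zero_mul]
    exact fun h => hc (φ.map_bijective.1 (funext h)).symm
  · exact fun h => absurd (Finset.mem_univ _) h
  · intro c _ hc
    rw [Proc.relabel, if_neg, mul_zero]
    exact fun h => hc (funext h)
  · exact fun h => absurd (Finset.mem_univ _) h

end Covariance

/-! ### Twirling, and the symmetrized theory as a process theory. -/

section Symmetry

variable {T : Theory.{u}} {G : Type} [Group G]
  {F : G → ∀ q : T.Q, Matrix (T.Idx q) (T.Idx q) ℝ}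

theorem IsSymmetry.sysAct_one (hF : IsSymmetry T F) (a : T.Sys) : sysAct F 1 a = 1 := by
  cases a with
  | cl n => exact sysAct_cl _ ⟨n, rfl⟩
  | gpt q =>
    exact (hF.map_one q).trans (by congr!)

theorem IsSymmetry.sysAct_mul (hF : IsSymmetry T F) (g h : G) (a : T.Sys) :
    sysAct F (g * h) a = sysAct F g a * sysAct F h a := by
  cases a with
  | cl n => rw [sysAct_cl _ ⟨n, rfl⟩, sysAct_cl _ ⟨n, rfl⟩, sysAct_cl _ ⟨n, rfl⟩, mul_one]
  | gpt q => exact hF.map_mul g h q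

variable {ι κ : Type} [Fintype ι] [Fintype κ] {s : ι → T.Sys} {t : κ → T.Sys}

theorem IsSymmetry.act_one (hF : IsSymmetry T F) : act F 1 s = idProc s :=
  act_of_sysAct_one _ fun _ => hF.sysAct_one _

theorem IsSymmetry.act_mul (hF : IsSymmetry T F) (g h : G) :
    act F (g * h) s = Proc.comp (act F g s) (act F h s) := by
  refine proc_ext fun b a => Eq.symm ((comp_apply _ _ _ _).trans ?_)
  simp only [act, hF.sysAct_mul, ← Finset.prod_mul_distrib]
  refine Eq.trans ?_ (Finset.prod_univ_sum (fun _ => Finset.univ)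
    fun i c => sysAct F g (s i) (b i) c * sysAct F h (s i) c (a i)).symm
  rw [Fintype.piFinset_univ]

theorem IsSymmetry.act_inv_comp (hF : IsSymmetry T F) (g : G) :
    Proc.comp (act F g⁻¹ s) (act F g s) = idProc s := by
  rw [← hF.act_mul, inv_mul_cancel, hF.act_one]

/-- The conjugate of a process by a symmetry transformation. -/
def conjAct (F : G → ∀ q : T.Q, Matrix (T.Idx q) (T.Idx q) ℝ) (g : G) (M : Proc s t) :
    Proc s t := Proc.comp (act F g t) (Proc.comp M (act F g⁻¹ s))

/-- Moving the action of `h` through a conjugate shifts the conjugating element by `h`; this makes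
averages over conjugates covariant. -/
theorem IsSymmetry.act_comp_conjAct (hF : IsSymmetry T F) (g h : G) (M : Proc s t) :
    Proc.comp (act F h t) (conjAct F g M) = Proc.comp (conjAct F (h * g) M) (act F h s) := by
  have h1 : act F g⁻¹ s = Proc.comp (act F (h * g)⁻¹ s) (act F h s) := by
    rw [← hF.act_mul]
    congr 1
    group
  rw [conjAct, conjAct, h1, hF.act_mul h g]
  simp only [comp_assoc]

/-- The average of a process over its conjugates. -/
def twirl [Fintype G] (F : G → ∀ q : T.Q, Matrix (T.Idx q) (T.Idx q) ℝ) (M : Proc s t) :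
    Proc s t := (Fintype.card G : ℝ)⁻¹ • ∑ g, conjAct F g M

/-- The average is valid because conjugates and uniform mixtures are, and covariant because left
translation permutes the summands. -/
theorem twirl_mem [Fintype G] (hT : IsProcessTheory T) (hF : IsSymmetry T F) {M : Proc s t}
    (hM : M ∈ T.Chan s t) : twirl F M ∈ (symmetrized T F).Chan s t := by
  refine ⟨hT.average_mem fun g => hF.conj g s t M hM, fun h => ?_⟩
  simp only [twirl, comp_smul, smul_comp, comp_sum, sum_comp, hF.act_comp_conjAct]
  congr 1
  exact Fintype.sum_equiv (Equiv.mulLeft h) _ _ fun _ => rfl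

/-- Every statement about process theories now applies to a theory and to its symmetrization alike.
The spanning axioms play no role here: invariant states need not span. -/
theorem IsProcessTheory.symmetrized {T : Theory.{u}} {G : Type}
    {F : G → ∀ q : T.Q, Matrix (T.Idx q) (T.Idx q) ℝ} (hT : IsProcessTheory T) :
    IsProcessTheory (symmetrized T F) where
  relabel e s := ⟨hT.relabel e s, covariant_relabel e⟩
  comp hN hM := ⟨hT.comp hN.1 hM.1, Covariant.comp (S := T.toSystems) hN.2 hM.2⟩
  par hM hN := ⟨hT.par hM.1 hN.1, Covariant.par (S := T.toSystems) hM.2 hN.2⟩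
  classical n m := Eq.trans (Set.ext fun M => and_iff_left (covariant_classical
    (S := T.toSystems) (fun i => ⟨n i, rfl⟩) (fun i => ⟨m i, rfl⟩) M)) (hT.classical n m)
  control hE := ⟨hT.control fun x => (hE x).1, Covariant.control (S := T.toSystems)
    fun x => (hE x).2⟩

end Symmetry

/-! ### Reindexing the wires at a gate -/

section Wires

variable {S : Systems.{u}}

/-- Composition of systems respects reindexing. -/
def Reindex.sum {ι ι' κ κ' : Type} {s : ι → S.Sys} {s' : ι' → S.Sys} {t : κ → S.Sys}
    {t' : κ' → S.Sys} (φ : Reindex s s') (ψ : Reindex t t') :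
    Reindex (Sum.elim s t) (Sum.elim s' t') where
  idx := Sum.map φ.idx ψ.idx
  bij := ⟨φ.bij.1.sumMap ψ.bij.1, φ.bij.2.sumMap ψ.bij.2⟩
  sys_eq := by rintro (i | i); exacts [φ.sys_eq i, ψ.sys_eq i]
  map b := joinBas (φ.map fun i => b (.inl i)) (ψ.map fun j => b (.inr j))
  heq b := by rintro (i | i); exacts [φ.heq _ i, ψ.heq _ i]

/-- Drop an empty composite on the left. -/
def Reindex.dropLeft {ι κ κ' : Type} {s : ι → S.Sys} {t : κ → S.Sys} {t' : κ' → S.Sys}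
    (h : ι → False) (ψ : Reindex t t') : Reindex (Sum.elim s t) t' where
  idx j := .inr (ψ.idx j)
  bij := ⟨Sum.inr_injective.comp ψ.bij.1, by
    rintro (i | i)
    · exact (h i).elim
    · obtain ⟨j, rfl⟩ := ψ.bij.2 i
      exact ⟨j, rfl⟩⟩
  sys_eq := ψ.sys_eq
  map b := ψ.map fun j => b (.inr j)
  heq b := ψ.heq _

/-- Drop an empty composite on the right. -/
def Reindex.dropRight {ι κ ι' : Type} {s : ι → S.Sys} {t : κ → S.Sys} {s' : ι' → S.Sys}
    (h : κ → False) (φ : Reindex s s') : Reindex (Sum.elim s t) s' where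
  idx j := .inl (φ.idx j)
  bij := ⟨Sum.inl_injective.comp φ.bij.1, by
    rintro (i | i)
    · obtain ⟨j, rfl⟩ := φ.bij.2 i
      exact ⟨j, rfl⟩
    · exact (h i).elim⟩
  sys_eq := φ.sys_eq
  map b := φ.map fun j => b (.inl j)
  heq b := φ.heq _

/-- An empty composite is the trivial system. -/
def Reindex.ofEmpty {ι : Type} (s : ι → S.Sys) (h : ι → False) : Reindex s S.triv where
  idx e := e.elim
  bij := ⟨fun e => e.elim, fun i => (h i).elim⟩
  sys_eq e := e.elim
  map _ := trivBas
  heq _ e := e.elim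

variable {V : Type}

/-- The classical systems of the variables with the property `p`. -/
abbrev obsSys (S : Systems.{u}) (p : V → Prop) (card : V → ℕ) : {v // p v} → S.Sys :=
  fun v => .cl (card v.1)

/-- The composite of all the systems on the wires with the property `p`. -/
abbrev wireSys (p : V → Prop) {len : V → ℕ} (sys : ∀ w, Fin (len w) → S.Sys) :
    (Σ w : {w // p w}, Fin (len w.1)) → S.Sys :=
  fun q => sys q.1.1 q.2

variable {p : V → Prop} {len : V → ℕ}

/-- Only one variable has the property `p`. -/
def Reindex.obsOne (card : V → ℕ) (v : V) (h : ∀ v', p v' ↔ v' = v) :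
    Reindex (obsSys S p card) (one (.cl (card v))) where
  idx _ := ⟨v, (h v).2 rfl⟩
  bij := ⟨fun _ _ _ => rfl, fun ⟨v', h'⟩ => ⟨(), Subtype.ext ((h v').1 h').symm⟩⟩
  sys_eq _ := rfl
  map b _ := b ⟨v, (h v).2 rfl⟩
  heq _ _ := HEq.rfl

/-- Only one wire has the property `p`. -/
def Reindex.wireOne (sys : ∀ w, Fin (len w) → S.Sys) (w : V) (h : ∀ w', p w' ↔ w' = w) :
    Reindex (wireSys p sys) (sys w) where
  idx j := ⟨⟨w, (h w).2 rfl⟩, j⟩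
  bij := ⟨fun i j hij => by simpa using hij, fun ⟨⟨w', h'⟩, j⟩ => by
    obtain rfl := (h w').1 h'
    exact ⟨j, rfl⟩⟩
  sys_eq _ := rfl
  map b j := b ⟨⟨w, (h w).2 rfl⟩, j⟩
  heq _ _ := HEq.rfl

/-- Only two wires have the property `p`. -/
def Reindex.wireTwo (sys : ∀ w, Fin (len w) → S.Sys) (w₀ w₁ : V) (hne : w₀ ≠ w₁)
    (h : ∀ w, p w ↔ w = w₀ ∨ w = w₁) :
    Reindex (wireSys p sys) (Sum.elim (sys w₀) (sys w₁)) where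
  idx := Sum.elim (fun j => ⟨⟨w₀, (h _).2 (.inl rfl)⟩, j⟩) fun j => ⟨⟨w₁, (h _).2 (.inr rfl)⟩, j⟩
  bij := by
    constructor
    · rintro (i | i) (j | j) hij
      · exact congrArg _ (by simpa using hij)
      · exact (hne (congrArg (fun q => q.1.1) hij)).elim
      · exact (hne (congrArg (fun q => q.1.1) hij).symm).elim
      · exact congrArg _ (by simpa using hij)
    · rintro ⟨⟨w, hw⟩, j⟩
      obtain rfl | rfl := (h w).1 hw
      exacts [⟨.inl j, rfl⟩, ⟨.inr j, rfl⟩]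
  sys_eq := by rintro (i | i) <;> rfl
  map b := joinBas (fun j => b ⟨⟨w₀, (h _).2 (.inl rfl)⟩, j⟩)
    fun j => b ⟨⟨w₁, (h _).2 (.inr rfl)⟩, j⟩
  heq b := by rintro (i | i) <;> exact HEq.rfl

variable (C : CausalStructure) (card : C.Out ⊕ C.In → ℕ) {len : C.Latent → ℕ}
  (sys : ∀ w, Fin (len w) → S.Sys) (g : C.Gate)

/-- Inputs of the gate `g`. -/
abbrev gateIn := Sum.elim (obsSys S (· ∈ C.reads g) card) (wireSys (C.tgt · = g) sys)

/-- Outputs of the gate `g`. -/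
abbrev gateOut := Sum.elim (obsSys S (C.origin · = g) fun o => card (.inl o))
  (wireSys (C.src · = g) sys)

end Wires

/-! ### The Bell scenario -/

section BellForm

/-- The probability of the outcomes `x`, `y` when the parties measure `M`, `N` on the state `ρ`. -/
def bellProb {S : Systems.{u}} {ι κ : Type} [Fintype ι] [Fintype κ] {s : ι → S.Sys}
    {t : κ → S.Sys} {nx ny : ℕ} (ρ : Proc S.triv (Sum.elim s t))
    (M : Proc s (one (.cl nx))) (N : Proc t (one (.cl ny))) (x : Fin (nx + 1))
    (y : Fin (ny + 1)) : ℝ :=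
  Proc.comp (Proc.par M N) ρ (joinBas (fun _ => x) fun _ => y) trivBas

theorem bellProb_eq {S : Systems.{u}} {ι κ : Type} [Fintype ι] [Fintype κ] {s : ι → S.Sys}
    {t : κ → S.Sys} [Fintype (Bas s)] [Fintype (Bas t)] {nx ny : ℕ}
    (ρ : Proc S.triv (Sum.elim s t)) (M : Proc s (one (.cl nx))) (N : Proc t (one (.cl ny)))
    (x : Fin (nx + 1)) (y : Fin (ny + 1)) :
    bellProb ρ M N x y =
      ∑ a, ∑ b, M (fun _ => x) a * N (fun _ => y) b * ρ (joinBas a b) trivBas :=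
  (comp_apply _ _ _ _).trans (sum_joinBas _)

/-- `Q` is the family of distributions `Q x y i j` of outcomes `x`, `y` given settings `i`, `j`
that arise from local measurements on a bipartite state of the theory `T`. -/
def BellForm (T : Theory.{u}) {nx ny ni nj : ℕ}
    (Q : Fin (nx + 1) → Fin (ny + 1) → Fin (ni + 1) → Fin (nj + 1) → ℝ) : Prop :=
  ∃ (k l : ℕ) (s : Fin k → T.Sys) (t : Fin l → T.Sys) (ρ : Proc T.triv (Sum.elim s t))
    (M : Fin (ni + 1) → Proc s (one (.cl nx))) (N : Fin (nj + 1) → Proc t (one (.cl ny))),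
    ρ ∈ T.Chan T.triv (Sum.elim s t) ∧ (∀ i, M i ∈ T.Chan s (one (.cl nx))) ∧
    (∀ j, N j ∈ T.Chan t (one (.cl ny))) ∧
    ∀ x y i j, Q x y i j = bellProb ρ (M i) (N j) x y

variable {T : Theory.{u}}

/-- Relabel a family of systems by a finite ordinal. -/
def Reindex.fin {S : Systems.{u}} {ι : Type} [Fintype ι] (s : ι → S.Sys) :
    Reindex s (fun j : Fin (Fintype.card ι) => s ((Fintype.equivFin ι).symm j)) where
  idx := (Fintype.equivFin ι).symm
  bij := Equiv.bijective _
  sys_eq _ := rfl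
  map b _ := b _
  heq _ _ := HEq.rfl

/-- `BellForm` insists on composites indexed by `Fin k`; relabelling the two parties' systems
removes this restriction. -/
theorem bellForm_of (hT : IsProcessTheory T) {ι κ : Type} [Fintype ι] [Fintype κ]
    {s : ι → T.Sys} {t : κ → T.Sys} {nx ny ni nj : ℕ} {ρ : Proc T.triv (Sum.elim s t)}
    {M : Fin (ni + 1) → Proc s (one (.cl nx))} {N : Fin (nj + 1) → Proc t (one (.cl ny))}
    (hρ : ρ ∈ T.Chan T.triv (Sum.elim s t)) (hM : ∀ i, M i ∈ T.Chan s (one (.cl nx)))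
    (hN : ∀ j, N j ∈ T.Chan t (one (.cl ny))) :
    BellForm T fun x y i j => bellProb ρ (M i) (N j) x y := by
  let φ := Reindex.fin s
  let ψ := Reindex.fin t
  obtain ⟨ρ', hρ', h1⟩ := hT.exists_pullback (Reindex.refl _) (φ.sum ψ) hρ
  choose M' hM' h2 using fun i => hT.exists_pullback φ (Reindex.refl _) (hM i)
  choose N' hN' h3 using fun j => hT.exists_pullback ψ (Reindex.refl _) (hN j)
  refine ⟨_, _, _, _, ρ', M', N', hρ', hM', hN', fun x y i j => ?_⟩
  refine (bellProb_eq _ _ _ _ _).trans (Eq.trans ?_ (bellProb_eq _ _ _ _ _).symm)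
  refine Fintype.sum_bijective _ φ.map_bijective _ _ fun a => ?_
  refine Fintype.sum_bijective _ ψ.map_bijective _ _ fun b => ?_
  exact congrArg₂ (· * ·) (congrArg₂ (· * ·) (h2 i _ _) (h3 j _ _)) (h1 _ _)

end BellForm

/-! ### Gates with one setting, one latent input and one outcome; bipartite sources -/

section Gates

variable {T : Theory.{u}} {C : CausalStructure}
  {card : C.Out ⊕ C.In → ℕ} {len : C.Latent → ℕ} {sys : ∀ w, Fin (len w) → T.Sys} {g : C.Gate}

/-- The gate `g` reads only `v`, receives only the wire `w`, and produces only `o`. -/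
structure IsMeasurement (C : CausalStructure) (g : C.Gate) (v : C.Out ⊕ C.In) (w : C.Latent)
    (o : C.Out) : Prop where
  reads : ∀ v', v' ∈ C.reads g ↔ v' = v
  tgt : ∀ w', C.tgt w' = g ↔ w' = w
  origin : ∀ o', C.origin o' = g ↔ o' = o
  src : ∀ w', C.src w' ≠ g

/-- The gate `g` emits only the wires `w₀` and `w₁`, and has no inputs or outcomes. -/
structure IsSource (C : CausalStructure) (g : C.Gate) (w₀ w₁ : C.Latent) : Prop where
  ne : w₀ ≠ w₁
  reads : ∀ v', v' ∉ C.reads g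
  tgt : ∀ w', C.tgt w' ≠ g
  origin : ∀ o', C.origin o' ≠ g
  src : ∀ w', C.src w' = g ↔ w' = w₀ ∨ w' = w₁

variable {v : C.Out ⊕ C.In} {w w₀ w₁ : C.Latent} {o : C.Out}

/-- The inputs of a measurement. -/
def IsMeasurement.inMap (h : IsMeasurement C g v w o) (card : C.Out ⊕ C.In → ℕ)
    (sys : ∀ w, Fin (len w) → T.Sys) :
    Reindex (gateIn C card sys g) (Sum.elim (one (.cl (card v))) (sys w)) :=
  (Reindex.obsOne card v h.reads).sum (Reindex.wireOne sys w h.tgt)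

/-- The outputs of a measurement. -/
def IsMeasurement.outMap (h : IsMeasurement C g v w o) (card : C.Out ⊕ C.In → ℕ)
    (sys : ∀ w, Fin (len w) → T.Sys) :
    Reindex (gateOut C card sys g) (one (.cl (card (.inl o)))) :=
  (Reindex.obsOne (fun o => card (.inl o)) o h.origin).dropRight fun q => h.src _ q.1.2

/-- The inputs of a source. -/
def IsSource.inMap (h : IsSource C g w₀ w₁) (card : C.Out ⊕ C.In → ℕ)
    (sys : ∀ w, Fin (len w) → T.Sys) : Reindex (gateIn C card sys g) T.triv :=
  Reindex.ofEmpty _ (Sum.rec (fun v => h.reads _ v.2) fun q => h.tgt _ q.1.2)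

/-- The outputs of a source. -/
def IsSource.outMap (h : IsSource C g w₀ w₁) (card : C.Out ⊕ C.In → ℕ)
    (sys : ∀ w, Fin (len w) → T.Sys) :
    Reindex (gateOut C card sys g) (Sum.elim (sys w₀) (sys w₁)) :=
  (Reindex.wireTwo sys w₀ w₁ h.ne h.src).dropLeft fun o => h.origin _ o.2

/-- Joint values at the inputs of a gate. -/
abbrev inVal (l : ∀ w, Bas (sys w)) (o : C.OutVals card) (i : C.InVals card) (g : C.Gate) :
    Bas (gateIn C card sys g)
  | .inl v => CausalStructure.vals o i v.1
  | .inr p => l p.1.1 p.2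

/-- Joint values at the outputs of a gate. -/
abbrev outVal (l : ∀ w, Bas (sys w)) (o : C.OutVals card) (g : C.Gate) :
    Bas (gateOut C card sys g)
  | .inl v => o v.1
  | .inr p => l p.1.1 p.2

theorem Circuit.prob_eq (K : Circuit T C card) (o : C.OutVals card) (i : C.InVals card) :
    K.prob o i = ∑ l : (∀ w, Bas (K.sys w)), ∏ g, K.gate g (outVal l o g) (inVal l o i g) := by
  refine Finset.sum_congr rfl fun l _ => Finset.prod_congr rfl fun g _ => ?_
  congr 1
  · funext b
    rcases b with b | b <;> rfl
  · funext b
    rcases b with b | b <;> rfl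

/-- A gate with a classical input is interchangeable with a family of processes: fixing the input
gives the family, classical control restores the gate. The lemmas for measurements and sources
express this in the coordinates that occur in `Circuit.prob`. -/
theorem IsMeasurement.exists_family (h : IsMeasurement C g v w o) (hT : IsProcessTheory T)
    {M : Proc (gateIn C card sys g) (gateOut C card sys g)} (hM : M ∈ T.Chan _ _) :
    ∃ M' : Fin (card v + 1) → Proc (sys w) (one (.cl (card (.inl o)))),
      (∀ x, M' x ∈ T.Chan _ _) ∧ ∀ l x i, M (outVal l x g) (inVal l x i g) =
        M' (CausalStructure.vals x i v) (fun _ => x o) (l w) := by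
  obtain ⟨M', hM', h1⟩ := hT.exists_pullback (h.inMap card sys) (h.outMap card sys) hM
  exact ⟨fun x b a => M' b (joinBas (fun _ => x) a), fun x => hT.fix_mem hM' x,
    fun l x i => h1 _ _⟩

theorem IsMeasurement.exists_gate (h : IsMeasurement C g v w o) (hT : IsProcessTheory T)
    {M : Fin (card v + 1) → Proc (sys w) (one (.cl (card (.inl o))))}
    (hM : ∀ x, M x ∈ T.Chan _ _) :
    ∃ M' : Proc (gateIn C card sys g) (gateOut C card sys g), M' ∈ T.Chan _ _ ∧
      ∀ l x i, M' (outVal l x g) (inVal l x i g) =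
        M (CausalStructure.vals x i v) (fun _ => x o) (l w) :=
  ⟨_, hT.pullback_mem (h.inMap card sys) (h.outMap card sys) (hT.control hM), fun _ _ _ => rfl⟩

theorem IsSource.exists_state (h : IsSource C g w₀ w₁) (hT : IsProcessTheory T)
    {M : Proc (gateIn C card sys g) (gateOut C card sys g)} (hM : M ∈ T.Chan _ _) :
    ∃ ρ ∈ T.Chan T.triv (Sum.elim (sys w₀) (sys w₁)), ∀ l x i,
      M (outVal l x g) (inVal l x i g) = ρ (joinBas (l w₀) (l w₁)) trivBas := by
  obtain ⟨ρ, hρ, h1⟩ := hT.exists_pullback (h.inMap card sys) (h.outMap card sys) hM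
  exact ⟨ρ, hρ, fun l x i => h1 _ _⟩

theorem IsSource.exists_gate (h : IsSource C g w₀ w₁) (hT : IsProcessTheory T)
    {ρ : Proc T.triv (Sum.elim (sys w₀) (sys w₁))} (hρ : ρ ∈ T.Chan _ _) :
    ∃ M : Proc (gateIn C card sys g) (gateOut C card sys g), M ∈ T.Chan _ _ ∧
      ∀ l x i, M (outVal l x g) (inVal l x i g) = ρ (joinBas (l w₀) (l w₁)) trivBas :=
  ⟨_, hT.pullback_mem (h.inMap card sys) (h.outMap card sys) hρ, fun _ _ _ => rfl⟩

end Gates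

/-! ### Circuits on the Bell scenario. -/

section BellCircuit

theorem bell_source : IsSource Bell (0 : Fin 3) (0 : Fin 2) (1 : Fin 2) where
  ne := show (0 : Fin 2) ≠ 1 by decide
  reads _ h := h
  tgt := show ∀ w : Fin 2, (![1, 2] w : Fin 3) ≠ 0 by decide
  origin := show ∀ w : Fin 2, (![1, 2] w : Fin 3) ≠ 0 by decide
  src := show ∀ w : Fin 2, (![0, 0] w : Fin 3) = 0 ↔ w = 0 ∨ w = 1 by decide

theorem bell_left :
    IsMeasurement Bell (1 : Fin 3) (.inr (0 : Fin 2)) (0 : Fin 2) (0 : Fin 2) where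
  reads _ := Iff.rfl
  tgt := show ∀ w : Fin 2, (![1, 2] w : Fin 3) = 1 ↔ w = 0 by decide
  origin := show ∀ w : Fin 2, (![1, 2] w : Fin 3) = 1 ↔ w = 0 by decide
  src := show ∀ w : Fin 2, (![0, 0] w : Fin 3) ≠ 1 by decide

theorem bell_right :
    IsMeasurement Bell (2 : Fin 3) (.inr (1 : Fin 2)) (1 : Fin 2) (1 : Fin 2) where
  reads _ := Iff.rfl
  tgt := show ∀ w : Fin 2, (![1, 2] w : Fin 3) = 2 ↔ w = 1 by decide
  origin := show ∀ w : Fin 2, (![1, 2] w : Fin 3) = 2 ↔ w = 1 by decide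
  src := show ∀ w : Fin 2, (![0, 0] w : Fin 3) ≠ 2 by decide

/-- Two-component dependent tuples are pairs. -/
def finTwoPiEquiv (α : Fin 2 → Type) : (∀ w, α w) ≃ α 0 × α 1 where
  toFun l := (l 0, l 1)
  invFun p := fun | 0 => p.1 | 1 => p.2
  left_inv l := by funext w; match w with | 0 => rfl | 1 => rfl
  right_inv _ := rfl

theorem sum_pi_two {W : Type} (e : Fin 2 ≃ W) {α : W → Type} {_ : Fintype (α (e 0))}
    {_ : Fintype (α (e 1))} {_ : Fintype (∀ w, α w)} (f : α (e 0) → α (e 1) → ℝ) :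
    ∑ l : (∀ w, α w), f (l (e 0)) (l (e 1)) = ∑ a, ∑ b, f a b := by
  rw [← Fintype.sum_prod_type']
  exact Fintype.sum_equiv ((Equiv.piCongrLeft' α e.symm).trans (finTwoPiEquiv fun i => α (e i)))
    _ _ fun _ => rfl

/-- Assembles gates that were constructed one at a time; as no wire is stipulated to be classical,
there is no further constraint on their systems. -/
theorem exists_circuit {T : Theory.{u}} {C : CausalStructure} (hC : C.stipulatedClassical = ∅)
    {card : C.Out ⊕ C.In → ℕ} {len : C.Latent → ℕ} {sys : ∀ w, Fin (len w) → T.Sys}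
    {val : C.Gate → (∀ w, Bas (sys w)) → C.OutVals card → C.InVals card → ℝ}
    (h : ∀ g, ∃ M : Proc (gateIn C card sys g) (gateOut C card sys g), M ∈ T.Chan _ _ ∧
      ∀ l x i, M (outVal l x g) (inVal l x i g) = val g l x i) :
    ∃ K : Circuit T C card, ∀ o i, K.prob o i = ∑ l, ∏ g, val g l o i := by
  choose M hM h1 using h
  refine ⟨⟨len, sys, fun w hw => by simp [hC] at hw, M, hM⟩, fun o i => ?_⟩
  refine (Circuit.prob_eq _ o i).trans ?_
  exact Finset.sum_congr rfl fun l _ => Finset.prod_congr rfl fun g _ => h1 g l o i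

theorem sum_prod_bell {S : Systems.{u}} {C : CausalStructure} (eL : Fin 2 ≃ C.Latent)
    (eG : Fin 3 ≃ C.Gate) {len : C.Latent → ℕ} {sys : ∀ w, Fin (len w) → S.Sys} {nx ny : ℕ}
    {ρ : Proc S.triv (Sum.elim (sys (eL 0)) (sys (eL 1)))} {M : Proc (sys (eL 0)) (one (.cl nx))}
    {N : Proc (sys (eL 1)) (one (.cl ny))} {x : Fin (nx + 1)} {y : Fin (ny + 1)}
    {val : C.Gate → (∀ w, Bas (sys w)) → ℝ}
    (h0 : ∀ l, val (eG 0) l = ρ (joinBas (l (eL 0)) (l (eL 1))) trivBas)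
    (h1 : ∀ l, val (eG 1) l = M (fun _ => x) (l (eL 0)))
    (h2 : ∀ l, val (eG 2) l = N (fun _ => y) (l (eL 1))) :
    ∑ l, ∏ g, val g l = bellProb ρ M N x y := by
  rw [bellProb_eq]
  refine Eq.trans (Finset.sum_congr rfl fun l _ => ?_) (sum_pi_two (α := fun w => Bas (sys w)) eL
    fun a b => M (fun _ => x) a * N (fun _ => y) b * ρ (joinBas a b) trivBas)
  rw [← eG.prod_comp, Fin.prod_univ_three, h0, h1, h2]
  ring

/-- From here on circuits on the Bell scenario can be forgotten in favour of `BellForm`. -/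
theorem mem_realizable_bell_iff {T : Theory.{u}} (hT : IsProcessTheory T)
    (card : Bell.Out ⊕ Bell.In → ℕ) (P : Bell.OutVals card → Bell.InVals card → ℝ) :
    (⟨card, P⟩ : Bell.Corr) ∈ realizable T Bell ↔
      ∃ Q : Fin (card (.inl (0 : Fin 2)) + 1) → Fin (card (.inl (1 : Fin 2)) + 1) →
          Fin (card (.inr (0 : Fin 2)) + 1) → Fin (card (.inr (1 : Fin 2)) + 1) → ℝ,
        BellForm T Q ∧ ∀ o i, P o i =
          Q (o (0 : Fin 2)) (o (1 : Fin 2)) (i (0 : Fin 2)) (i (1 : Fin 2)) := by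
  constructor
  · rintro ⟨K, hK⟩
    obtain ⟨ρ, hρ, h0⟩ := bell_source.exists_state hT (K.valid (0 : Fin 3))
    obtain ⟨M, hM, h1⟩ := bell_left.exists_family hT (K.valid (1 : Fin 3))
    obtain ⟨N, hN, h2⟩ := bell_right.exists_family hT (K.valid (2 : Fin 3))
    refine ⟨fun x y i j => bellProb ρ (M i) (N j) x y, bellForm_of hT hρ hM hN,
      fun o i => (hK o i).trans ((K.prob_eq o i).trans ?_)⟩
    exact sum_prod_bell (C := Bell) (Equiv.refl (Fin 2)) (Equiv.refl (Fin 3))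
      (fun l => h0 l o i) (fun l => h1 l o i) fun l => h2 l o i
  · rintro ⟨Q, ⟨k, l, s, t, ρ, M, N, hρ, hM, hN, hQ⟩, hP⟩
    let len : Fin 2 → ℕ := ![k, l]
    let sys : ∀ w : Fin 2, Fin (len w) → T.Sys := fun | 0 => s | 1 => t
    obtain ⟨g0, hg0, h0⟩ := bell_source.exists_gate (card := card) (sys := sys) hT hρ
    obtain ⟨g1, hg1, h1⟩ := bell_left.exists_gate (card := card) (sys := sys) hT hM
    obtain ⟨g2, hg2, h2⟩ := bell_right.exists_gate (card := card) (sys := sys) hT hN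
    obtain ⟨K, hK⟩ := exists_circuit (C := Bell) (card := card) (sys := sys) (T := T) rfl
      (val := fun g : Fin 3 => match g with
        | 0 => fun l _ _ => ρ (joinBas (l (0 : Fin 2)) (l (1 : Fin 2))) trivBas
        | 1 => fun l o i => M (i (0 : Fin 2)) (fun _ => o (0 : Fin 2)) (l (0 : Fin 2))
        | 2 => fun l o i => N (i (1 : Fin 2)) (fun _ => o (1 : Fin 2)) (l (1 : Fin 2)))
      (fun g : Fin 3 => match g with
        | 0 => ⟨g0, hg0, h0⟩ | 1 => ⟨g1, hg1, h1⟩ | 2 => ⟨g2, hg2, h2⟩)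
    refine ⟨K, fun o i => (hP o i).trans ((hQ _ _ _ _).trans (Eq.symm ((hK o i).trans ?_)))⟩
    exact sum_prod_bell (C := Bell) (Equiv.refl (Fin 2)) (Equiv.refl (Fin 3))
      (fun l => rfl) (fun l => rfl) fun l => rfl

end BellCircuit

/-! ### The structure with two districts -/

section DoubleBellCircuit

theorem doubleBell_source₀ : IsSource DoubleBell (0 : Fin 6) (0 : Fin 4) (1 : Fin 4) where
  ne := show (0 : Fin 4) ≠ 1 by decide
  reads _ h := h
  tgt := show ∀ w : Fin 4, (![3, 5, 2, 4] w : Fin 6) ≠ 0 by decide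
  origin := show ∀ w : Fin 4, (![2, 3, 4, 5] w : Fin 6) ≠ 0 by decide
  src := show ∀ w : Fin 4, (![0, 0, 1, 1] w : Fin 6) = 0 ↔ w = 0 ∨ w = 1 by decide

theorem doubleBell_source₁ : IsSource DoubleBell (1 : Fin 6) (2 : Fin 4) (3 : Fin 4) where
  ne := show (2 : Fin 4) ≠ 3 by decide
  reads _ h := h
  tgt := show ∀ w : Fin 4, (![3, 5, 2, 4] w : Fin 6) ≠ 1 by decide
  origin := show ∀ w : Fin 4, (![2, 3, 4, 5] w : Fin 6) ≠ 1 by decide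
  src := show ∀ w : Fin 4, (![0, 0, 1, 1] w : Fin 6) = 1 ↔ w = 2 ∨ w = 3 by decide

theorem doubleBell_gate₂ :
    IsMeasurement DoubleBell (2 : Fin 6) (.inr (0 : Fin 1)) (2 : Fin 4) (0 : Fin 4) where
  reads _ := Iff.rfl
  tgt := show ∀ w : Fin 4, (![3, 5, 2, 4] w : Fin 6) = 2 ↔ w = 2 by decide
  origin := show ∀ w : Fin 4, (![2, 3, 4, 5] w : Fin 6) = 2 ↔ w = 0 by decide
  src := show ∀ w : Fin 4, (![0, 0, 1, 1] w : Fin 6) ≠ 2 by decide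

theorem doubleBell_gate₃ :
    IsMeasurement DoubleBell (3 : Fin 6) (.inl (0 : Fin 4)) (0 : Fin 4) (1 : Fin 4) where
  reads _ := Iff.rfl
  tgt := show ∀ w : Fin 4, (![3, 5, 2, 4] w : Fin 6) = 3 ↔ w = 0 by decide
  origin := show ∀ w : Fin 4, (![2, 3, 4, 5] w : Fin 6) = 3 ↔ w = 1 by decide
  src := show ∀ w : Fin 4, (![0, 0, 1, 1] w : Fin 6) ≠ 3 by decide

theorem doubleBell_gate₄ :
    IsMeasurement DoubleBell (4 : Fin 6) (.inl (1 : Fin 4)) (3 : Fin 4) (2 : Fin 4) where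
  reads _ := Iff.rfl
  tgt := show ∀ w : Fin 4, (![3, 5, 2, 4] w : Fin 6) = 4 ↔ w = 3 by decide
  origin := show ∀ w : Fin 4, (![2, 3, 4, 5] w : Fin 6) = 4 ↔ w = 2 by decide
  src := show ∀ w : Fin 4, (![0, 0, 1, 1] w : Fin 6) ≠ 4 by decide

theorem doubleBell_gate₅ :
    IsMeasurement DoubleBell (5 : Fin 6) (.inl (2 : Fin 4)) (1 : Fin 4) (3 : Fin 4) where
  reads _ := Iff.rfl
  tgt := show ∀ w : Fin 4, (![3, 5, 2, 4] w : Fin 6) = 5 ↔ w = 1 by decide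
  origin := show ∀ w : Fin 4, (![2, 3, 4, 5] w : Fin 6) = 5 ↔ w = 3 by decide
  src := show ∀ w : Fin 4, (![0, 0, 1, 1] w : Fin 6) ≠ 5 by decide

/-- Four-component dependent tuples are quadruples. -/
def finFourPiEquiv (α : Fin 4 → Type) : (∀ w, α w) ≃ α 0 × α 1 × α 2 × α 3 where
  toFun l := (l 0, l 1, l 2, l 3)
  invFun p := fun | 0 => p.1 | 1 => p.2.1 | 2 => p.2.2.1 | 3 => p.2.2.2
  left_inv l := by funext w; match w with | 0 => rfl | 1 => rfl | 2 => rfl | 3 => rfl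
  right_inv _ := rfl

/-- The contraction splits since no factor involves wires of both sources. -/
theorem sum_pi_four {W : Type} (e : Fin 4 ≃ W) {α : W → Type} {_ : Fintype (α (e 0))}
    {_ : Fintype (α (e 1))} {_ : Fintype (α (e 2))} {_ : Fintype (α (e 3))}
    {_ : Fintype (∀ w, α w)} (f : α (e 0) → α (e 1) → ℝ) (h : α (e 2) → α (e 3) → ℝ) :
    ∑ l : (∀ w, α w), f (l (e 0)) (l (e 1)) * h (l (e 2)) (l (e 3)) =
      (∑ a, ∑ b, f a b) * ∑ a, ∑ b, h a b := by
  rw [← Fintype.sum_prod_type', ← Fintype.sum_prod_type', Finset.sum_mul_sum,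
    ← Fintype.sum_prod_type']
  exact Fintype.sum_equiv (((Equiv.piCongrLeft' α e.symm).trans
    (finFourPiEquiv fun i => α (e i))).trans (Equiv.prodAssoc _ _ _).symm) _ _ fun _ => rfl

theorem sum_prod_doubleBell {S : Systems.{u}} {C : CausalStructure} (eL : Fin 4 ≃ C.Latent)
    (eG : Fin 6 ≃ C.Gate) {len : C.Latent → ℕ} {sys : ∀ w, Fin (len w) → S.Sys} {nb nc nd ne : ℕ}
    {ρ₁ : Proc S.triv (Sum.elim (sys (eL 0)) (sys (eL 1)))}
    {ρ₂ : Proc S.triv (Sum.elim (sys (eL 2)) (sys (eL 3)))}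
    {M₁ : Proc (sys (eL 0)) (one (.cl nc))} {N₁ : Proc (sys (eL 1)) (one (.cl ne))}
    {M₂ : Proc (sys (eL 2)) (one (.cl nb))} {N₂ : Proc (sys (eL 3)) (one (.cl nd))}
    {b : Fin (nb + 1)} {c : Fin (nc + 1)} {d : Fin (nd + 1)} {e : Fin (ne + 1)}
    {val : C.Gate → (∀ w, Bas (sys w)) → ℝ}
    (h0 : ∀ l, val (eG 0) l = ρ₁ (joinBas (l (eL 0)) (l (eL 1))) trivBas)
    (h1 : ∀ l, val (eG 1) l = ρ₂ (joinBas (l (eL 2)) (l (eL 3))) trivBas)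
    (h2 : ∀ l, val (eG 2) l = M₂ (fun _ => b) (l (eL 2)))
    (h3 : ∀ l, val (eG 3) l = M₁ (fun _ => c) (l (eL 0)))
    (h4 : ∀ l, val (eG 4) l = N₂ (fun _ => d) (l (eL 3)))
    (h5 : ∀ l, val (eG 5) l = N₁ (fun _ => e) (l (eL 1))) :
    ∑ l, ∏ g, val g l = bellProb ρ₁ M₁ N₁ c e * bellProb ρ₂ M₂ N₂ b d := by
  rw [bellProb_eq, bellProb_eq]
  refine Eq.trans (Finset.sum_congr rfl fun l _ => ?_) (sum_pi_four (α := fun w => Bas (sys w)) eL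
    (fun x y => M₁ (fun _ => c) x * N₁ (fun _ => e) y * ρ₁ (joinBas x y) trivBas)
    (fun x y => M₂ (fun _ => b) x * N₂ (fun _ => d) y * ρ₂ (joinBas x y) trivBas))
  rw [← eG.prod_comp, Fin.prod_univ_six, h0, h1, h2, h3, h4, h5]
  ring

/-- The two sources feed disjoint sets of gates, so the contraction is a product of two Bell
probabilities. The factors interact only through the observed variables: the outcomes B and D of one
are the settings of the other, whose outcome C is in turn a setting of the first. -/
theorem mem_realizable_doubleBell_iff {T : Theory.{u}} (hT : IsProcessTheory T)
    (card : DoubleBell.Out ⊕ DoubleBell.In → ℕ)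
    (P : DoubleBell.OutVals card → DoubleBell.InVals card → ℝ) :
    (⟨card, P⟩ : DoubleBell.Corr) ∈ realizable T DoubleBell ↔
      ∃ (Q₁ : Fin (card (.inl (1 : Fin 4)) + 1) → Fin (card (.inl (3 : Fin 4)) + 1) →
          Fin (card (.inl (0 : Fin 4)) + 1) → Fin (card (.inl (2 : Fin 4)) + 1) → ℝ)
        (Q₂ : Fin (card (.inl (0 : Fin 4)) + 1) → Fin (card (.inl (2 : Fin 4)) + 1) →
          Fin (card (.inr (0 : Fin 1)) + 1) → Fin (card (.inl (1 : Fin 4)) + 1) → ℝ),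
        BellForm T Q₁ ∧ BellForm T Q₂ ∧ ∀ o i, P o i =
          Q₁ (o (1 : Fin 4)) (o (3 : Fin 4)) (o (0 : Fin 4)) (o (2 : Fin 4)) *
          Q₂ (o (0 : Fin 4)) (o (2 : Fin 4)) (i (0 : Fin 1)) (o (1 : Fin 4)) := by
  constructor
  · rintro ⟨K, hK⟩
    obtain ⟨ρ₁, hρ₁, h0⟩ := doubleBell_source₀.exists_state hT (K.valid (0 : Fin 6))
    obtain ⟨ρ₂, hρ₂, h1⟩ := doubleBell_source₁.exists_state hT (K.valid (1 : Fin 6))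
    obtain ⟨M₂, hM₂, h2⟩ := doubleBell_gate₂.exists_family hT (K.valid (2 : Fin 6))
    obtain ⟨M₁, hM₁, h3⟩ := doubleBell_gate₃.exists_family hT (K.valid (3 : Fin 6))
    obtain ⟨N₂, hN₂, h4⟩ := doubleBell_gate₄.exists_family hT (K.valid (4 : Fin 6))
    obtain ⟨N₁, hN₁, h5⟩ := doubleBell_gate₅.exists_family hT (K.valid (5 : Fin 6))
    refine ⟨fun x y i j => bellProb ρ₁ (M₁ i) (N₁ j) x y,
      fun x y i j => bellProb ρ₂ (M₂ i) (N₂ j) x y, bellForm_of hT hρ₁ hM₁ hN₁,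
      bellForm_of hT hρ₂ hM₂ hN₂, fun o i => (hK o i).trans ((K.prob_eq o i).trans ?_)⟩
    exact sum_prod_doubleBell (C := DoubleBell) (Equiv.refl (Fin 4)) (Equiv.refl (Fin 6))
      (fun l => h0 l o i) (fun l => h1 l o i) (fun l => h2 l o i) (fun l => h3 l o i)
      (fun l => h4 l o i) fun l => h5 l o i
  · rintro ⟨Q₁, Q₂, ⟨k, l, s₁, t₁, ρ₁, M₁, N₁, hρ₁, hM₁, hN₁, hQ₁⟩,
      ⟨k', l', s₂, t₂, ρ₂, M₂, N₂, hρ₂, hM₂, hN₂, hQ₂⟩, hP⟩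
    let len : Fin 4 → ℕ := ![k, l, k', l']
    let sys : ∀ w : Fin 4, Fin (len w) → T.Sys := fun | 0 => s₁ | 1 => t₁ | 2 => s₂ | 3 => t₂
    obtain ⟨g0, hg0, h0⟩ := doubleBell_source₀.exists_gate (card := card) (sys := sys) hT hρ₁
    obtain ⟨g1, hg1, h1⟩ := doubleBell_source₁.exists_gate (card := card) (sys := sys) hT hρ₂
    obtain ⟨g2, hg2, h2⟩ := doubleBell_gate₂.exists_gate (card := card) (sys := sys) hT hM₂
    obtain ⟨g3, hg3, h3⟩ := doubleBell_gate₃.exists_gate (card := card) (sys := sys) hT hM₁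
    obtain ⟨g4, hg4, h4⟩ := doubleBell_gate₄.exists_gate (card := card) (sys := sys) hT hN₂
    obtain ⟨g5, hg5, h5⟩ := doubleBell_gate₅.exists_gate (card := card) (sys := sys) hT hN₁
    obtain ⟨K, hK⟩ := exists_circuit (C := DoubleBell) (card := card) (sys := sys) (T := T) rfl
      (val := fun g : Fin 6 => match g with
        | 0 => fun l _ _ => ρ₁ (joinBas (l (0 : Fin 4)) (l (1 : Fin 4))) trivBas
        | 1 => fun l _ _ => ρ₂ (joinBas (l (2 : Fin 4)) (l (3 : Fin 4))) trivBas
        | 2 => fun l o i => M₂ (i (0 : Fin 1)) (fun _ => o (0 : Fin 4)) (l (2 : Fin 4))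
        | 3 => fun l o _ => M₁ (o (0 : Fin 4)) (fun _ => o (1 : Fin 4)) (l (0 : Fin 4))
        | 4 => fun l o _ => N₂ (o (1 : Fin 4)) (fun _ => o (2 : Fin 4)) (l (3 : Fin 4))
        | 5 => fun l o _ => N₁ (o (2 : Fin 4)) (fun _ => o (3 : Fin 4)) (l (1 : Fin 4)))
      (fun g : Fin 6 => match g with
        | 0 => ⟨g0, hg0, h0⟩ | 1 => ⟨g1, hg1, h1⟩ | 2 => ⟨g2, hg2, h2⟩
        | 3 => ⟨g3, hg3, h3⟩ | 4 => ⟨g4, hg4, h4⟩ | 5 => ⟨g5, hg5, h5⟩)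
    refine ⟨K, fun o i => (hP o i).trans ?_⟩
    refine (congrArg₂ (· * ·) (hQ₁ _ _ _ _) (hQ₂ _ _ _ _)).trans (Eq.symm ((hK o i).trans ?_))
    exact sum_prod_doubleBell (C := DoubleBell) (Equiv.refl (Fin 4)) (Equiv.refl (Fin 6))
      (fun l => rfl) (fun l => rfl) (fun l => rfl) (fun l => rfl) (fun l => rfl) fun l => rfl

end DoubleBellCircuit

/-! ### Perfect reference frames remove the gap -/

section ReferenceFrame

variable {T : Theory.{u}} {G : Type} {F : G → ∀ q : T.Q, Matrix (T.Idx q) (T.Idx q) ℝ}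

theorem BellForm.of_symmetrized {nx ny ni nj : ℕ}
    {Q : Fin (nx + 1) → Fin (ny + 1) → Fin (ni + 1) → Fin (nj + 1) → ℝ}
    (h : BellForm (symmetrized T F) Q) : BellForm T Q := by
  obtain ⟨k, l, s, t, ρ, M, N, hρ, hM, hN, hQ⟩ := h
  exact ⟨k, l, s, t, ρ, M, N, hρ.1, fun i => (hM i).1, fun j => (hN j).1, hQ⟩

variable [Group G] [Fintype G]

/-- Measurement relative to a reference frame: read out the frame, and undo the group element. -/
theorem exists_frame_measurement (hT : IsProcessTheory T) (hF : IsSymmetry T F)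
    {k : ℕ} {r : Fin k → T.Sys} {n : ℕ} {label : G → Fin (n + 1)} {ω : Proc T.triv r}
    {L : Proc r (one (.cl n))} (hL : L ∈ T.Chan r (one (.cl n)))
    (hω : ∀ (g : G) (y : Fin (n + 1)),
      Proc.comp L (Proc.comp (act F g r) ω) (fun _ => y) trivBas = if y = label g then 1 else 0)
    (hlabel : ∀ g h : G, label g = label h → F g = F h)
    {ι : Type} [Fintype ι] {s : ι → T.Sys} {m : ℕ} {M : Proc s (one (.cl m))}
    (hM : M ∈ T.Chan s (one (.cl m))) :
    ∃ M' : Proc (Sum.elim r s) (one (.cl m : T.Sys)),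
      M' ∈ (symmetrized T F).Chan (Sum.elim r s) (one (.cl m)) ∧
      Proc.comp M' (ancilla ω s) = M := by
  -- A reading determines a group element only up to its action, hence the choice of a
  -- representative. The value `1` at readings outside the range of `label` is harmless: they have
  -- probability zero on the orbit.
  let pick : Fin (n + 1) → G := fun y => if h : ∃ g, label g = y then h.choose else 1
  have hpick : ∀ g, F (pick (label g)) = F g := fun g => by
    have h : ∃ g', label g' = label g := ⟨g, rfl⟩
    refine hlabel _ _ ?_
    rw [show pick (label g) = h.choose from dif_pos h]
    exact h.choose_spec
  have hact : ∀ g, act F (pick (label g)) s = act F g s := fun g => by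
    have : ∀ a : T.Sys, sysAct F (pick (label g)) a = sysAct F g a := by
      rintro (n | q)
      · rfl
      · exact congrFun (hpick g) q
    exact proc_ext fun b a => Finset.prod_congr rfl fun i _ => by rw [this]
  -- `act F (pick y)⁻¹ s` alone need not be valid; preceding `M`, it gives a conjugate of `M`, as
  -- the outcome of `M` is classical.
  let E : Fin (n + 1) → Proc s (one (.cl m)) := fun y => Proc.comp M (act F (pick y)⁻¹ s)
  have hE : ∀ y, E y ∈ T.Chan s (one (.cl m)) := fun y => by
    have := hF.conj (pick y) s (one (.cl m)) M hM
    rwa [act_classical _ fun _ => ⟨m, rfl⟩, id_comp] at this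
  let M₀ : Proc (Sum.elim r s) (one (.cl m)) :=
    Proc.comp (Proc.control E) (Proc.par L (idProc s))
  have hM₀ : M₀ ∈ T.Chan (Sum.elim r s) (one (.cl m)) :=
    hT.comp (hT.control hE) (hT.par hL (hT.id_mem s))
  -- A joint rotation of frame and system by `g` is invisible: the frame reads `label g`, and the
  -- correction cancels the rotation of the system.
  have key : ∀ g, Proc.comp (Proc.comp M₀ (act F g _)) (ancilla ω s) = M := fun g => by
    have h1 : Proc.comp (Proc.comp M₀ (act F g _)) (ancilla ω s) =
        Proc.comp (Proc.control E) (Proc.comp (Proc.par L (idProc s))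
          (Proc.comp (Proc.par (act F g r) (act F g s)) (ancilla ω s))) := by
      rw [act_elim]
      simp only [M₀, comp_assoc]
    have h2 : Proc.comp (Proc.par L (idProc s))
        (Proc.comp (Proc.par (act F g r) (act F g s)) (ancilla ω s)) =
        fun b a => (if b (.inl ()) = label g then 1 else 0) *
          act F g s (fun i => b (.inr i)) a := by
      rw [comp_assoc, par_comp_par, id_comp]
      refine proc_ext fun b a => (comp_ancilla_apply _ _ _ _).trans ?_
      rw [← hω g (b (.inl ())), comp_assoc]
      refine Eq.trans ?_ (congrArg (· * _) (comp_apply _ _ _ _).symm)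
      rw [Finset.sum_mul]
      exact Finset.sum_congr rfl fun c _ => mul_right_comm _ _ _
    rw [h1, h2]
    refine proc_ext fun b a => (comp_apply _ _ _ _).trans ((sum_joinBas _).trans ?_)
    rw [sum_one, Finset.sum_eq_single (label g)]
    · have h3 : Proc.comp (E (label g)) (act F g s) = M := by
        refine (comp_assoc _ _ _).symm.trans ((congrArg (Proc.comp M) ?_).trans (comp_id M))
        exact (congrArg _ (hact g).symm).trans (hF.act_inv_comp _)
      refine Eq.trans ?_ (congrFun (congrFun h3 b) a)
      refine Eq.trans ?_ (comp_apply _ _ _ _).symm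
      refine Finset.sum_congr rfl fun c _ => congrArg (E (label g) b c * ·) ?_
      exact (congrArg (· * _) (if_pos rfl)).trans (one_mul _)
    · intro y _ hy
      refine Finset.sum_eq_zero fun c _ => mul_eq_zero_of_right _ ?_
      exact mul_eq_zero_of_left (if_neg hy) _
    · exact fun h => absurd (Finset.mem_univ _) h
  -- Each summand of the twirl is `M₀` after a joint rotation, so each reproduces `M`, and so does
  -- their average.
  refine ⟨twirl F M₀, twirl_mem hT hF hM₀, ?_⟩
  have h4 : ∀ g, conjAct F g M₀ = Proc.comp M₀ (act F g⁻¹ _) := fun g => by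
    rw [conjAct, act_classical _ fun _ => ⟨m, rfl⟩, id_comp]
  simp only [twirl, h4, smul_comp, sum_comp, key]
  rw [Finset.sum_const, Finset.card_univ, ← Nat.cast_smul_eq_nsmul ℝ, smul_smul,
    inv_mul_cancel₀ (Nat.cast_ne_zero.2 Fintype.card_ne_zero), one_smul]

theorem funext₄ {α β γ δ ε : Type} {f g : α → β → γ → δ → ε}
    (h : ∀ a b c d, f a b c d = g a b c d) : f = g :=
  funext fun a => funext fun b => funext fun c => funext fun d => h a b c d

/-- One copy of the frame goes to each party. The twirl correlates the orientations of both frames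
and of the shared state, and measuring relative to the frames makes the common orientation
irrelevant. -/
theorem BellForm.symmetrized (hT : IsProcessTheory T) (hF : IsSymmetry T F)
    (hR : HasPerfectReferenceFrame T F) {nx ny ni nj : ℕ}
    {Q : Fin (nx + 1) → Fin (ny + 1) → Fin (ni + 1) → Fin (nj + 1) → ℝ} (h : BellForm T Q) :
    BellForm (symmetrized T F) Q := by
  obtain ⟨k, l, s, t, ρ, M, N, hρ, hM, hN, hQ⟩ := h
  obtain ⟨k, r, n, label, ω, hω, L, hL, hωL, hlabel⟩ := hR
  have hωL' : ∀ (g : G) (y : Fin (n + 1)),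
      Proc.comp L (Proc.comp (act F g r) ω) (fun _ => y) trivBas =
        if y = label g then 1 else 0 := hωL
  choose M' hM' h1 using fun i => exists_frame_measurement hT hF hL hωL' hlabel (hM i)
  choose N' hN' h2 using fun j => exists_frame_measurement hT hF hL hωL' hlabel (hN j)
  let ρ₀ : Proc T.triv (Sum.elim (Sum.elim r s) (Sum.elim r t)) :=
    Proc.comp (Proc.par (ancilla ω s) (ancilla ω t)) ρ
  have hρ₀ : ρ₀ ∈ T.Chan _ _ :=
    hT.comp (hT.par (hT.ancilla_mem hω s) (hT.ancilla_mem hω t)) hρ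
  have h3 := bellForm_of hT.symmetrized (twirl_mem hT hF hρ₀) hM' hN'
  refine (congrArg (BellForm _) (funext₄ fun x y i j => ?_)).mpr h3
  suffices h4 : Proc.comp (Proc.par (M' i) (N' j)) (twirl F ρ₀) =
      Proc.comp (Proc.par (M i) (N j)) ρ from
    (hQ x y i j).trans (congrFun (congrFun h4 _) _).symm
  -- The outcomes carry the trivial action, so covariant measurements absorb collective rotations;
  -- the twirl of the state then does not affect the statistics.
  have hcov : ∀ g, Proc.comp (Proc.par (M' i) (N' j)) (act F g _) = Proc.par (M' i) (N' j) :=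
    fun g => by
      have := Covariant.par (S := T.toSystems) (hM' i).2 (hN' j).2 g
      rw [act_classical] at this
      · exact this.symm.trans (id_comp _)
      · rintro (a | a)
        exacts [⟨nx, rfl⟩, ⟨ny, rfl⟩]
  have hg : ∀ g, Proc.comp (Proc.par (M' i) (N' j)) (conjAct F g ρ₀) =
      Proc.comp (Proc.par (M i) (N j)) ρ := fun g => by
    rw [conjAct, act_triv, comp_id, comp_assoc]
    refine (congrArg (Proc.comp · ρ₀) (hcov g)).trans ?_
    simp only [ρ₀]
    rw [comp_assoc]
    refine congrArg (Proc.comp · ρ) ((par_comp_par _ _ _ _).trans ?_)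
    exact congrArg₂ Proc.par (h1 i) (h2 j)
  refine (comp_smul _ _ _).trans ((congrArg _ (comp_sum _ _)).trans ?_)
  rw [Finset.sum_congr rfl fun g _ => hg g]
  rw [Finset.sum_const, Finset.card_univ, ← Nat.cast_smul_eq_nsmul ℝ, smul_smul,
    inv_mul_cancel₀ (Nat.cast_ne_zero.2 Fintype.card_ne_zero), one_smul]

theorem realizable_symmetrized_doubleBell (hT : IsProcessTheory T) (hF : IsSymmetry T F)
    (hR : HasPerfectReferenceFrame T F) :
    realizable (symmetrized T F) DoubleBell = realizable T DoubleBell := by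
  ext ⟨card, P⟩
  rw [mem_realizable_doubleBell_iff hT, mem_realizable_doubleBell_iff hT.symmetrized]
  constructor
  · rintro ⟨Q₁, Q₂, h1, h2, h⟩
    exact ⟨Q₁, Q₂, h1.of_symmetrized, h2.of_symmetrized, h⟩
  · rintro ⟨Q₁, Q₂, h1, h2, h⟩
    exact ⟨Q₁, Q₂, h1.symmetrized hT hF hR, h2.symmetrized hT hF hR, h⟩

end ReferenceFrame

/-! ### Classical probability theory -/

section Stochastic

variable {S : Systems.{u}} {ι κ ι' κ' μ : Type} [Fintype κ] [Fintype κ'] [Fintype μ]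
  {s : ι → S.Sys} {t : κ → S.Sys} {s' : ι' → S.Sys} {t' : κ' → S.Sys} {r : μ → S.Sys}

theorem stochastic_relabel (e : κ ≃ ι) : Stochastic (Proc.relabel e s) := by
  let φ : Reindex s (fun k => s (e k)) := ⟨e, e.bijective, fun _ => rfl, fun b k => b (e k),
    fun _ _ => HEq.rfl⟩
  refine ⟨fun b a => ?_, fun a => ?_⟩
  · unfold Proc.relabel
    split_ifs <;> norm_num
  · rw [Finset.sum_eq_single (φ.map a)]
    · exact if_pos fun _ => rfl
    · exact fun b _ hb => if_neg fun h => hb (funext h)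
    · exact fun h => absurd (Finset.mem_univ _) h

theorem Stochastic.comp {N : Proc t r} {M : Proc s t} (hN : Stochastic N) (hM : Stochastic M) :
    Stochastic (Proc.comp N M) := by
  refine ⟨fun b a => ?_, fun a => ?_⟩
  · rw [comp_apply]
    exact Finset.sum_nonneg fun c _ => mul_nonneg (hN.1 _ _) (hM.1 _ _)
  · simp only [comp_apply]
    rw [Finset.sum_comm]
    simp only [← Finset.sum_mul]
    refine Eq.trans (Finset.sum_congr rfl fun c _ => ?_) (hM.2 a)
    exact (congrArg (· * M c a) (hN.2 c)).trans (one_mul _)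

theorem Stochastic.par {_ : Fintype (Bas (Sum.elim t t'))} {M : Proc s t} {N : Proc s' t'}
    (hM : Stochastic M) (hN : Stochastic N) : Stochastic (Proc.par M N) := by
  refine ⟨fun b a => mul_nonneg (hM.1 _ _) (hN.1 _ _), fun a => (sum_joinBas _).trans ?_⟩
  change ∑ b, ∑ c, M b _ * N c _ = 1
  rw [← Finset.sum_mul_sum]
  exact (congrArg₂ (· * ·) (hM.2 _) (hN.2 _)).trans (one_mul _)

end Stochastic

theorem isGPT_CPT : IsGPT CPT where
  relabel e s := stochastic_relabel (S := CPT.toSystems) e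
  comp s t r M hM N hN := Stochastic.comp (S := CPT.toSystems) hN hM
  par s t s' t' M hM N hN := Stochastic.par (S := CPT.toSystems) hM hN
  classical _ _ := rfl
  control s t n E hE := ⟨fun b a => (hE _).1 _ _, fun a => (hE _).2 _⟩
  discard s := by
    refine ⟨fun _ _ => 1, ⟨fun _ _ => zero_le_one, fun a => sum_triv _⟩, fun U hU => ?_⟩
    refine proc_ext fun b a => ?_
    rw [eq_trivBas b]
    exact (sum_triv fun b => U b a).symm.trans (hU.2 a)
  states_span q := q.elim
  effects_span q := q.elim

/-- The classical systems of `T`. -/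
def classicalSys (T : Theory.{u}) : CPT.Sys → T.Sys
  | .cl n => .cl n
  | .gpt q => q.elim

/-- Classical systems have the same coordinates in every theory. -/
def classicalIx (T : Theory.{u}) : ∀ a : CPT.Sys, (classicalSys T a).Ix ≃ a.Ix
  | .cl _ => Equiv.refl _
  | .gpt q => q.elim

theorem exists_classicalSys_eq (T : Theory.{u}) (a : CPT.Sys) : ∃ n, classicalSys T a = .cl n := by
  rcases a with n | q
  · exact ⟨n, rfl⟩
  · exact q.elim

/-- Classical composites have the same coordinates in every theory. -/
def classicalBas (T : Theory.{u}) {ι : Type} (s : ι → CPT.Sys) :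
    Bas (fun i => classicalSys T (s i)) ≃ Bas s :=
  Equiv.piCongrRight fun i => classicalIx T (s i)

/-- Every system of `CPT` is classical, and `T` has the same classical systems with the same
stochastic maps. Only the type of systems changes, which is the purpose of `classicalSys` and
`classicalBas`. -/
theorem BellForm.of_CPT {T : Theory.{u}} (hT : IsProcessTheory T) {nx ny ni nj : ℕ}
    {Q : Fin (nx + 1) → Fin (ny + 1) → Fin (ni + 1) → Fin (nj + 1) → ℝ} (h : BellForm CPT Q) :
    BellForm T Q := by
  obtain ⟨k, l, s, t, ρ, M, N, hρ, hM, hN, hQ⟩ := h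
  let s' : Fin k → T.Sys := fun i => classicalSys T (s i)
  let t' : Fin l → T.Sys := fun i => classicalSys T (t i)
  let φ : Bas s' ≃ Bas s := classicalBas T s
  let ψ : Bas t' ≃ Bas t := classicalBas T t
  have hs : ∀ i, ∃ n, s' i = .cl n := fun i => exists_classicalSys_eq T (s i)
  have ht : ∀ i, ∃ n, t' i = .cl n := fun i => exists_classicalSys_eq T (t i)
  refine ⟨k, l, s', t', fun b _ => ρ (joinBas (φ fun i => b (.inl i)) (ψ fun j => b (.inr j)))
    trivBas, fun i b a => M i b (φ a), fun j b a => N j b (ψ a), ?_, fun i => ?_, fun j => ?_,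
    fun x y i j => (hQ x y i j).trans ?_⟩
  · refine hT.mem_of_stochastic (fun e => e.elim) (Sum.rec hs ht) (fun _ _ => hρ.1 _ _)
      fun a => (sum_joinBas _).trans ?_
    refine Eq.trans ?_ ((sum_joinBas fun b => ρ b trivBas).symm.trans
      ((sum_univ_congr _ _ _).trans (hρ.2 trivBas)))
    exact Fintype.sum_equiv φ _ _ fun a => Fintype.sum_equiv ψ _ _ fun b => rfl
  · exact hT.mem_of_stochastic hs (fun _ => ⟨nx, rfl⟩) (fun _ _ => (hM i).1 _ _)
      fun a => (sum_univ_congr _ _ _).trans ((hM i).2 (φ a))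
  · exact hT.mem_of_stochastic ht (fun _ => ⟨ny, rfl⟩) (fun _ _ => (hN j).1 _ _)
      fun a => (sum_univ_congr _ _ _).trans ((hN j).2 (ψ a))
  · refine (bellProb_eq _ _ _ _ _).trans (Eq.trans ?_ (bellProb_eq _ _ _ _ _).symm)
    refine (Fintype.sum_equiv φ _ _ fun a => ?_).symm
    exact Fintype.sum_equiv ψ _ (fun b => M i (fun _ => x) (φ a) * N j (fun _ => y) b *
      ρ (joinBas (φ a) b) trivBas) fun b => rfl

/-! ### Units and the absence of signalling -/

section Units

variable {T : Theory.{u}} {ι κ : Type} [Fintype ι] [Fintype κ] {s : ι → T.Sys} {t : κ → T.Sys}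

/-- The sum over the outcomes of a measurement is the unit effect. -/
theorem IsGPT.sum_eq_sum (hT : IsGPT T) (ht : ∀ i, ∃ n, t i = .cl n) {M N : Proc s t}
    [Fintype (Bas t)] (hM : M ∈ T.Chan s t) (hN : N ∈ T.Chan s t) (a : Bas s) :
    ∑ b, M b a = ∑ b, N b a := by
  have h : (fun _ _ => 1 : Proc t T.triv) ∈ T.Chan t T.triv :=
    hT.isProcessTheory.mem_of_stochastic ht (fun e => e.elim) (fun _ _ => zero_le_one)
      fun _ => sum_triv _
  -- Measuring and then ignoring the outcome is a deterministic effect, and there is only one.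
  have h1 := (hT.discard s).unique (hT.isProcessTheory.comp h hM) (hT.isProcessTheory.comp h hN)
  have h2 := congrFun (congrFun h1 trivBas) a
  have h3 : ∀ M : Proc s t, Proc.comp (fun _ _ => 1 : Proc t T.triv) M trivBas a = ∑ b, M b a :=
    fun M => (comp_apply _ _ _ _).trans (Finset.sum_congr rfl fun _ _ => one_mul _)
  rw [h3, h3] at h2
  exact h2

variable {nx ny ni nj : ℕ} {Q : Fin (nx + 1) → Fin (ny + 1) → Fin (ni + 1) → Fin (nj + 1) → ℝ}

theorem BellForm.stochastic (hT : IsProcessTheory T) (h : BellForm T Q) :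
    (∀ x y i j, 0 ≤ Q x y i j) ∧ ∀ i j, ∑ x, ∑ y, Q x y i j = 1 := by
  obtain ⟨k, l, s, t, ρ, M, N, hρ, hM, hN, hQ⟩ := h
  have h1 := fun i j => hT.stochastic_of_mem (fun e => e.elim)
    (Sum.rec (fun _ => ⟨nx, rfl⟩) fun _ => ⟨ny, rfl⟩) (hT.comp (hT.par (hM i) (hN j)) hρ)
  refine ⟨fun x y i j => ?_, fun i j => ?_⟩
  · rw [hQ]
    exact (h1 i j).1 _ _
  · refine Eq.trans ?_ ((h1 i j).2 trivBas)
    refine Eq.symm ((sum_joinBas _).trans ((sum_one _).trans ?_))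
    refine Finset.sum_congr rfl fun x _ => (sum_one _).trans ?_
    exact Finset.sum_congr rfl fun y _ => (hQ x y i j).symm

/-- Summing over the second outcome turns the second measurement into the unit effect, whatever its
setting. -/
theorem BellForm.no_signalling (hT : IsGPT T) (h : BellForm T Q) (x i j j') :
    ∑ y, Q x y i j = ∑ y, Q x y i j' := by
  obtain ⟨k, l, s, t, ρ, M, N, hρ, hM, hN, hQ⟩ := h
  have h1 : ∀ b, ∑ y, N j (fun _ => y) b = ∑ y, N j' (fun _ => y) b := fun b =>
    (sum_one fun y => N j y b).symm.trans
      ((hT.sum_eq_sum (fun _ => ⟨ny, rfl⟩) (hN j) (hN j') b).trans (sum_one fun y => N j' y b))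
  have h2 : ∀ j, ∑ y, Q x y i j =
      ∑ a, ∑ b, M i (fun _ => x) a * (∑ y, N j (fun _ => y) b) * ρ (joinBas a b) trivBas := by
    intro j
    simp only [hQ, bellProb_eq, Finset.mul_sum, Finset.sum_mul]
    rw [Finset.sum_comm]
    exact Finset.sum_congr rfl fun a _ => Finset.sum_comm
  rw [h2, h2]
  simp only [h1]

/-- The uniform distribution on the outcomes is realizable in the Bell scenario. -/
theorem bellForm_uniform (hT : IsProcessTheory T) (nx ny ni nj : ℕ) :
    BellForm T fun (_ : Fin (nx + 1)) (_ : Fin (ny + 1)) (_ : Fin (ni + 1)) (_ : Fin (nj + 1)) =>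
      ((nx + 1 : ℝ) * (ny + 1))⁻¹ := by
  have h1 : ∀ n : ℕ, (distState fun _ => ((n : ℝ) + 1)⁻¹) ∈ T.Chan T.triv (one (.cl n)) :=
    fun n => hT.distState_mem (fun _ => by positivity) (by
      simp only [Finset.sum_const, Finset.card_univ, Fintype.card_fin, nsmul_eq_mul]
      push_cast
      exact mul_inv_cancel₀ (by positivity))
  -- The shared state is trivial, and each party draws its outcome from a local uniform
  -- distribution.
  have h2 := bellForm_of hT (ni := ni) (nj := nj)
    (hT.ancilla_mem (hT.id_mem T.triv) T.triv) (fun _ => h1 nx) (fun _ => h1 ny)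
  convert h2 using 5
  rw [bellProb_eq, sum_triv, sum_triv]
  have h3 : ancilla (idProc T.triv) T.triv (joinBas trivBas trivBas) trivBas = (1 : ℝ) :=
    (congrArg₂ (· * ·) (if_pos rfl) (if_pos rfl)).trans (one_mul 1)
  rw [h3, mul_inv, mul_one]
  rfl

end Units

/-! ### Gaps between classical probability theory and other theories -/

section Gap

theorem sum_eq_of_forall_eq_const {n : ℕ} {f : Fin (n + 1) → ℝ} {c : ℝ} (h : ∀ x, f x = c) :
    ∑ x, f x = (n + 1) * c := by
  simp [h]

/-- In a product of two Bell correlations whose second factor is uniform, the first factor is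
determined. -/
theorem eq_of_mul_eq {nb nc nd ne na : ℕ}
    {Q Q₁ : Fin (nc + 1) → Fin (ne + 1) → Fin (nb + 1) → Fin (nd + 1) → ℝ}
    {Q₂ : Fin (nb + 1) → Fin (nd + 1) → Fin (na + 1) → Fin (nc + 1) → ℝ}
    (hQ0 : ∀ c e b d, 0 ≤ Q c e b d) (hQ1 : ∀ b d, ∑ c, ∑ e, Q c e b d = 1)
    (hQs : ∀ c b d d', ∑ e, Q c e b d = ∑ e, Q c e b d')
    (hQ₁0 : ∀ c e b d, 0 ≤ Q₁ c e b d) (hQ₁1 : ∀ b d, ∑ c, ∑ e, Q₁ c e b d = 1)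
    (hQ₁s : ∀ c b d d', ∑ e, Q₁ c e b d = ∑ e, Q₁ c e b d')
    (hQ₂s : ∀ b a c c', ∑ d, Q₂ b d a c = ∑ d, Q₂ b d a c')
    (h : ∀ a b c d e, Q c e b d * ((nb + 1 : ℝ) * (nd + 1))⁻¹ = Q₁ c e b d * Q₂ b d a c) :
    Q = Q₁ := by
  refine funext₄ fun c e b d => ?_
  -- Sum over `e`. The remaining marginal does not depend on the setting `d`, which is set to 0 in
  -- it while `d` stays free in `Q₂`.
  have h1 : ∀ b c d, (∑ e, Q c e b 0) * ((nb + 1 : ℝ) * (nd + 1))⁻¹ =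
      (∑ e, Q₁ c e b 0) * Q₂ b d 0 c := fun b c d => by
    rw [hQs c b 0 d, hQ₁s c b 0 d, Finset.sum_mul, Finset.sum_mul]
    exact Finset.sum_congr rfl fun e _ => h 0 b c d e
  -- Sum over `d`. The marginal of `Q₂` on `b` does not depend on `c`, so the last factor is the
  -- same for all `c`.
  have h2 : ∀ b c, (∑ e, Q c e b 0) * (nb + 1 : ℝ)⁻¹ =
      (∑ e, Q₁ c e b 0) * ∑ d, Q₂ b d 0 0 := fun b c => by
    rw [hQ₂s b 0 0 c, Finset.mul_sum, ← Finset.sum_congr rfl fun d _ => h1 b c d]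
    rw [sum_eq_of_forall_eq_const fun _ => rfl]
    field_simp
  -- Sum over `c` and use normalization: `Q₂` must have the uniform marginal on `b`, so that `Q` and
  -- `Q₁` have the same marginal on `c`.
  have h3 : ∀ b, (nb + 1 : ℝ)⁻¹ = ∑ d, Q₂ b d 0 0 := fun b => by
    have := Finset.sum_congr rfl fun c (_ : c ∈ Finset.univ) => h2 b c
    rwa [← Finset.sum_mul, ← Finset.sum_mul, hQ1, hQ₁1, one_mul, one_mul] at this
  have h4 : ∑ e, Q c e b d = ∑ e, Q₁ c e b d := by
    have := h2 b c
    rw [← h3] at this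
    rw [hQs c b d 0, hQ₁s c b d 0]
    exact mul_right_cancel₀ (by positivity) this
  -- If this common marginal vanishes, nonnegativity makes both entries zero. Otherwise it can be
  -- cancelled: `Q₂` is uniform at these arguments, and the hypothesis determines the entry.
  by_cases hm : ∑ e, Q₁ c e b d = 0
  · have h5 := (Finset.sum_eq_zero_iff_of_nonneg fun e _ => hQ₁0 c e b d).1 hm e (Finset.mem_univ _)
    rw [hm] at h4
    rw [h5, (Finset.sum_eq_zero_iff_of_nonneg fun e _ => hQ0 c e b d).1 h4 e (Finset.mem_univ _)]
  · have h5 : ((nb + 1 : ℝ) * (nd + 1))⁻¹ = Q₂ b d 0 c := by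
      have := h1 b c d
      rw [hQs c b 0 d, hQ₁s c b 0 d, h4] at this
      exact mul_left_cancel₀ hm this
    have h6 := h 0 b c d e
    rw [← h5] at h6
    exact mul_right_cancel₀ (by positivity) h6

theorem realizable_CPT_bell_subset {T : Theory.{u}} (hT : IsProcessTheory T) :
    (realizable CPT Bell : Set Bell.Corr) ⊆ realizable T Bell := by
  rintro ⟨card, P⟩
  rw [mem_realizable_bell_iff isGPT_CPT.isProcessTheory, mem_realizable_bell_iff hT]
  rintro ⟨Q, h1, h⟩
  exact ⟨Q, h1.of_CPT hT, h⟩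

theorem realizable_CPT_doubleBell_subset {T : Theory.{u}} (hT : IsProcessTheory T) :
    (realizable CPT DoubleBell : Set DoubleBell.Corr) ⊆ realizable T DoubleBell := by
  rintro ⟨card, P⟩
  rw [mem_realizable_doubleBell_iff isGPT_CPT.isProcessTheory, mem_realizable_doubleBell_iff hT]
  rintro ⟨Q₁, Q₂, h1, h2, h⟩
  exact ⟨Q₁, Q₂, h1.of_CPT hT, h2.of_CPT hT, h⟩

theorem BellForm.of_realizable_subset {T : Theory.{u}} {T' : Theory.{v}} (hT : IsProcessTheory T)
    (hT' : IsProcessTheory T') (h : (realizable T Bell : Set Bell.Corr) ⊆ realizable T' Bell)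
    {nx ny ni nj : ℕ} {Q : Fin (nx + 1) → Fin (ny + 1) → Fin (ni + 1) → Fin (nj + 1) → ℝ}
    (hQ : BellForm T Q) : BellForm T' Q := by
  let card : Bell.Out ⊕ Bell.In → ℕ :=
    Sum.elim (fun o : Fin 2 => ![nx, ny] o) (fun i : Fin 2 => ![ni, nj] i)
  have h1 := (mem_realizable_bell_iff hT card
    (fun o i => Q (o (0 : Fin 2)) (o (1 : Fin 2)) (i (0 : Fin 2)) (i (1 : Fin 2)))).2
    ⟨Q, hQ, fun _ _ => rfl⟩
  obtain ⟨Q', hQ', h2⟩ := (mem_realizable_bell_iff hT' card _).1 (h h1)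
  have h3 : Q = Q' := funext₄ fun x y i j =>
    h2 (fun o : Fin 2 => match o with | 0 => x | 1 => y)
      (fun o : Fin 2 => match o with | 0 => i | 1 => j)
  rw [h3]
  exact hQ'

theorem realizable_doubleBell_subset {T : Theory.{u}} {T' : Theory.{v}} (hT : IsProcessTheory T)
    (hT' : IsProcessTheory T')
    (h : (realizable T Bell : Set Bell.Corr) ⊆ realizable T' Bell) :
    (realizable T DoubleBell : Set DoubleBell.Corr) ⊆ realizable T' DoubleBell := by
  rintro ⟨card, P⟩
  rw [mem_realizable_doubleBell_iff hT, mem_realizable_doubleBell_iff hT']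
  rintro ⟨Q₁, Q₂, h1, h2, h3⟩
  exact ⟨Q₁, Q₂, h1.of_realizable_subset hT hT' h, h2.of_realizable_subset hT hT' h, h3⟩

/-- A Bell correlation is put into the district of C and E, with the uniform distribution in the
other one. Any factorization of this product in `T'` has the given correlation as its first factor,
by `eq_of_mul_eq`. -/
theorem realizable_bell_subset {T : Theory.{u}} {T' : Theory.{v}} (hT : IsGPT T)
    (hT' : IsGPT T')
    (h : (realizable T DoubleBell : Set DoubleBell.Corr) ⊆ realizable T' DoubleBell) :
    (realizable T Bell : Set Bell.Corr) ⊆ realizable T' Bell := by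
  rintro ⟨card', P⟩
  rw [mem_realizable_bell_iff hT.isProcessTheory, mem_realizable_bell_iff hT'.isProcessTheory]
  rintro ⟨Q, hQ, hP⟩
  -- B and D take over the alphabets of the Bell settings, C and E those of the Bell outcomes; A has
  -- the single value 0.
  let card : DoubleBell.Out ⊕ DoubleBell.In → ℕ :=
    Sum.elim (fun o : Fin 4 => ![card' (.inr (0 : Fin 2)), card' (.inl (0 : Fin 2)),
      card' (.inr (1 : Fin 2)), card' (.inl (1 : Fin 2))] o) fun _ => 0
  obtain ⟨Q₁, Q₂, h1, h2, h3⟩ := (mem_realizable_doubleBell_iff hT'.isProcessTheory card _).1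
    (h ((mem_realizable_doubleBell_iff hT.isProcessTheory card _).2
      ⟨Q, _, hQ, bellForm_uniform hT.isProcessTheory _ _ _ _, fun _ _ => rfl⟩))
  have hs := hQ.stochastic hT.isProcessTheory
  have hs₁ := h1.stochastic hT'.isProcessTheory
  have h4 : Q = Q₁ := eq_of_mul_eq hs.1 hs.2 (fun c b d d' => hQ.no_signalling hT c b d d')
    hs₁.1 hs₁.2 (fun c b d d' => h1.no_signalling hT' c b d d')
    (fun b a c c' => h2.no_signalling hT' b a c c') fun a b c d e =>
      h3 (fun o : Fin 4 => match o with | 0 => b | 1 => c | 2 => d | 3 => e) fun _ => a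
  rw [h4] at hP
  exact ⟨Q₁, h1, hP⟩

theorem admitsGap_CPT_doubleBell_iff {T : Theory.{u}} (hT : IsGPT T) :
    AdmitsGap CPT T DoubleBell ↔ AdmitsGap CPT T Bell := by
  rw [AdmitsGap, AdmitsGap, ssubset_iff_subset_not_subset, ssubset_iff_subset_not_subset]
  refine and_congr (iff_of_true (realizable_CPT_doubleBell_subset hT.isProcessTheory)
    (realizable_CPT_bell_subset hT.isProcessTheory)) (not_congr ?_)
  exact ⟨realizable_bell_subset hT isGPT_CPT,
    realizable_doubleBell_subset hT.isProcessTheory isGPT_CPT.isProcessTheory⟩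

end Gap

/-! ### Districts -/

section Districts

/-- The inverse of an isomorphism. -/
def CausalStructure.Iso.symm {C D : CausalStructure} (I : C.Iso D) : D.Iso C where
  gate := I.gate.symm
  latent := I.latent.symm
  out := I.out.symm
  inp := I.inp.symm
  src w := by rw [Equiv.eq_symm_apply, ← I.src, Equiv.apply_symm_apply]
  tgt w := by rw [Equiv.eq_symm_apply, ← I.tgt, Equiv.apply_symm_apply]
  stipulatedClassical w := by rw [← I.stipulatedClassical, Equiv.apply_symm_apply]
  origin w := by rw [Equiv.eq_symm_apply, ← I.origin, Equiv.apply_symm_apply]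
  reads g v := by
    rw [← I.reads, Equiv.apply_symm_apply]
    rcases v with v | v <;> simp

/-- The number of the source that a gate of the structure with two districts is connected to. -/
def sourceOf : Fin 6 → Fin 2 := ![0, 1, 1, 0, 1, 0]

theorem fragments_mk_source (g : Fin 6) :
    (Quotient.mk DoubleBell.fragments g) =
      Quotient.mk DoubleBell.fragments ((![0, 1] : Fin 2 → Fin 6) (sourceOf g)) := by
  have h : ∀ w : Fin 4, (Quotient.mk DoubleBell.fragments ((![0, 0, 1, 1] : Fin 4 → Fin 6) w)) =
      Quotient.mk DoubleBell.fragments ((![3, 5, 2, 4] : Fin 4 → Fin 6) w) := fun w =>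
    Quotient.sound (Relation.EqvGen.rel _ _ ⟨w, rfl, rfl⟩)
  match g with
  | 0 => rfl
  | 1 => rfl
  | 2 => exact (h 2).symm
  | 3 => exact (h 0).symm
  | 4 => exact (h 3).symm
  | 5 => exact (h 1).symm

/-- `sourceOf` takes equal values at the two ends of each latent wire, hence is constant on the
classes that wires generate; conversely, each gate lies in the class of its source. -/
theorem fragments_mk_eq_iff (g h : Fin 6) :
    (Quotient.mk DoubleBell.fragments g) = Quotient.mk DoubleBell.fragments h ↔
      sourceOf g = sourceOf h := by
  constructor
  · intro hgh
    have h1 : Relation.EqvGen _ g h := Quotient.exact hgh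
    induction h1 with
    | rel g h hr =>
      obtain ⟨w, rfl, rfl⟩ := hr
      exact (show ∀ w : Fin 4, sourceOf ((![0, 0, 1, 1] : Fin 4 → Fin 6) w) =
        sourceOf ((![3, 5, 2, 4] : Fin 4 → Fin 6) w) by decide) w
    | refl => rfl
    | symm g h h1 ih => exact (ih (Quotient.sound h1)).symm
    | trans g h k h1 h2 ih1 ih2 => exact (ih1 (Quotient.sound h1)).trans (ih2 (Quotient.sound h2))
  · intro hgh
    rw [fragments_mk_source g, fragments_mk_source h, hgh]

theorem card_fragments : Nat.card (Quotient DoubleBell.fragments) = 2 := by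
  refine (Nat.card_eq_of_bijective
    (fun a : Fin 2 => Quotient.mk DoubleBell.fragments ((![0, 1] : Fin 2 → Fin 6) a))
    ⟨?_, ?_⟩).symm.trans (Nat.card_fin 2)
  · intro a b hab
    have h : ∀ a b : Fin 2, sourceOf ((![0, 1] : Fin 2 → Fin 6) a) =
      sourceOf ((![0, 1] : Fin 2 → Fin 6) b) → a = b := by decide
    exact h a b ((fragments_mk_eq_iff _ _).1 hab)
  · intro d
    obtain ⟨g, rfl⟩ := Quotient.exists_rep d
    exact ⟨sourceOf g, (fragments_mk_source g).symm⟩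

theorem bijective_subtype_mk {α β : Type} {p : β → Prop} {f : α → β} (hp : ∀ a, p (f a))
    (hf : Function.Injective f) (hs : ∀ b, p b → ∃ a, f a = b) :
    Function.Bijective (fun a => (⟨f a, hp a⟩ : {b // p b})) :=
  ⟨fun _ _ h => hf (congrArg Subtype.val h), fun ⟨b, hb⟩ => by
    obtain ⟨a, rfl⟩ := hs b hb
    exact ⟨a, rfl⟩⟩

/-- The district of the source `0` is a Bell scenario. -/
def isoDistrict₀ : Bell.Iso (DoubleBell.restrict {g : Fin 6 | sourceOf g = 0}) where
  gate := Equiv.ofBijective _ (bijective_subtype_mk (f := (![0, 3, 5] : Fin 3 → Fin 6))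
    (p := fun g => sourceOf g = 0) (by decide) (by decide) (by decide))
  latent := Equiv.ofBijective _ (bijective_subtype_mk (f := (![0, 1] : Fin 2 → Fin 4))
    (p := fun w => sourceOf ((![0, 0, 1, 1] : Fin 4 → Fin 6) w) = 0 ∧
      sourceOf ((![3, 5, 2, 4] : Fin 4 → Fin 6) w) = 0) (by decide) (by decide) (by decide))
  out := Equiv.ofBijective _ (bijective_subtype_mk (f := (![1, 3] : Fin 2 → Fin 4))
    (p := fun o => sourceOf ((![2, 3, 4, 5] : Fin 4 → Fin 6) o) = 0) (by decide) (by decide)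
      (by decide))
  inp := Equiv.ofBijective _ (bijective_subtype_mk
    (f := (![.inl 0, .inl 2] : Fin 2 → Fin 4 ⊕ Fin 1))
    (p := fun v : Fin 4 ⊕ Fin 1 => (∃ g : Fin 6, sourceOf g = 0 ∧ v ∈ DoubleBell.reads g) ∧
      ∀ o : Fin 4, v = .inl o → ¬ sourceOf ((![2, 3, 4, 5] : Fin 4 → Fin 6) o) = 0)
    (by
      intro a
      match a with
      | 0 => exact ⟨⟨3, rfl, rfl⟩, by decide⟩
      | 1 => exact ⟨⟨5, rfl, rfl⟩, by decide⟩)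
    (by decide)
    (by
      rintro v ⟨⟨g, hg, hv⟩, h⟩
      match g with
      | 1 | 2 | 4 => exact absurd hg (by decide)
      | 0 => exact hv.elim
      | 3 => exact ⟨0, hv.symm⟩
      | 5 => exact ⟨1, hv.symm⟩))
  src := fun w : Fin 2 => Subtype.ext (match w with | 0 => rfl | 1 => rfl)
  tgt := fun w : Fin 2 => Subtype.ext (match w with | 0 => rfl | 1 => rfl)
  stipulatedClassical _ := Iff.rfl
  origin := fun o : Fin 2 => Subtype.ext (match o with | 0 => rfl | 1 => rfl)
  reads := by
    rintro (g : Fin 3) ((v : Fin 2) | (v : Fin 2)) <;> fin_cases g <;> fin_cases v <;>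
      first
      | exact iff_of_true rfl rfl
      | exact iff_of_false (fun h => nomatch h) fun h => nomatch h

/-- The district of the source `1` is a Bell scenario. -/
def isoDistrict₁ : Bell.Iso (DoubleBell.restrict {g : Fin 6 | sourceOf g = 1}) where
  gate := Equiv.ofBijective _ (bijective_subtype_mk (f := (![1, 2, 4] : Fin 3 → Fin 6))
    (p := fun g => sourceOf g = 1) (by decide) (by decide) (by decide))
  latent := Equiv.ofBijective _ (bijective_subtype_mk (f := (![2, 3] : Fin 2 → Fin 4))
    (p := fun w => sourceOf ((![0, 0, 1, 1] : Fin 4 → Fin 6) w) = 1 ∧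
      sourceOf ((![3, 5, 2, 4] : Fin 4 → Fin 6) w) = 1) (by decide) (by decide) (by decide))
  out := Equiv.ofBijective _ (bijective_subtype_mk (f := (![0, 2] : Fin 2 → Fin 4))
    (p := fun o => sourceOf ((![2, 3, 4, 5] : Fin 4 → Fin 6) o) = 1) (by decide) (by decide)
      (by decide))
  inp := Equiv.ofBijective _ (bijective_subtype_mk
    (f := (![.inr 0, .inl 1] : Fin 2 → Fin 4 ⊕ Fin 1))
    (p := fun v : Fin 4 ⊕ Fin 1 => (∃ g : Fin 6, sourceOf g = 1 ∧ v ∈ DoubleBell.reads g) ∧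
      ∀ o : Fin 4, v = .inl o → ¬ sourceOf ((![2, 3, 4, 5] : Fin 4 → Fin 6) o) = 1)
    (by
      intro a
      match a with
      | 0 => exact ⟨⟨2, rfl, rfl⟩, by decide⟩
      | 1 => exact ⟨⟨4, rfl, rfl⟩, by decide⟩)
    (by decide)
    (by
      rintro v ⟨⟨g, hg, hv⟩, h⟩
      match g with
      | 0 | 3 | 5 => exact absurd hg (by decide)
      | 1 => exact hv.elim
      | 2 => exact ⟨0, hv.symm⟩
      | 4 => exact ⟨1, hv.symm⟩))
  src := fun w : Fin 2 => Subtype.ext (match w with | 0 => rfl | 1 => rfl)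
  tgt := fun w : Fin 2 => Subtype.ext (match w with | 0 => rfl | 1 => rfl)
  stipulatedClassical _ := Iff.rfl
  origin := fun o : Fin 2 => Subtype.ext (match o with | 0 => rfl | 1 => rfl)
  reads := by
    rintro (g : Fin 3) ((v : Fin 2) | (v : Fin 2)) <;> fin_cases g <;> fin_cases v <;>
      first
      | exact iff_of_true rfl rfl
      | exact iff_of_false (fun h => nomatch h) fun h => nomatch h

theorem nonempty_district_iso_bell (d : Quotient DoubleBell.fragments) :
    Nonempty ((DoubleBell.district d).Iso Bell) := by
  obtain ⟨g, rfl⟩ := Quotient.exists_rep d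
  have h : DoubleBell.district (Quotient.mk DoubleBell.fragments g) =
      DoubleBell.restrict {h : Fin 6 | sourceOf h = sourceOf g} :=
    congrArg DoubleBell.restrict (Set.ext fun h => fragments_mk_eq_iff h g)
  rw [h]
  generalize sourceOf g = a
  match a with
  | 0 => exact ⟨isoDistrict₀.symm⟩
  | 1 => exact ⟨isoDistrict₁.symm⟩

end Districts

/-! ### The PBR scenario -/

section PBRCircuit

variable {T : Theory.{u}} {C : CausalStructure} {card : C.Out ⊕ C.In → ℕ} {len : C.Latent → ℕ}
  {sys : ∀ w, Fin (len w) → T.Sys} {g : C.Gate} {v : C.Out ⊕ C.In} {w w₀ w₁ : C.Latent} {o : C.Out}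

/-- The gate `g` reads only `v`, receives only the wires `w₀` and `w₁`, and produces only `o`. -/
structure IsJointMeasurement (C : CausalStructure) (g : C.Gate) (v : C.Out ⊕ C.In)
    (w₀ w₁ : C.Latent) (o : C.Out) : Prop where
  ne : w₀ ≠ w₁
  reads : ∀ v', v' ∈ C.reads g ↔ v' = v
  tgt : ∀ w', C.tgt w' = g ↔ w' = w₀ ∨ w' = w₁
  origin : ∀ o', C.origin o' = g ↔ o' = o
  src : ∀ w', C.src w' ≠ g

/-- The gate `g` reads only `v` and emits only the wire `w`. -/
structure IsPreparation (C : CausalStructure) (g : C.Gate) (v : C.Out ⊕ C.In)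
    (w : C.Latent) : Prop where
  reads : ∀ v', v' ∈ C.reads g ↔ v' = v
  tgt : ∀ w', C.tgt w' ≠ g
  origin : ∀ o', C.origin o' ≠ g
  src : ∀ w', C.src w' = g ↔ w' = w

/-- The inputs of a joint measurement. -/
def IsJointMeasurement.inMap (h : IsJointMeasurement C g v w₀ w₁ o) (card : C.Out ⊕ C.In → ℕ)
    (sys : ∀ w, Fin (len w) → T.Sys) :
    Reindex (gateIn C card sys g) (Sum.elim (one (.cl (card v))) (Sum.elim (sys w₀) (sys w₁))) :=
  (Reindex.obsOne card v h.reads).sum (Reindex.wireTwo sys w₀ w₁ h.ne h.tgt)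

/-- The outputs of a joint measurement. -/
def IsJointMeasurement.outMap (h : IsJointMeasurement C g v w₀ w₁ o)
    (card : C.Out ⊕ C.In → ℕ) (sys : ∀ w, Fin (len w) → T.Sys) :
    Reindex (gateOut C card sys g) (one (.cl (card (.inl o)))) :=
  (Reindex.obsOne (fun o => card (.inl o)) o h.origin).dropRight fun q => h.src _ q.1.2

/-- The inputs of a preparation. -/
def IsPreparation.inMap (h : IsPreparation C g v w) (card : C.Out ⊕ C.In → ℕ)
    (sys : ∀ w, Fin (len w) → T.Sys) :
    Reindex (gateIn C card sys g) (Sum.elim (one (.cl (card v))) T.triv) :=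
  (Reindex.obsOne card v h.reads).sum (Reindex.ofEmpty _ fun q => h.tgt _ q.1.2)

/-- The outputs of a preparation. -/
def IsPreparation.outMap (h : IsPreparation C g v w) (card : C.Out ⊕ C.In → ℕ)
    (sys : ∀ w, Fin (len w) → T.Sys) : Reindex (gateOut C card sys g) (sys w) :=
  (Reindex.wireOne sys w h.src).dropLeft fun o => h.origin _ o.2

theorem IsJointMeasurement.exists_family (h : IsJointMeasurement C g v w₀ w₁ o)
    (hT : IsProcessTheory T) {M : Proc (gateIn C card sys g) (gateOut C card sys g)}
    (hM : M ∈ T.Chan _ _) :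
    ∃ M' : Fin (card v + 1) → Proc (Sum.elim (sys w₀) (sys w₁)) (one (.cl (card (.inl o)))),
      (∀ x, M' x ∈ T.Chan _ _) ∧ ∀ l x i, M (outVal l x g) (inVal l x i g) =
        M' (CausalStructure.vals x i v) (fun _ => x o) (joinBas (l w₀) (l w₁)) := by
  obtain ⟨M', hM', h1⟩ := hT.exists_pullback (h.inMap card sys) (h.outMap card sys) hM
  exact ⟨fun x b a => M' b (joinBas (fun _ => x) a), fun x => hT.fix_mem hM' x,
    fun l x i => h1 _ _⟩

theorem IsJointMeasurement.exists_gate (h : IsJointMeasurement C g v w₀ w₁ o)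
    (hT : IsProcessTheory T)
    {M : Fin (card v + 1) → Proc (Sum.elim (sys w₀) (sys w₁)) (one (.cl (card (.inl o))))}
    (hM : ∀ x, M x ∈ T.Chan _ _) :
    ∃ M' : Proc (gateIn C card sys g) (gateOut C card sys g), M' ∈ T.Chan _ _ ∧
      ∀ l x i, M' (outVal l x g) (inVal l x i g) =
        M (CausalStructure.vals x i v) (fun _ => x o) (joinBas (l w₀) (l w₁)) :=
  ⟨_, hT.pullback_mem (h.inMap card sys) (h.outMap card sys) (hT.control hM), fun _ _ _ => rfl⟩

theorem IsPreparation.exists_family (h : IsPreparation C g v w) (hT : IsProcessTheory T)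
    {M : Proc (gateIn C card sys g) (gateOut C card sys g)} (hM : M ∈ T.Chan _ _) :
    ∃ M' : Fin (card v + 1) → Proc T.triv (sys w), (∀ x, M' x ∈ T.Chan _ _) ∧
      ∀ l x i, M (outVal l x g) (inVal l x i g) =
        M' (CausalStructure.vals x i v) (l w) trivBas := by
  obtain ⟨M', hM', h1⟩ := hT.exists_pullback (h.inMap card sys) (h.outMap card sys) hM
  exact ⟨fun x b a => M' b (joinBas (fun _ => x) a), fun x => hT.fix_mem hM' x,
    fun l x i => h1 _ _⟩

theorem IsPreparation.exists_gate (h : IsPreparation C g v w) (hT : IsProcessTheory T)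
    {M : Fin (card v + 1) → Proc T.triv (sys w)} (hM : ∀ x, M x ∈ T.Chan _ _) :
    ∃ M' : Proc (gateIn C card sys g) (gateOut C card sys g), M' ∈ T.Chan _ _ ∧
      ∀ l x i, M' (outVal l x g) (inVal l x i g) =
        M (CausalStructure.vals x i v) (l w) trivBas :=
  ⟨_, hT.pullback_mem (h.inMap card sys) (h.outMap card sys) (hT.control hM), fun _ _ _ => rfl⟩

theorem pbr_preparation₀ : IsPreparation PBR (0 : Fin 3) (.inr (0 : Fin 3)) (0 : Fin 2) where
  reads _ := Iff.rfl
  tgt := show ∀ w : Fin 2, (![2, 2] w : Fin 3) ≠ 0 by decide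
  origin := show ∀ w : Fin 1, (![2] w : Fin 3) ≠ 0 by decide
  src := show ∀ w : Fin 2, (![0, 1] w : Fin 3) = 0 ↔ w = 0 by decide

theorem pbr_preparation₁ : IsPreparation PBR (1 : Fin 3) (.inr (1 : Fin 3)) (1 : Fin 2) where
  reads _ := Iff.rfl
  tgt := show ∀ w : Fin 2, (![2, 2] w : Fin 3) ≠ 1 by decide
  origin := show ∀ w : Fin 1, (![2] w : Fin 3) ≠ 1 by decide
  src := show ∀ w : Fin 2, (![0, 1] w : Fin 3) = 1 ↔ w = 1 by decide

theorem pbr_measurement :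
    IsJointMeasurement PBR (2 : Fin 3) (.inr (2 : Fin 3)) (0 : Fin 2) (1 : Fin 2) (0 : Fin 1) where
  ne := show (0 : Fin 2) ≠ 1 by decide
  reads _ := Iff.rfl
  tgt := show ∀ w : Fin 2, (![2, 2] w : Fin 3) = 2 ↔ w = 0 ∨ w = 1 by decide
  origin := show ∀ w : Fin 1, (![2] w : Fin 3) = 2 ↔ w = 0 by decide
  src := show ∀ w : Fin 2, (![0, 1] w : Fin 3) ≠ 2 by decide

/-- The probability of the outcome `x` when `M` measures the systems prepared in `σ` and `τ`. -/
def jointProb {S : Systems.{u}} {ι κ : Type} [Fintype ι] [Fintype κ] {s : ι → S.Sys}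
    {t : κ → S.Sys} {n : ℕ} (σ : Proc S.triv s) (τ : Proc S.triv t)
    (M : Proc (Sum.elim s t) (one (.cl n))) (x : Fin (n + 1)) : ℝ :=
  Proc.comp M (Proc.par σ τ) (fun _ => x) (joinBas trivBas trivBas)

theorem sum_prod_pbr {S : Systems.{u}} {C : CausalStructure} (eL : Fin 2 ≃ C.Latent)
    (eG : Fin 3 ≃ C.Gate) {len : C.Latent → ℕ} {sys : ∀ w, Fin (len w) → S.Sys} {n : ℕ}
    {σ : Proc S.triv (sys (eL 0))} {τ : Proc S.triv (sys (eL 1))}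
    {M : Proc (Sum.elim (sys (eL 0)) (sys (eL 1))) (one (.cl n))} {x : Fin (n + 1)}
    {val : C.Gate → (∀ w, Bas (sys w)) → ℝ}
    (h0 : ∀ l, val (eG 0) l = σ (l (eL 0)) trivBas)
    (h1 : ∀ l, val (eG 1) l = τ (l (eL 1)) trivBas)
    (h2 : ∀ l, val (eG 2) l = M (fun _ => x) (joinBas (l (eL 0)) (l (eL 1)))) :
    ∑ l, ∏ g, val g l = jointProb σ τ M x := by
  refine Eq.trans ?_ ((comp_apply _ _ _ _).trans (sum_joinBas _)).symm
  refine Eq.trans (Finset.sum_congr rfl fun l _ => ?_) (sum_pi_two (α := fun w => Bas (sys w)) eL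
    fun a b => M (fun _ => x) (joinBas a b) * (σ a trivBas * τ b trivBas))
  rw [← eG.prod_comp, Fin.prod_univ_three, h0, h1, h2]
  ring

/-- The deterministic state with value `a`. -/
def pointState {S : Systems.{u}} {ι : Type} {s : ι → S.Sys} (a : Bas s) : Proc S.triv s :=
  fun b _ => if b = a then 1 else 0

/-- With deterministic preparations the contraction just evaluates the measurement at the prepared
values. -/
theorem jointProb_pointState {S : Systems.{u}} {ι κ : Type} [Fintype ι] [Fintype κ]
    {s : ι → S.Sys} {t : κ → S.Sys} {n : ℕ} (a₀ : Bas s) (b₀ : Bas t)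
    (M : Proc (Sum.elim s t) (one (.cl n))) (x : Fin (n + 1)) :
    jointProb (pointState a₀) (pointState b₀) M x = M (fun _ => x) (joinBas a₀ b₀) := by
  refine (comp_apply _ _ _ _).trans ((sum_joinBas _).trans ?_)
  simp only [par_joinBas, pointState]
  simp

theorem IsProcessTheory.pointState_mem (hT : IsProcessTheory T) {ι : Type} [Fintype ι]
    {s : ι → T.Sys} (hs : ∀ i, ∃ n, s i = .cl n) (a : Bas s) :
    pointState a ∈ T.Chan T.triv s :=
  hT.mem_of_stochastic (fun e => e.elim) hs
    (fun b _ => by unfold pointState; split_ifs <;> norm_num) fun _ =>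
    (Finset.sum_eq_single a (fun _ _ h => if_neg h)
      fun h => absurd (Finset.mem_univ _) h).trans (if_pos rfl)

/-- A one-component tuple. -/
def finOnePiEquiv (α : Fin 1 → Type) : (∀ w, α w) ≃ α 0 where
  toFun l := l 0
  invFun p := fun | 0 => p
  left_inv l := by funext w; match w with | 0 => rfl
  right_inv _ := rfl

/-- The measurement is downstream of all settings and is the only gate with an outcome, so nothing
restricts how A depends on X, Y and Z. -/
theorem mem_realizable_pbr_iff (hT : IsProcessTheory T) (card : PBR.Out ⊕ PBR.In → ℕ)
    (P : PBR.OutVals card → PBR.InVals card → ℝ) :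
    (⟨card, P⟩ : PBR.Corr) ∈ realizable T PBR ↔ (∀ o i, 0 ≤ P o i) ∧ ∀ i, ∑ o, P o i = 1 := by
  constructor
  · rintro ⟨K, hK⟩
    obtain ⟨σ, hσ, h0⟩ := pbr_preparation₀.exists_family hT (K.valid (0 : Fin 3))
    obtain ⟨τ, hτ, h1⟩ := pbr_preparation₁.exists_family hT (K.valid (1 : Fin 3))
    obtain ⟨M, hM, h2⟩ := pbr_measurement.exists_family hT (K.valid (2 : Fin 3))
    have h3 : ∀ o i, P o i = jointProb (σ (i (0 : Fin 3))) (τ (i (1 : Fin 3)))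
        (M (i (2 : Fin 3))) (o (0 : Fin 1)) := fun o i =>
      (hK o i).trans ((K.prob_eq o i).trans (sum_prod_pbr (C := PBR) (Equiv.refl (Fin 2))
        (Equiv.refl (Fin 3)) (fun l => h0 l o i) (fun l => h1 l o i) fun l => h2 l o i))
    have h4 := fun x y z => hT.stochastic_of_mem (Sum.rec (fun e => e.elim) fun e => e.elim)
      (fun _ => ⟨_, rfl⟩) (hT.comp (hM z) (hT.par (hσ x) (hτ y)))
    refine ⟨fun o i => ?_, fun i => ?_⟩
    · rw [h3]
      exact (h4 _ _ _).1 _ _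
    · have h5 := (h4 (i (0 : Fin 3)) (i (1 : Fin 3)) (i (2 : Fin 3))).2 (joinBas trivBas trivBas)
      have h6 : ∑ x, jointProb (σ (i (0 : Fin 3))) (τ (i (1 : Fin 3))) (M (i (2 : Fin 3))) x = 1 :=
        (sum_one _).symm.trans h5
      let e : PBR.OutVals card ≃ Fin (card (.inl (0 : Fin 1)) + 1) :=
        finOnePiEquiv fun o : Fin 1 => Fin (card (.inl o) + 1)
      exact (Fintype.sum_equiv e (fun o => P o i) _ fun o => h3 o i).trans h6
  · rintro ⟨hP0, hP1⟩
    -- Each wire is one classical system with the alphabet of the setting of its source, and carries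
    -- that setting unchanged.
    let sys : ∀ w : Fin 2, Fin 1 → T.Sys :=
      fun w _ => .cl (card (.inr ((![0, 1] : Fin 2 → Fin 3) w)))
    have hsys : ∀ w j, ∃ n, sys w j = .cl n := fun _ _ => ⟨_, rfl⟩
    let pt : ∀ (w : Fin 2), Fin (card (.inr ((![0, 1] : Fin 2 → Fin 3) w)) + 1) → Bas (sys w) :=
      fun w x _ => x
    let δ : ∀ (w : Fin 2), Fin (card (.inr ((![0, 1] : Fin 2 → Fin 3) w)) + 1) →
      Proc T.triv (sys w) := fun w x => pointState (pt w x)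
    have hδ : ∀ w x, δ w x ∈ T.Chan T.triv (sys w) := fun w x => hT.pointState_mem (hsys w) _
    let inp : Fin (card (.inr (0 : Fin 3)) + 1) → Fin (card (.inr (1 : Fin 3)) + 1) →
      Fin (card (.inr (2 : Fin 3)) + 1) → PBR.InVals card :=
        fun x y z (j : Fin 3) => match j with | 0 => x | 1 => y | 2 => z
    let e : Fin (card (.inl (0 : Fin 1)) + 1) ≃ PBR.OutVals card :=
      (finOnePiEquiv fun o : Fin 1 => Fin (card (.inl o) + 1)).symm
    let P' : Fin (card (.inl (0 : Fin 1)) + 1) → Fin (card (.inr (0 : Fin 3)) + 1) →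
      Fin (card (.inr (1 : Fin 3)) + 1) → Fin (card (.inr (2 : Fin 3)) + 1) → ℝ :=
        fun a x y z => P (e a) (inp x y z)
    have hP' : ∀ x y z, ∑ a, P' a x y z = 1 := fun x y z =>
      (Fintype.sum_equiv e (fun a => P' a x y z) (fun o => P o (inp x y z)) fun o => rfl).trans
        (hP1 (inp x y z))
    -- The measurement reads X and Y off the wires and draws A from the prescribed distribution.
    let M : Fin (card (.inr (2 : Fin 3)) + 1) →
        Proc (Sum.elim (sys 0) (sys 1)) (one (.cl (card (.inl (0 : Fin 1))))) := fun z b a =>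
      P' (b ()) (a (.inl (0 : Fin 1))) (a (.inr (0 : Fin 1))) z
    have hM : ∀ z, M z ∈ T.Chan _ _ := fun z =>
      hT.mem_of_stochastic (Sum.rec (hsys 0) (hsys 1)) (fun _ => ⟨_, rfl⟩)
        (fun b a => hP0 _ _) fun a => (sum_one (S := T.toSystems) fun b =>
          P' (b ()) (a (.inl (0 : Fin 1))) (a (.inr (0 : Fin 1))) z).trans (hP' _ _ _)
    obtain ⟨g0, hg0, h0⟩ :=
      pbr_preparation₀.exists_gate (card := card) (sys := sys) hT (hδ (0 : Fin 2))
    obtain ⟨g1, hg1, h1⟩ :=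
      pbr_preparation₁.exists_gate (card := card) (sys := sys) hT (hδ (1 : Fin 2))
    obtain ⟨g2, hg2, h2⟩ := pbr_measurement.exists_gate (card := card) (sys := sys) hT hM
    obtain ⟨K, hK⟩ := exists_circuit (C := PBR) (card := card) (sys := sys) (T := T) rfl
      (val := fun g : Fin 3 => match g with
        | 0 => fun l _ i => δ (0 : Fin 2) (i (0 : Fin 3)) (l (0 : Fin 2)) trivBas
        | 1 => fun l _ i => δ (1 : Fin 2) (i (1 : Fin 3)) (l (1 : Fin 2)) trivBas
        | 2 => fun l o i => M (i (2 : Fin 3)) (fun _ => o (0 : Fin 1))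
            (joinBas (l (0 : Fin 2)) (l (1 : Fin 2))))
      (fun g : Fin 3 => match g with
        | 0 => ⟨g0, hg0, h0⟩ | 1 => ⟨g1, hg1, h1⟩ | 2 => ⟨g2, hg2, h2⟩)
    refine ⟨K, fun o i => Eq.symm ((hK o i).trans ?_)⟩
    refine (sum_prod_pbr (C := PBR) (Equiv.refl (Fin 2)) (Equiv.refl (Fin 3))
      (σ := δ (0 : Fin 2) (i (0 : Fin 3))) (τ := δ (1 : Fin 2) (i (1 : Fin 3)))
      (M := M (i (2 : Fin 3))) (x := o (0 : Fin 1)) (fun l => rfl)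
      (fun l => rfl) fun l => rfl).trans ?_
    refine (jointProb_pointState (pt (0 : Fin 2) (i (0 : Fin 3))) (pt (1 : Fin 2) (i (1 : Fin 3)))
      (M (i (2 : Fin 3))) (o (0 : Fin 1))).trans (congrArg₂ P ?_ ?_)
    · exact (finOnePiEquiv fun o => Fin (card (.inl o) + 1)).symm_apply_apply o
    · exact funext fun j : Fin 3 => match j with | 0 => rfl | 1 => rfl | 2 => rfl

theorem realizable_pbr_eq {T T' : Theory.{u}} (hT : IsProcessTheory T)
    (hT' : IsProcessTheory T') : realizable T PBR = realizable T' PBR := by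
  ext ⟨card, P⟩
  rw [mem_realizable_pbr_iff hT, mem_realizable_pbr_iff hT']

theorem algebraic_pbr : Algebraic PBR := fun card => ⟨∅, fun P => by
  rw [mem_realizable_pbr_iff isGPT_CPT.isProcessTheory]
  simp⟩

end PBRCircuit

/-! ### Shared reference frames -/

section PartialAct

variable {S : Systems.{u}} {G W : Type} [Fintype W] {len : W → ℕ}
  {F : G → ∀ q : S.Q, Matrix (S.Idx q) (S.Idx q) ℝ} {sys : ∀ w, Fin (len w) → S.Sys}
  {τ : (∀ w, Bas (sys w)) → ℝ}

/-- A multipartite state that is invariant under the collective action and under the action on some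
of the parties is not a shared reference frame state. -/
theorem not_isSharedReferenceFrame [Fintype G] [Nonempty G] {A : Set W} (hA : A.Nonempty)
    (hA' : A ≠ Set.univ) (h : ∀ g, (partialAct F sys A g).mulVec τ = τ)
    (h' : ∀ g, (partialAct F sys Set.univ g).mulVec τ = τ) :
    ¬ IsSharedReferenceFrame F sys τ := by
  have h1 : symmetrizeState F sys τ = τ := by
    rw [symmetrizeState, Finset.sum_congr rfl fun g _ => h' g, Finset.sum_const, Finset.card_univ,
      ← Nat.cast_smul_eq_nsmul ℝ, smul_smul,
      inv_mul_cancel₀ (Nat.cast_ne_zero.2 Fintype.card_ne_zero), one_smul]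
  intro h2
  obtain ⟨g, hg⟩ := h2 A hA hA'
  rw [h1] at hg
  exact hg (h g)

theorem Covariant.sum_act {ι : Type} [Fintype ι] {s : ι → S.Sys} {f : Proc S.triv s}
    (hf : Covariant F f) (g : G) (b : Bas s) {_ : Fintype (Bas s)} :
    ∑ a, act F g s b a * f a trivBas = f b trivBas := by
  have h := congrFun (congrFun (hf g) b) trivBas
  rw [act_triv, comp_id] at h
  exact (comp_apply _ _ _ _).symm.trans h

/-- Each factor is invariant on its own, so it does not matter on which of the parties the group
acts. -/
theorem partialAct_mulVec_two (e : Fin 2 ≃ W) {f : Proc S.triv (sys (e 0))}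
    {h : Proc S.triv (sys (e 1))} (hf : Covariant F f) (hh : Covariant F h)
    (hτ : ∀ x, τ x = f (x (e 0)) trivBas * h (x (e 1)) trivBas) (A : Set W) (g : G) :
    (partialAct F sys A g).mulVec τ = τ := by
  have key : ∀ (w : W) {f : Proc S.triv (sys w)}, Covariant F f → ∀ b : Bas (sys w),
      ∑ a, (if w ∈ A then act F g (sys w) b a else if b = a then 1 else 0) * f a trivBas =
        f b trivBas := by
    intro w f hf b
    split_ifs
    · exact hf.sum_act g b
    · simp
  funext b
  rw [hτ, ← key _ hf, ← key _ hh]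
  refine Eq.trans ?_ (Finset.sum_mul_sum _ _ _ _).symm
  refine Eq.trans (Finset.sum_congr rfl fun x _ => ?_) (sum_pi_two (α := fun w => Bas (sys w)) e
    fun x y => ((if e 0 ∈ A then act F g (sys (e 0)) (b (e 0)) x
        else if b (e 0) = x then 1 else 0) * f x trivBas) *
      ((if e 1 ∈ A then act F g (sys (e 1)) (b (e 1)) y
        else if b (e 1) = y then 1 else 0) * h y trivBas))
  rw [hτ]
  refine (congrArg (· * _) ((e.prod_comp fun w => if w ∈ A then act F g (sys w) (b w) (x w) else
    if b w = x w then 1 else 0).symm.trans (Fin.prod_univ_two _))).trans ?_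
  ring

/-- A covariant bipartite state is invariant only under joint action on both of its parties; hence
the condition that `A` splits neither pair. -/
theorem partialAct_mulVec_four (e : Fin 4 ≃ W) {f : Proc S.triv (Sum.elim (sys (e 0)) (sys (e 1)))}
    {h : Proc S.triv (Sum.elim (sys (e 2)) (sys (e 3)))} (hf : Covariant F f) (hh : Covariant F h)
    (hτ : ∀ x, τ x = f (joinBas (x (e 0)) (x (e 1))) trivBas *
      h (joinBas (x (e 2)) (x (e 3))) trivBas) {A : Set W} (hA : e 0 ∈ A ↔ e 1 ∈ A)
    (hA' : e 2 ∈ A ↔ e 3 ∈ A) (g : G) :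
    (partialAct F sys A g).mulVec τ = τ := by
  have key : ∀ (w w' : W) {f : Proc S.triv (Sum.elim (sys w) (sys w'))}, Covariant F f →
      (w ∈ A ↔ w' ∈ A) → ∀ (b : Bas (sys w)) (b' : Bas (sys w')),
      ∑ a, ∑ a', (if w ∈ A then act F g (sys w) b a else if b = a then 1 else 0) *
        (if w' ∈ A then act F g (sys w') b' a' else if b' = a' then 1 else 0) *
          f (joinBas a a') trivBas = f (joinBas b b') trivBas := by
    intro w w' f hf hw b b'
    by_cases h : w ∈ A
    · simp only [if_pos h, if_pos (hw.1 h)]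
      rw [← hf.sum_act g, sum_joinBas]
      simp only [act_elim, par_joinBas]
    · simp only [if_neg h, if_neg (mt hw.2 h)]
      simp
  funext b
  rw [hτ, ← key _ _ hf hA, ← key _ _ hh hA']
  refine Eq.trans (Finset.sum_congr rfl fun x _ => ?_) (sum_pi_four (α := fun w => Bas (sys w)) e
    (fun x y => (if e 0 ∈ A then act F g (sys (e 0)) (b (e 0)) x
        else if b (e 0) = x then 1 else 0) *
      (if e 1 ∈ A then act F g (sys (e 1)) (b (e 1)) y
        else if b (e 1) = y then 1 else 0) * f (joinBas x y) trivBas)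
    (fun x y => (if e 2 ∈ A then act F g (sys (e 2)) (b (e 2)) x
        else if b (e 2) = x then 1 else 0) *
      (if e 3 ∈ A then act F g (sys (e 3)) (b (e 3)) y
        else if b (e 3) = y then 1 else 0) * h (joinBas x y) trivBas))
  rw [hτ]
  refine (congrArg (· * _) ((e.prod_comp fun w => if w ∈ A then act F g (sys w) (b w) (x w) else
    if b w = x w then 1 else 0).symm.trans (Fin.prod_univ_four _))).trans ?_
  ring

end PartialAct

/-! ### Gates of circuits with tokens. -/

section Tokens

variable {T : Theory.{u}} {C : CausalStructure} {card : C.Out ⊕ C.In → ℕ} {len : C.Latent → ℕ}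
  {sys : ∀ w, Fin (len w) → T.Sys} {tokLen : {w // w ∉ C.stipulatedClassical} → ℕ}
  {tok : ∀ w, Fin (tokLen w) → T.Sys} {g : C.Gate} {v : C.Out ⊕ C.In} {o : C.Out}

/-- Discard the first component of a bipartite state. -/
def discardLeft {S : Systems.{u}} {ι κ : Type} [Fintype ι] {s : ι → S.Sys} {t : κ → S.Sys}
    (U : Proc s S.triv) (ρ : Proc S.triv (Sum.elim s t)) : Proc S.triv t :=
  fun b a => ∑ c, U trivBas c * ρ (joinBas c b) a

theorem discardLeft_par {S : Systems.{u}} {ι κ μ : Type} [Fintype ι] [Fintype κ] {s : ι → S.Sys}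
    {t : κ → S.Sys} {r : μ → S.Sys} [Fintype (Bas s)] [Fintype (Bas t)] (U : Proc s S.triv)
    (V : Proc t S.triv) (ρ : Proc S.triv (Sum.elim (Sum.elim s t) r)) (b : Bas r) :
    discardLeft (fun _ a => Proc.par U V (joinBas trivBas trivBas) a) ρ b trivBas =
      ∑ x, ∑ y, U trivBas x * V trivBas y * ρ (joinBas (joinBas x y) b) trivBas :=
  (sum_univ_congr _ _ _).trans (sum_joinBas _)

theorem IsProcessTheory.discardLeft_mem (hT : IsProcessTheory T) {ι κ : Type} [Fintype ι]
    [Fintype κ] {s : ι → T.Sys} {t : κ → T.Sys} {U : Proc s T.triv}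
    {ρ : Proc T.triv (Sum.elim s t)} (hU : U ∈ T.Chan s T.triv) (hρ : ρ ∈ T.Chan _ _) :
    discardLeft U ρ ∈ T.Chan T.triv t := by
  refine T.mem_of_eq (hT.pullback_mem (Reindex.refl _) (Reindex.trivSum t)
    (hT.comp (hT.par hU (hT.id_mem t)) hρ)) fun b a => Eq.symm ?_
  refine (comp_apply _ _ _ _).trans ((sum_joinBas _).trans (Finset.sum_congr rfl fun c _ => ?_))
  rw [Finset.sum_eq_single b]
  · refine congrArg (· * _) ?_
    exact (congrArg (U trivBas c * ·) (if_pos rfl)).trans (mul_one _)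
  · intro x _ hx
    exact mul_eq_zero_of_left (mul_eq_zero_of_right _ (if_neg hx.symm)) _
  · exact fun h => absurd (Finset.mem_univ _) h

/-- Outputs of the gate `g` in a circuit with tokens. -/
abbrev tokenOut (C : CausalStructure) (card : C.Out ⊕ C.In → ℕ) {S : Systems.{u}}
    {len : C.Latent → ℕ} (sys : ∀ w, Fin (len w) → S.Sys)
    {tokLen : {w // w ∉ C.stipulatedClassical} → ℕ} (tok : ∀ w, Fin (tokLen w) → S.Sys)
    (g : C.Gate) :=
  Sum.elim (obsSys S (C.origin · = g) fun o => card (.inl o))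
    (Sum.elim (wireSys (C.src · = g) sys)
      (wireSys (fun w : {w // w ∉ C.stipulatedClassical} => C.src w.1 = g) tok))

/-- Joint values at the outputs of a gate with tokens. -/
abbrev tokenVal (l : ∀ w, Bas (sys w)) (x : ∀ w, Bas (tok w)) (o : C.OutVals card) (g : C.Gate) :
    Bas (tokenOut C card sys tok g)
  | .inl v => o v.1
  | .inr (.inl p) => l p.1.1 p.2
  | .inr (.inr p) => x p.1.1 p.2

theorem TokenCircuit.state_eq (K : TokenCircuit T C card) (i : C.InVals card)
    (x : ∀ w, Bas (K.tok w)) :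
    K.state i x = ∑ o : C.OutVals card, ∑ l : (∀ w, Bas (K.sys w)),
      ∏ g, K.gate g (tokenVal l x o g) (inVal l o i g) := by
  refine Finset.sum_congr rfl fun o _ => Finset.sum_congr rfl fun l _ =>
    Finset.prod_congr rfl fun g _ => ?_
  congr 1
  · funext b
    rcases b with b | b | b <;> rfl
  · funext b
    rcases b with b | b <;> rfl

/-- A measurement emits no latent wire, hence no token, and is the same as in a circuit without
tokens. -/
theorem IsMeasurement.exists_token_family {w : C.Latent} (h : IsMeasurement C g v w o)
    (hT : IsProcessTheory T) {M : Proc (gateIn C card sys g) (tokenOut C card sys tok g)}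
    (hM : M ∈ T.Chan _ _) :
    ∃ M' : Fin (card v + 1) → Proc (sys w) (one (.cl (card (.inl o)))),
      (∀ y, M' y ∈ T.Chan _ _) ∧ ∀ l x y i, M (tokenVal l x y g) (inVal l y i g) =
        M' (CausalStructure.vals y i v) (fun _ => y o) (l w) := by
  obtain ⟨M', hM', h1⟩ := hT.exists_pullback (h.inMap card sys)
    ((Reindex.obsOne (fun o => card (.inl o)) o h.origin).dropRight
      (Sum.rec (fun q => h.src _ q.1.2) fun q => h.src _ q.1.2)) hM
  exact ⟨fun x b a => M' b (joinBas (fun _ => x) a), fun x => hT.fix_mem hM' x,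
    fun l x y i => h1 _ _⟩

theorem IsJointMeasurement.exists_token_family {w₀ w₁ : C.Latent}
    (h : IsJointMeasurement C g v w₀ w₁ o)
    (hT : IsProcessTheory T) {M : Proc (gateIn C card sys g) (tokenOut C card sys tok g)}
    (hM : M ∈ T.Chan _ _) :
    ∃ M' : Fin (card v + 1) → Proc (Sum.elim (sys w₀) (sys w₁)) (one (.cl (card (.inl o)))),
      (∀ y, M' y ∈ T.Chan _ _) ∧ ∀ l x y i, M (tokenVal l x y g) (inVal l y i g) =
        M' (CausalStructure.vals y i v) (fun _ => y o) (joinBas (l w₀) (l w₁)) := by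
  obtain ⟨M', hM', h1⟩ := hT.exists_pullback (h.inMap card sys)
    ((Reindex.obsOne (fun o => card (.inl o)) o h.origin).dropRight
      (Sum.rec (fun q => h.src _ q.1.2) fun q => h.src _ q.1.2)) hM
  exact ⟨fun x b a => M' b (joinBas (fun _ => x) a), fun x => hT.fix_mem hM' x,
    fun l x y i => h1 _ _⟩

theorem IsPreparation.exists_token_family {w : {w // w ∉ C.stipulatedClassical}}
    (h : IsPreparation C g v w.1) (hT : IsProcessTheory T)
    {M : Proc (gateIn C card sys g) (tokenOut C card sys tok g)} (hM : M ∈ T.Chan _ _) :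
    ∃ M' : Fin (card v + 1) → Proc T.triv (Sum.elim (sys w.1) (tok w)),
      (∀ y, M' y ∈ T.Chan _ _) ∧ ∀ l x y i, M (tokenVal l x y g) (inVal l y i g) =
        M' (CausalStructure.vals y i v) (joinBas (l w.1) (x w)) trivBas := by
  obtain ⟨M', hM', h1⟩ := hT.exists_pullback (h.inMap card sys)
    (((Reindex.wireOne sys w.1 h.src).sum (Reindex.wireOne tok w fun w' =>
      (h.src w'.1).trans Subtype.ext_iff.symm)).dropLeft fun o => h.origin _ o.2) hM
  exact ⟨fun x b a => M' b (joinBas (fun _ => x) a), fun x => hT.fix_mem hM' x,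
    fun l x y i => h1 _ _⟩

theorem IsSource.exists_token_state {w₀ w₁ : {w // w ∉ C.stipulatedClassical}}
    (h : IsSource C g w₀.1 w₁.1) (hT : IsProcessTheory T)
    {M : Proc (gateIn C card sys g) (tokenOut C card sys tok g)} (hM : M ∈ T.Chan _ _) :
    ∃ ρ : Proc T.triv (Sum.elim (Sum.elim (sys w₀.1) (sys w₁.1)) (Sum.elim (tok w₀) (tok w₁))),
      ρ ∈ T.Chan _ _ ∧ ∀ l x y i, M (tokenVal l x y g) (inVal l y i g) =
        ρ (joinBas (joinBas (l w₀.1) (l w₁.1)) (joinBas (x w₀) (x w₁))) trivBas := by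
  obtain ⟨ρ, hρ, h1⟩ := hT.exists_pullback (h.inMap card sys)
    (((Reindex.wireTwo sys w₀.1 w₁.1 h.ne h.src).sum (Reindex.wireTwo tok w₀ w₁
      (fun h' => h.ne (congrArg _ h')) fun w => (h.src w.1).trans
        (or_congr Subtype.ext_iff.symm Subtype.ext_iff.symm))).dropLeft fun o => h.origin _ o.2) hM
  exact ⟨ρ, hρ, fun l x y i => h1 _ _⟩

end Tokens

/-! ### Token states of the PBR and double Bell structures are products over the sources. -/

section NoSharedFrame

variable {T : Theory.{u}} {G : Type} [Group G] [Fintype G]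
  {F : G → ∀ q : T.Q, Matrix (T.Idx q) (T.Idx q) ℝ}

/-- The symmetrized theory contains the unit effects of the theory. -/
theorem existsUnique_discard_symmetrized (hT : IsGPT T) (hF : IsSymmetry T F) {ι : Type}
    [Fintype ι] (s : ι → (symmetrized T F).Sys) :
    ∃! U : Proc s (symmetrized T F).triv, U ∈ (symmetrized T F).Chan s (symmetrized T F).triv := by
  obtain ⟨U, hU, -⟩ := hT.discard s
  have h := twirl_mem hT.isProcessTheory hF hU
  exact ⟨_, h, fun V hV => (hT.discard s).unique hV.1 h.1⟩

/-- Takes uniqueness of the unit effect as an argument, so that it applies to the symmetrized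
theory, of which `IsGPT` is not available. -/
theorem sum_eq_unit (hT : IsProcessTheory T) {ι : Type} [Fintype ι] {s : ι → T.Sys}
    (hs : ∃! U : Proc s T.triv, U ∈ T.Chan s T.triv) {U : Proc s T.triv}
    (hU : U ∈ T.Chan s T.triv) {n : ℕ} {M : Proc s (one (.cl n))}
    (hM : M ∈ T.Chan s (one (.cl n))) (a : Bas s) : ∑ x, M (fun _ => x) a = U trivBas a := by
  have h : (fun _ _ => 1 : Proc (one (.cl n)) T.triv) ∈ T.Chan (one (.cl n)) T.triv :=
    hT.mem_of_stochastic (fun _ => ⟨n, rfl⟩) (fun e => e.elim)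
      (fun _ _ => zero_le_one) fun _ => sum_triv _
  rw [hs.unique hU (hT.comp h hM)]
  refine Eq.symm ((comp_apply _ _ _ _).trans ((sum_one _).trans ?_))
  exact Finset.sum_congr rfl fun _ _ => one_mul _

/-- With its outcome disregarded, the joint measurement discards both wires separately, and what is
left of each source is its own token state. -/
theorem sum_prod_pbr_token {S : Systems.{u}} {C : CausalStructure} (eL : Fin 2 ≃ C.Latent)
    (eG : Fin 3 ≃ C.Gate) {len : C.Latent → ℕ} {sys : ∀ w, Fin (len w) → S.Sys} {ι κ : Type}
    {s : ι → S.Sys} {t : κ → S.Sys} {α : Type} [Fintype α]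
    {σ : Proc S.triv (Sum.elim (sys (eL 0)) s)} {τ : Proc S.triv (Sum.elim (sys (eL 1)) t)}
    {U₀ : Proc (sys (eL 0)) S.triv} {U₁ : Proc (sys (eL 1)) S.triv}
    {M : α → Bas (sys (eL 0)) → Bas (sys (eL 1)) → ℝ} {x : Bas s} {y : Bas t}
    (hM : ∀ a b, ∑ o, M o a b = U₀ trivBas a * U₁ trivBas b)
    {val : α → C.Gate → (∀ w, Bas (sys w)) → ℝ}
    (h0 : ∀ o l, val o (eG 0) l = σ (joinBas (l (eL 0)) x) trivBas)
    (h1 : ∀ o l, val o (eG 1) l = τ (joinBas (l (eL 1)) y) trivBas)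
    (h2 : ∀ o l, val o (eG 2) l = M o (l (eL 0)) (l (eL 1))) :
    ∑ o, ∑ l, ∏ g, val o g l = discardLeft U₀ σ x trivBas * discardLeft U₁ τ y trivBas := by
  rw [Finset.sum_comm]
  refine Eq.trans (Finset.sum_congr rfl fun l _ => ?_) ((sum_pi_two (α := fun w => Bas (sys w)) eL
    fun a b => (U₀ trivBas a * σ (joinBas a x) trivBas) *
      (U₁ trivBas b * τ (joinBas b y) trivBas)).trans (Finset.sum_mul_sum _ _ _ _).symm)
  simp only [← eG.prod_comp, Fin.prod_univ_three, h0, h1, h2]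
  rw [← Finset.mul_sum, hM]
  ring

/-- The last variable occurs in the last factor only, and the sum over it does not depend on its
predecessor; so the variables can be removed from the end of the chain. -/
theorem sum_chain {α β γ δ : Type} [Fintype α] [Fintype β] [Fintype γ] [Fintype δ]
    {p : α → ℝ} {q : α → β → ℝ} {r : β → γ → ℝ} {s : γ → δ → ℝ} {P Q R S : ℝ}
    (hp : ∑ a, p a = P) (hq : ∀ a, ∑ b, q a b = Q) (hr : ∀ b, ∑ c, r b c = R)
    (hs : ∀ c, ∑ d, s c d = S) :
    ∑ z : α × β × γ × δ, p z.1 * q z.1 z.2.1 * r z.2.1 z.2.2.1 * s z.2.2.1 z.2.2.2 =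
      P * Q * R * S := by
  simp only [Fintype.sum_prod_type, ← Finset.mul_sum, hs, ← Finset.sum_mul, hr, hq, hp]

/-- For fixed values on the wires, the outcomes form the chain B, C, D, E of `sum_chain`.
Disregarding them replaces the four measurements by unit effects, which removes every link between
the two sources. -/
theorem sum_prod_doubleBell_token {S : Systems.{u}} {C : CausalStructure} (eL : Fin 4 ≃ C.Latent)
    (eG : Fin 6 ≃ C.Gate) {len : C.Latent → ℕ} {sys : ∀ w, Fin (len w) → S.Sys} {ι κ : Type}
    {s : ι → S.Sys} {t : κ → S.Sys} {α β γ δ : Type} [Fintype α] [Fintype β] [Fintype γ]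
    [Fintype δ] {σ : Proc S.triv (Sum.elim (Sum.elim (sys (eL 0)) (sys (eL 1))) s)}
    {τ : Proc S.triv (Sum.elim (Sum.elim (sys (eL 2)) (sys (eL 3))) t)}
    {U : ∀ w, Proc (sys w) S.triv}
    {M₂ : α → Bas (sys (eL 2)) → ℝ} {M₃ : α → β → Bas (sys (eL 0)) → ℝ}
    {M₄ : β → γ → Bas (sys (eL 3)) → ℝ} {M₅ : γ → δ → Bas (sys (eL 1)) → ℝ}
    {x : Bas s} {y : Bas t}
    (h2 : ∀ a, ∑ o, M₂ o a = U (eL 2) trivBas a) (h3 : ∀ o a, ∑ o', M₃ o o' a = U (eL 0) trivBas a)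
    (h4 : ∀ o a, ∑ o', M₄ o o' a = U (eL 3) trivBas a)
    (h5 : ∀ o a, ∑ o', M₅ o o' a = U (eL 1) trivBas a)
    {O : Type} [Fintype O] (e : O ≃ α × β × γ × δ) {val : O → C.Gate → (∀ w, Bas (sys w)) → ℝ}
    (v0 : ∀ o l, val o (eG 0) l = σ (joinBas (joinBas (l (eL 0)) (l (eL 1))) x) trivBas)
    (v1 : ∀ o l, val o (eG 1) l = τ (joinBas (joinBas (l (eL 2)) (l (eL 3))) y) trivBas)
    (v2 : ∀ o l, val o (eG 2) l = M₂ (e o).1 (l (eL 2)))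
    (v3 : ∀ o l, val o (eG 3) l = M₃ (e o).1 (e o).2.1 (l (eL 0)))
    (v4 : ∀ o l, val o (eG 4) l = M₄ (e o).2.1 (e o).2.2.1 (l (eL 3)))
    (v5 : ∀ o l, val o (eG 5) l = M₅ (e o).2.2.1 (e o).2.2.2 (l (eL 1))) :
    ∑ o, ∑ l, ∏ g, val o g l =
      discardLeft (fun _ a => Proc.par (U (eL 0)) (U (eL 1)) (joinBas trivBas trivBas) a) σ x
        trivBas *
      discardLeft (fun _ a => Proc.par (U (eL 2)) (U (eL 3)) (joinBas trivBas trivBas) a) τ y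
        trivBas := by
  rw [Finset.sum_comm, discardLeft_par, discardLeft_par]
  refine Eq.trans (Finset.sum_congr rfl fun l _ => ?_)
    (sum_pi_four (α := fun w => Bas (sys w)) eL
      (fun a b => U (eL 0) trivBas a * U (eL 1) trivBas b *
        σ (joinBas (joinBas a b) x) trivBas)
      (fun a b => U (eL 2) trivBas a * U (eL 3) trivBas b *
        τ (joinBas (joinBas a b) y) trivBas))
  have key := sum_chain (h2 (l (eL 2))) (fun o => h3 o (l (eL 0))) (fun o => h4 o (l (eL 3)))
    (fun o => h5 o (l (eL 1)))
  rw [← e.sum_comp] at key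
  simp only [← eG.prod_comp, Fin.prod_univ_six, v0, v1, v2, v3, v4, v5, mul_assoc] at key ⊢
  rw [← Finset.mul_sum, ← Finset.mul_sum, key]
  ring

theorem eq_trivBas_sum {S : Systems.{u}} (b : Bas (Sum.elim S.triv S.triv)) :
    b = joinBas trivBas trivBas :=
  funext fun e => (Sum.elim Empty.elim Empty.elim e : Empty).elim

theorem par_unit_mem (hT : IsProcessTheory T) {ι κ : Type} [Fintype ι] [Fintype κ]
    {s : ι → T.Sys} {t : κ → T.Sys} {U : Proc s T.triv} {V : Proc t T.triv}
    (hU : U ∈ T.Chan s T.triv) (hV : V ∈ T.Chan t T.triv) :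
    (fun _ a => Proc.par U V (joinBas trivBas trivBas) a) ∈ T.Chan (Sum.elim s t) T.triv :=
  T.mem_of_eq (hT.pullback_mem (Reindex.refl _) (Reindex.trivSum T.triv) (hT.par hU hV))
    fun b a => congrArg (fun c => Proc.par U V c a)
      (eq_trivBas_sum (S := T.toSystems) ((Reindex.trivSum T.triv).map b)).symm

/-- All the latent wires of the PBR scenario carry GPT systems. -/
def pbrWires : Fin 2 ≃ {w : PBR.Latent // w ∉ PBR.stipulatedClassical} :=
  ⟨fun w => ⟨w, fun h => h⟩, fun w => w.1, fun _ => rfl, fun _ => rfl⟩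

/-- All the latent wires of the structure with two districts carry GPT systems. -/
def doubleBellWires : Fin 4 ≃ {w : DoubleBell.Latent // w ∉ DoubleBell.stipulatedClassical} :=
  ⟨fun w => ⟨w, fun h => h⟩, fun w => w.1, fun _ => rfl, fun _ => rfl⟩

theorem TokenCircuit.exists_state_pbr (hT : IsProcessTheory T)
    (hD : ∀ {ι : Type} [Fintype ι] (s : ι → T.Sys), ∃! U : Proc s T.triv, U ∈ T.Chan s T.triv)
    {card : PBR.Out ⊕ PBR.In → ℕ} (K : TokenCircuit T PBR card) (i : PBR.InVals card) :
    ∃ f ∈ T.Chan T.triv (K.tok (pbrWires 0)), ∃ h ∈ T.Chan T.triv (K.tok (pbrWires 1)),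
      ∀ x, K.state i x = f (x (pbrWires 0)) trivBas * h (x (pbrWires 1)) trivBas := by
  obtain ⟨σ, hσ, h0⟩ := pbr_preparation₀.exists_token_family (w := pbrWires 0)
    hT (K.valid (0 : Fin 3))
  obtain ⟨τ, hτ, h1⟩ := pbr_preparation₁.exists_token_family (w := pbrWires 1)
    hT (K.valid (1 : Fin 3))
  obtain ⟨M, hM, h2⟩ := pbr_measurement.exists_token_family hT (K.valid (2 : Fin 3))
  obtain ⟨U, hU, -⟩ := hD (K.sys (0 : Fin 2))
  obtain ⟨V, hV, -⟩ := hD (K.sys (1 : Fin 2))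
  let e : PBR.OutVals card ≃ Fin (card (.inl (0 : Fin 1)) + 1) :=
    finOnePiEquiv fun o : Fin 1 => Fin (card (.inl o) + 1)
  have hsum : ∀ a b, ∑ o : PBR.OutVals card, M (i (2 : Fin 3)) (fun _ => e o)
      (joinBas a b) = U trivBas a * V trivBas b := fun a b =>
    (Fintype.sum_equiv e _ (fun x => M (i (2 : Fin 3)) (fun _ => x) (joinBas a b))
      fun _ => rfl).trans
      (sum_eq_unit hT (hD _) (par_unit_mem hT hU hV) (hM (i (2 : Fin 3))) (joinBas a b))
  exact ⟨_, hT.discardLeft_mem hU (hσ (i (0 : Fin 3))), _,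
    hT.discardLeft_mem hV (hτ (i (1 : Fin 3))), fun x =>
    (K.state_eq i x).trans (sum_prod_pbr_token (C := PBR) (Equiv.refl (Fin 2))
      (Equiv.refl (Fin 3)) (sys := K.sys) (U₀ := U) (U₁ := V)
      (M := fun o a b => M (i (2 : Fin 3)) (fun _ => e o) (joinBas a b)) hsum
      (fun o l => h0 l x o i) (fun o l => h1 l x o i) fun o l => h2 l x o i)⟩

theorem TokenCircuit.exists_state_doubleBell (hT : IsProcessTheory T)
    (hD : ∀ {ι : Type} [Fintype ι] (s : ι → T.Sys), ∃! U : Proc s T.triv, U ∈ T.Chan s T.triv)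
    {card : DoubleBell.Out ⊕ DoubleBell.In → ℕ} (K : TokenCircuit T DoubleBell card)
    (i : DoubleBell.InVals card) :
    ∃ f ∈ T.Chan T.triv (Sum.elim (K.tok (doubleBellWires 0)) (K.tok (doubleBellWires 1))),
    ∃ h ∈ T.Chan T.triv (Sum.elim (K.tok (doubleBellWires 2)) (K.tok (doubleBellWires 3))),
      ∀ x, K.state i x =
        f (joinBas (x (doubleBellWires 0)) (x (doubleBellWires 1))) trivBas *
        h (joinBas (x (doubleBellWires 2)) (x (doubleBellWires 3))) trivBas := by
  obtain ⟨σ, hσ, h0⟩ := doubleBell_source₀.exists_token_state (w₀ := doubleBellWires 0)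
    (w₁ := doubleBellWires 1) hT (K.valid (0 : Fin 6))
  obtain ⟨τ, hτ, h1⟩ := doubleBell_source₁.exists_token_state (w₀ := doubleBellWires 2)
    (w₁ := doubleBellWires 3) hT (K.valid (1 : Fin 6))
  obtain ⟨M₂, hM₂, h2⟩ := doubleBell_gate₂.exists_token_family hT (K.valid (2 : Fin 6))
  obtain ⟨M₃, hM₃, h3⟩ := doubleBell_gate₃.exists_token_family hT (K.valid (3 : Fin 6))
  obtain ⟨M₄, hM₄, h4⟩ := doubleBell_gate₄.exists_token_family hT (K.valid (4 : Fin 6))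
  obtain ⟨M₅, hM₅, h5⟩ := doubleBell_gate₅.exists_token_family hT (K.valid (5 : Fin 6))
  choose U hU using fun w => (hD (K.sys w)).exists
  have e2 := fun a => sum_eq_unit hT (hD _) (hU (2 : Fin 4)) (hM₂ (i (0 : Fin 1))) a
  have e3 := fun o a => sum_eq_unit hT (hD _) (hU (0 : Fin 4)) (hM₃ o) a
  have e4 := fun o a => sum_eq_unit hT (hD _) (hU (3 : Fin 4)) (hM₄ o) a
  have e5 := fun o a => sum_eq_unit hT (hD _) (hU (1 : Fin 4)) (hM₅ o) a
  let e : DoubleBell.OutVals card ≃ Fin (card (.inl (0 : Fin 4)) + 1) ×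
      Fin (card (.inl (1 : Fin 4)) + 1) × Fin (card (.inl (2 : Fin 4)) + 1) ×
      Fin (card (.inl (3 : Fin 4)) + 1) :=
    finFourPiEquiv fun o : Fin 4 => Fin (card (.inl o) + 1)
  have key := fun x : (∀ w, Bas (K.tok w)) => sum_prod_doubleBell_token
    (C := DoubleBell) (Equiv.refl (Fin 4))
    (Equiv.refl (Fin 6)) (sys := K.sys) (U := U)
    (σ := σ) (τ := τ)
    (M₂ := fun o a => M₂ (i (0 : Fin 1)) (fun _ => o) a)
    (M₃ := fun o o' a => M₃ o (fun _ => o') a)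
    (M₄ := fun o o' a => M₄ o (fun _ => o') a)
    (M₅ := fun o o' a => M₅ o (fun _ => o') a)
    (x := joinBas (x (doubleBellWires 0)) (x (doubleBellWires 1)))
    (y := joinBas (x (doubleBellWires 2)) (x (doubleBellWires 3))) e2 e3 e4 e5 e
    (val := fun o g l => K.gate g (tokenVal l x o g) (inVal l o i g))
    (fun o l => h0 l x o i) (fun o l => h1 l x o i) (fun o l => h2 l x o i)
    (fun o l => h3 l x o i) (fun o l => h4 l x o i) fun o l => h5 l x o i
  exact ⟨_, hT.discardLeft_mem (par_unit_mem hT (hU (0 : Fin 4)) (hU (1 : Fin 4))) hσ, _,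
    hT.discardLeft_mem (par_unit_mem hT (hU (2 : Fin 4)) (hU (3 : Fin 4))) hτ,
    fun x => (K.state_eq i x).trans (key x)⟩
theorem not_allowsSharedReferenceFrame_pbr (hT : IsGPT T) (hF : IsSymmetry T F) :
    ¬ AllowsSharedReferenceFrame T F PBR := by
  rintro ⟨card, K, i, hK⟩
  obtain ⟨f, hf, h, hh, hx⟩ := K.exists_state_pbr hT.isProcessTheory.symmetrized
    (existsUnique_discard_symmetrized hT hF) i
  have key := partialAct_mulVec_two (S := T.toSystems) pbrWires hf.2 hh.2 hx
  -- The offending bipartition separates the tokens of the two sources.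
  refine not_isSharedReferenceFrame (S := T.toSystems) (A := pbrWires '' {0})
    ((Set.singleton_nonempty _).image _) (fun h => ?_) (key _) (key _) hK
  obtain ⟨w, rfl, hw⟩ : pbrWires 1 ∈ pbrWires '' {0} := h ▸ Set.mem_univ _
  exact absurd (pbrWires.injective hw) (by decide)

theorem not_allowsSharedReferenceFrame_doubleBell (hT : IsGPT T) (hF : IsSymmetry T F) :
    ¬ AllowsSharedReferenceFrame T F DoubleBell := by
  rintro ⟨card, K, i, hK⟩
  obtain ⟨f, hf, h, hh, hx⟩ := K.exists_state_doubleBell hT.isProcessTheory.symmetrized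
    (existsUnique_discard_symmetrized hT hF) i
  have key := fun A h h' => partialAct_mulVec_four (S := T.toSystems) doubleBellWires hf.2 hh.2 hx
    (A := A) h h'
  -- The tokens of one source against those of the other: neither bipartite state is split.
  refine not_isSharedReferenceFrame (S := T.toSystems) (A := doubleBellWires '' {0, 1})
    ((Set.insert_nonempty _ _).image _) (fun h => ?_)
    (key _ (iff_of_true ⟨0, by simp, rfl⟩ ⟨1, by simp, rfl⟩) (iff_of_false ?_ ?_))
    (key _ (iff_of_true trivial trivial) (iff_of_true trivial trivial)) hK
  · obtain ⟨w, hw, hw'⟩ : doubleBellWires 2 ∈ doubleBellWires '' {0, 1} := h ▸ Set.mem_univ _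
    obtain rfl := doubleBellWires.injective hw'
    exact absurd hw (by simp)
  · rintro ⟨w, hw, hw'⟩
    obtain rfl := doubleBellWires.injective hw'
    exact absurd hw (by simp)
  · rintro ⟨w, hw, hw'⟩
    obtain rfl := doubleBellWires.injective hw'
    exact absurd hw (by simp)

end NoSharedFrame

/-! ### The product basis of Hermitian operators -/

section Herm

open Matrix

/-- Projector onto a basis vector. -/
def diagHerm {n : ℕ} (c x y : Fin n) : ℂ := if x = c ∧ y = c then 1 else 0

/-- Basis of the Hermitian operators on `ℂ ^ n`. -/
def pairHerm {n : ℕ} (c : Fin n × Fin n) (x y : Fin n) : ℂ :=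
  (1 + Complex.I) / 2 * (if c.1 = x ∧ c.2 = y then 1 else 0) +
    (1 - Complex.I) / 2 * if c.1 = y ∧ c.2 = x then 1 else 0

theorem herm_cl (n : ℕ) (c x y : Fin (n + 1)) :
    herm (.cl n) c x y = diagHerm c x y := by
  refine (Matrix.single_apply _ _ _ _ _).trans ?_
  simp only [diagHerm, eq_comm]
  rfl

theorem herm_gpt (q : ℕ) (c : Fin (q + 1) × Fin (q + 1)) (x y : Fin (q + 1)) :
    herm (.gpt q) c x y = pairHerm c x y := by
  change (((1 + Complex.I) / 2) • Matrix.single c.1 c.2 (1 : ℂ) +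
    ((1 - Complex.I) / 2) • Matrix.single c.2 c.1 (1 : ℂ)) x y = _
  simp only [Matrix.add_apply, Matrix.smul_apply, Matrix.single_apply, pairHerm, smul_eq_mul,
    and_comm (a := c.2 = x)]

theorem star_diagHerm {n : ℕ} (c x y : Fin n) : star (diagHerm c x y) = diagHerm c y x := by
  simp only [diagHerm, and_comm (a := x = c)]
  split_ifs <;> simp

theorem star_pairHerm {n : ℕ} (c : Fin n × Fin n) (x y : Fin n) :
    star (pairHerm c x y) = pairHerm c y x := by
  simp only [pairHerm, Complex.star_def, map_add, map_mul, map_div₀, map_sub, map_one,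
    Complex.conj_I, apply_ite (starRingEnd ℂ), map_zero, map_ofNat]
  ring

theorem pairHerm_swap {n : ℕ} (c : Fin n × Fin n) (x y : Fin n) :
    pairHerm (c.2, c.1) x y = pairHerm c y x := by
  simp only [pairHerm, and_comm]

theorem sum_diagHerm_mul {n : ℕ} (x y z w : Fin n) :
    ∑ c, diagHerm c x y * diagHerm c z w = if x = w ∧ y = z ∧ x = y then 1 else 0 := by
  simp only [diagHerm]
  by_cases h : x = y ∧ x = z ∧ x = w
  · obtain ⟨rfl, rfl, rfl⟩ := h
    simp
  · rw [if_neg fun h' => h (by aesop)]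
    refine Finset.sum_eq_zero fun c _ => ?_
    by_cases h1 : x = c ∧ y = c
    · rw [if_neg fun h2 : z = c ∧ w = c => h (by aesop), mul_zero]
    · rw [if_neg h1, zero_mul]

/-- Completeness of the basis: the sum of `E ⊗ E` over its elements is the swap operator. -/
theorem sum_pairHerm_mul {n : ℕ} (x y z w : Fin n) :
    ∑ c, pairHerm c x y * pairHerm c z w = if x = w ∧ y = z then 1 else 0 := by
  let δ : Fin n × Fin n → Fin n → Fin n → ℂ := fun c i j => if c.1 = i ∧ c.2 = j then 1 else 0
  have h2 : ∀ i j k l : Fin n, ∑ c, δ c i j * δ c k l = if i = k ∧ j = l then 1 else 0 := by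
    intro i j k l
    rw [Finset.sum_eq_single (i, j)]
    · simp [δ]
    · rintro ⟨c, d⟩ - h
      exact mul_eq_zero_of_left (if_neg fun h' => h (Prod.ext h'.1 h'.2)) _
    · exact fun h => absurd (Finset.mem_univ _) h
  have h3 : ∀ c, pairHerm c x y * pairHerm c z w =
      Complex.I / 2 * (δ c x y * δ c z w) + 1 / 2 * (δ c x y * δ c w z) +
      1 / 2 * (δ c y x * δ c z w) - Complex.I / 2 * (δ c y x * δ c w z) := by
    intro c
    change ((1 + Complex.I) / 2 * δ c x y + (1 - Complex.I) / 2 * δ c y x) *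
      ((1 + Complex.I) / 2 * δ c z w + (1 - Complex.I) / 2 * δ c w z) = _
    linear_combination (δ c x y * δ c z w - δ c x y * δ c w z - δ c y x * δ c z w +
      δ c y x * δ c w z) / 4 * Complex.I_mul_I
  rw [Finset.sum_congr rfl fun c _ => h3 c]
  simp only [Finset.sum_sub_distrib, Finset.sum_add_distrib, ← Finset.mul_sum, h2]
  simp only [and_comm (a := y = z), and_comm (a := y = w)]
  ring

theorem sum_diagHerm_mul_swap {n : ℕ} (b c : Fin n) :
    ∑ x, ∑ y, diagHerm b x y * diagHerm c y x = if b = c then 1 else 0 := by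
  simp only [diagHerm]
  rw [Finset.sum_eq_single b, Finset.sum_eq_single b]
  · simp
  · intro x _ hx
    simp [hx]
  · exact fun h => absurd (Finset.mem_univ _) h
  · intro x _ hx
    simp [hx]
  · exact fun h => absurd (Finset.mem_univ _) h

theorem sum_pairHerm_mul_swap {n : ℕ} (b c : Fin n × Fin n) :
    ∑ x, ∑ y, pairHerm b x y * pairHerm c y x = if b = c then 1 else 0 := by
  have h1 : ∀ x y, pairHerm b x y = (1 + Complex.I) / 2 * (if (x, y) = b then 1 else 0) +
      (1 - Complex.I) / 2 * if (x, y) = (b.2, b.1) then 1 else 0 := by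
    intro x y
    simp only [pairHerm, Prod.ext_iff, and_comm, eq_comm]
  rw [← Fintype.sum_prod_type']
  simp only [h1, add_mul, mul_assoc, Finset.sum_add_distrib, ← Finset.mul_sum, ite_mul, one_mul,
    zero_mul, Finset.sum_ite_eq', Finset.mem_univ, if_true]
  simp only [pairHerm, Prod.ext_iff]
  simp only [eq_comm (a := b.1), eq_comm (a := b.2)]
  linear_combination ((if c.1 = b.2 ∧ c.2 = b.1 then 1 else 0) / 2 -
    (if c.1 = b.1 ∧ c.2 = b.2 then 1 else 0) / 2) * Complex.I_mul_I

theorem star_herm : ∀ (a : quantumSystems.Sys) (c : a.Ix) (x y : Fin (hdim a + 1)),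
    star (herm a c x y) = herm a c y x
  | .cl n, c, x, y => (congrArg star (herm_cl n c x y)).trans
      ((star_diagHerm _ _ _).trans (herm_cl n c y x).symm)
  | .gpt q, c, x, y => (congrArg star (herm_gpt q c x y)).trans
      ((star_pairHerm _ _ _).trans (herm_gpt q c y x).symm)

/-- Coefficients that restrict the operators of a classical system to the diagonal. -/
def diagCoeff : ∀ a : quantumSystems.Sys, Fin (hdim a + 1) → Fin (hdim a + 1) → ℂ
  | .cl _, x, y => if x = y then 1 else 0
  | .gpt _, _, _ => 1

/-- Completeness for both kinds of systems; for a classical one the basis spans the diagonal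
operators only, whence the factor `diagCoeff`. -/
theorem sum_herm_mul : ∀ (a : quantumSystems.Sys) (x y z w : Fin (hdim a + 1)),
    ∑ c, herm a c x y * herm a c z w = if x = w ∧ y = z then diagCoeff a x y else 0
  | .cl n, x, y, z, w => (Finset.sum_congr rfl fun c _ => congrArg₂ (· * ·) (herm_cl n c x y)
      (herm_cl n c z w)).trans ((sum_diagHerm_mul (n := n + 1) x y z w).trans (by
        simp only [diagCoeff, ← ite_and, and_assoc]
        rfl))
  | .gpt q, x, y, z, w => (Finset.sum_congr rfl fun c _ => congrArg₂ (· * ·) (herm_gpt q c x y)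
      (herm_gpt q c z w)).trans (sum_pairHerm_mul (n := Nat.succ q) x y z w)

theorem sum_herm_mul_swap : ∀ (a : quantumSystems.Sys) (b c : a.Ix),
    ∑ x, ∑ y, herm a b x y * herm a c y x = if b = c then 1 else 0
  | .cl n, b, c => (Finset.sum_congr rfl fun x _ => Finset.sum_congr rfl fun y _ =>
      congrArg₂ (· * ·) (herm_cl n b x y) (herm_cl n c y x)).trans
        ((sum_diagHerm_mul_swap (n := n + 1) b c).trans (by congr))
  | .gpt q, b, c => (Finset.sum_congr rfl fun x _ => Finset.sum_congr rfl fun y _ =>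
      congrArg₂ (· * ·) (herm_gpt q b x y) (herm_gpt q c y x)).trans
        ((sum_pairHerm_mul_swap (n := Nat.succ q) b c).trans (by congr))

/-- A dilation of `diagCoeff`. -/
def diagKraus : ∀ a : quantumSystems.Sys, Fin (hdim a + 1) → Fin (hdim a + 1) → ℂ
  | .cl _, u, x => if u = x then 1 else 0
  | .gpt _, u, _ => if u = 0 then 1 else 0

theorem sum_diagKraus : ∀ (a : quantumSystems.Sys) (x y : Fin (hdim a + 1)),
    ∑ u, diagKraus a u x * star (diagKraus a u y) = diagCoeff a x y
  | .cl n, x, y => by simp [diagKraus, diagCoeff, eq_comm, apply_ite (starRingEnd ℂ)]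
  | .gpt q, x, y => by simp [diagKraus, diagCoeff]

theorem diagCoeff_self : ∀ (a : quantumSystems.Sys) (x : Fin (hdim a + 1)), diagCoeff a x x = 1
  | .cl _, _ => if_pos rfl
  | .gpt _, _ => rfl

variable {ι : Type} [Fintype ι] {s : ι → quantumSystems.Sys}

theorem star_hermProd (c : Bas s) (x y : HBas s) :
    star (hermProd s c x y) = hermProd s c y x :=
  (map_prod (starRingEnd ℂ) _ _).trans (Finset.prod_congr rfl fun _ _ => star_herm _ _ _ _)

theorem conjTranspose_hermProd (c : Bas s) : (hermProd s c)ᴴ = hermProd s c :=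
  Matrix.ext fun x y => star_hermProd c y x

theorem sum_hermProd_mul (x y z w : HBas s) :
    ∑ c, hermProd s c x y * hermProd s c z w =
      if x = w ∧ y = z then ∏ i, diagCoeff (s i) (x i) (y i) else 0 := by
  simp only [hermProd, ← Finset.prod_mul_distrib]
  refine (Fintype.prod_sum fun i c => herm (s i) c (x i) (y i) * herm (s i) c (z i) (w i)).symm.trans
    ?_
  simp only [sum_herm_mul]
  split_ifs with h
  · exact Finset.prod_congr rfl fun i _ => if_pos ⟨congrFun h.1 i, congrFun h.2 i⟩
  · obtain ⟨i, hi⟩ : ∃ i, ¬ (x i = w i ∧ y i = z i) := by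
      by_contra! h'
      exact h ⟨funext fun i => (h' i).1, funext fun i => (h' i).2⟩
    exact Finset.prod_eq_zero (Finset.mem_univ i) (if_neg hi)

/-- Orthonormality passes to products because the trace of a tensor product is the product of the
traces. -/
theorem trace_hermProd_mul (b c : Bas s) :
    (hermProd s b * hermProd s c).trace = if b = c then 1 else 0 := by
  have h1 : ∀ i, ∑ x, ∑ y, herm (s i) (b i) x y * herm (s i) (c i) y x =
      if b i = c i then 1 else 0 := fun i => sum_herm_mul_swap _ _ _
  have h2 : ∀ x y, hermProd s b x y * hermProd s c y x =
      ∏ i, herm (s i) (b i) (x i) (y i) * herm (s i) (c i) (y i) (x i) := fun x y =>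
    Finset.prod_mul_distrib.symm
  simp only [Matrix.trace, Matrix.diag, Matrix.mul_apply, h2]
  refine Eq.trans (Finset.sum_congr rfl fun x _ => (Fintype.prod_sum fun i y =>
    herm (s i) (b i) (x i) y * herm (s i) (c i) y (x i)).symm) ?_
  refine (Fintype.prod_sum fun i x => ∑ y, herm (s i) (b i) x y * herm (s i) (c i) y x).symm.trans ?_
  simp only [h1]
  split_ifs with h
  · exact Finset.prod_eq_one fun i _ => if_pos (congrFun h i)
  · obtain ⟨i, hi⟩ := Function.ne_iff.1 h
    exact Finset.prod_eq_zero (Finset.mem_univ i) (if_neg hi)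

/-- Restrict the classical systems to the diagonal. -/
theorem sum_hermProd_smul_trace (X : Matrix (HBas s) (HBas s) ℂ) :
    ∑ c, (hermProd s c * X).trace • hermProd s c =
      Matrix.of fun x y => X x y * ∏ i, diagCoeff (s i) (x i) (y i) := by
  ext x y
  simp only [Matrix.sum_apply, Matrix.smul_apply, smul_eq_mul, Matrix.trace, Matrix.diag,
    Matrix.mul_apply, Finset.sum_mul, Matrix.of_apply]
  rw [Finset.sum_comm]
  have h1 : ∀ z, ∑ c, ∑ w, hermProd s c z w * X w z * hermProd s c x y =
      ∑ w, if x = w ∧ y = z then X x y * ∏ i, diagCoeff (s i) (x i) (y i) else 0 := by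
    intro z
    rw [Finset.sum_comm]
    refine Finset.sum_congr rfl fun w _ => ?_
    have h2 := sum_hermProd_mul x y z w
    calc _ = X w z * ∑ c, hermProd s c x y * hermProd s c z w := by
          rw [Finset.mul_sum]
          exact Finset.sum_congr rfl fun _ _ => by ring
      _ = _ := by
        rw [h2]
        split_ifs with h
        · rw [h.1, h.2]
        · rw [mul_zero]
  rw [Finset.sum_congr rfl fun z _ => h1 z]
  simp [ite_and]

/-- Kraus operators of the restriction of the classical systems to the diagonal. -/
def dephase (s : ι → quantumSystems.Sys) (u : HBas s) : Matrix (HBas s) (HBas s) ℂ :=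
  Matrix.diagonal fun x => ∏ i, diagKraus (s i) (u i) (x i)

theorem sum_prod_diagKraus (x y : HBas s) :
    ∑ u : HBas s, (∏ i, diagKraus (s i) (u i) (x i)) * star (∏ i, diagKraus (s i) (u i) (y i)) =
      ∏ i, diagCoeff (s i) (x i) (y i) := by
  have h1 : ∀ u : HBas s, (∏ i, diagKraus (s i) (u i) (x i)) *
      star (∏ i, diagKraus (s i) (u i) (y i)) =
      ∏ i, diagKraus (s i) (u i) (x i) * star (diagKraus (s i) (u i) (y i)) := fun u =>
    (congrArg (_ * ·) (map_prod (starRingEnd ℂ) _ _)).trans Finset.prod_mul_distrib.symm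
  simp only [h1]
  refine (Fintype.prod_sum fun i u => diagKraus (s i) u (x i) *
    star (diagKraus (s i) u (y i))).symm.trans ?_
  exact Finset.prod_congr rfl fun i _ => sum_diagKraus _ _ _

/-- Projecting onto the span of the basis multiplies entries by the `diagCoeff`, and so does the
channel `dephase`. A sum over coordinates is therefore itself a channel, which is what composition
needs. -/
theorem sum_dephase (X : Matrix (HBas s) (HBas s) ℂ) :
    ∑ u, dephase s u * X * (dephase s u)ᴴ = ∑ c, (hermProd s c * X).trace • hermProd s c := by
  rw [sum_hermProd_smul_trace]
  ext x y
  rw [Matrix.sum_apply, Matrix.of_apply, ← sum_prod_diagKraus, Finset.mul_sum]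
  refine Finset.sum_congr rfl fun u _ => ?_
  rw [dephase, Matrix.diagonal_conjTranspose, Matrix.mul_diagonal, Matrix.diagonal_mul]
  exact by rw [Pi.star_apply]; ring

theorem sum_dephase_conjTranspose_mul :
    ∑ u, (dephase s u)ᴴ * dephase s u = 1 := by
  ext x y
  rw [Matrix.sum_apply]
  have h1 : ∀ u, ((dephase s u)ᴴ * dephase s u) x y = if x = y then
      (∏ i, diagKraus (s i) (u i) (x i)) * star (∏ i, diagKraus (s i) (u i) (x i)) else 0 := by
    intro u
    rw [dephase, Matrix.diagonal_conjTranspose, Matrix.diagonal_mul_diagonal,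
      Matrix.diagonal_apply]
    exact if_congr Iff.rfl (mul_comm _ _) rfl
  simp only [h1]
  rw [Matrix.one_apply]
  split_ifs with h
  · rw [sum_prod_diagKraus]
    exact Finset.prod_eq_one fun i _ => diagCoeff_self _ _
  · exact Finset.sum_const_zero

end Herm

/-! ### Kraus operators -/

section Kraus

open Matrix

variable {α β α' β' J J' : Type} [Fintype α] [Fintype β] [Fintype α'] [Fintype β'] [Fintype J]
  [Fintype J']

/-- The matrix elements of the map with the Kraus operators `K`. -/
def krausForm (K : J → Matrix β α ℂ) (B : Matrix β β ℂ) (A : Matrix α α ℂ) : ℂ :=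
  ∑ j, (B * (K j * A * (K j)ᴴ)).trace

theorem krausForm_submatrix (φ : α' ≃ α) (φ' : β' ≃ β) (K : J → Matrix β α ℂ)
    (B : Matrix β β ℂ) (A : Matrix α α ℂ) :
    krausForm (fun j => (K j).submatrix φ' φ) (B.submatrix φ' φ') (A.submatrix φ φ) =
      krausForm K B A := by
  simp only [krausForm, conjTranspose_submatrix, submatrix_mul_equiv]
  refine Finset.sum_congr rfl fun j _ => ?_
  exact φ'.sum_comp fun x => (B * (K j * A * (K j)ᴴ)) x x

theorem sum_conjTranspose_submatrix_mul {α α' β β' J : Type} [Fintype β] [Fintype β'] [Fintype J]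
    [DecidableEq α] [DecidableEq α'] (φ : α' ≃ α) (φ' : β' ≃ β) {K : J → Matrix β α ℂ}
    (hK : ∑ j, (K j)ᴴ * K j = 1) :
    ∑ j, ((K j).submatrix φ' φ)ᴴ * (K j).submatrix φ' φ = 1 := by
  simp only [conjTranspose_submatrix, submatrix_mul_equiv]
  rw [← submatrix_one_equiv φ, ← hK]
  ext x y
  simp [Matrix.sum_apply]

/-- Completely positive maps preserve hermiticity, so their matrices in Hermitian bases are real. -/
theorem star_krausForm (K : J → Matrix β α ℂ) {B : Matrix β β ℂ} {A : Matrix α α ℂ} (hB : Bᴴ = B)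
    (hA : Aᴴ = A) : star (krausForm K B A) = krausForm K B A := by
  rw [krausForm, star_sum]
  refine Finset.sum_congr rfl fun j _ => ?_
  rw [← trace_conjTranspose, conjTranspose_mul, conjTranspose_mul, conjTranspose_mul,
    conjTranspose_conjTranspose, hA, hB, Matrix.trace_mul_comm, Matrix.mul_assoc]

theorem krausForm_one [DecidableEq α] [DecidableEq β] {K : J → Matrix β α ℂ}
    (hK : ∑ j, (K j)ᴴ * K j = 1) (A : Matrix α α ℂ) : krausForm K 1 A = A.trace := by
  have h1 : ∀ j, (1 * (K j * A * (K j)ᴴ)).trace = ((K j)ᴴ * K j * A).trace :=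
    fun j => by rw [Matrix.one_mul, Matrix.trace_mul_comm, Matrix.mul_assoc]
  rw [krausForm, Finset.sum_congr rfl fun j _ => h1 j, ← Matrix.trace_sum, ← Matrix.sum_mul, hK,
    Matrix.one_mul]

theorem krausForm_equiv (e : J' ≃ J) (K : J → Matrix β α ℂ) (B : Matrix β β ℂ)
    (A : Matrix α α ℂ) : krausForm (fun j => K (e j)) B A = krausForm K B A :=
  e.sum_comp fun j => (B * (K j * A * (K j)ᴴ)).trace

theorem krausForm_kronecker {γ δ : Type} [Fintype γ] [Fintype δ] (K : J → Matrix β α ℂ)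
    (L : J' → Matrix δ γ ℂ) (B : Matrix β β ℂ) (A : Matrix α α ℂ) (D : Matrix δ δ ℂ)
    (C : Matrix γ γ ℂ) :
    krausForm (fun j : J × J' => kroneckerMap (· * ·) (K j.1) (L j.2))
      (kroneckerMap (· * ·) B D) (kroneckerMap (· * ·) A C) = krausForm K B A * krausForm L D C := by
  rw [krausForm, krausForm, krausForm, Finset.sum_mul_sum, ← Fintype.sum_prod_type']
  refine Finset.sum_congr rfl fun j _ => ?_
  rw [← trace_kronecker, mul_kronecker_mul, mul_kronecker_mul, mul_kronecker_mul,
    conjTranspose_kronecker]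

/-- Multiplying the real matrices inserts the projection onto the span of the intermediate basis
between the two maps. This projection has the Kraus operators `D`, so the product has the Kraus
operators `L D K`. -/
theorem krausForm_comp {γ ι : Type} [Fintype γ] [Fintype ι] {U : Type} [Fintype U]
    (K : J → Matrix β α ℂ) (L : J' → Matrix γ β ℂ) (D : U → Matrix β β ℂ)
    (E : ι → Matrix β β ℂ)
    (hD : ∀ X, ∑ u, D u * X * (D u)ᴴ = ∑ c, (E c * X).trace • E c)
    (C : Matrix γ γ ℂ) (A : Matrix α α ℂ) :
    krausForm (fun j : J' × J × U => L j.1 * D j.2.2 * K j.2.1) C A =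
      ∑ c, krausForm L C (E c) * krausForm K (E c) A := by
  have h1 : ∀ k j, ∑ u, (C * (L k * D u * K j * A * (L k * D u * K j)ᴴ)).trace =
      ∑ c, (C * (L k * E c * (L k)ᴴ)).trace * (E c * (K j * A * (K j)ᴴ)).trace := by
    intro k j
    have h2 : ∀ u, L k * D u * K j * A * (L k * D u * K j)ᴴ =
        L k * (D u * (K j * A * (K j)ᴴ) * (D u)ᴴ) * (L k)ᴴ := by
      intro u
      simp only [conjTranspose_mul, Matrix.mul_assoc]
    simp only [h2]
    rw [← trace_sum, ← Matrix.mul_sum, ← Matrix.sum_mul, ← Matrix.mul_sum, hD]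
    simp only [Matrix.mul_sum, Matrix.sum_mul, trace_sum, Matrix.mul_smul, Matrix.smul_mul,
      trace_smul, smul_eq_mul]
    exact Finset.sum_congr rfl fun c _ => mul_comm _ _
  simp only [krausForm, Fintype.sum_prod_type, h1, Finset.sum_mul_sum]
  exact (Finset.sum_congr rfl fun k _ => Finset.sum_comm).trans Finset.sum_comm

theorem sum_conjTranspose_comp_mul {α β γ J J' U : Type} [Fintype β] [Fintype J] [Fintype J']
    [DecidableEq α] [DecidableEq β] [Fintype γ] [Fintype U] {K : J → Matrix β α ℂ}
    {L : J' → Matrix γ β ℂ} {D : U → Matrix β β ℂ}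
    (hK : ∑ j, (K j)ᴴ * K j = 1) (hL : ∑ j, (L j)ᴴ * L j = 1) (hD : ∑ j, (D j)ᴴ * D j = 1) :
    ∑ j : J' × J × U, (L j.1 * D j.2.2 * K j.2.1)ᴴ * (L j.1 * D j.2.2 * K j.2.1) = 1 := by
  have h2 : ∀ (k : J') (j : J) (u : U), (L k * D u * K j)ᴴ * (L k * D u * K j) =
      (K j)ᴴ * ((D u)ᴴ * ((L k)ᴴ * L k) * D u) * K j := by
    intro k j u
    simp only [conjTranspose_mul, Matrix.mul_assoc]
  simp only [Fintype.sum_prod_type, h2]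
  rw [Finset.sum_comm]
  have h3 : ∀ j, ∑ k, ∑ u, (K j)ᴴ * ((D u)ᴴ * ((L k)ᴴ * L k) * D u) * K j = (K j)ᴴ * K j := by
    intro j
    rw [Finset.sum_comm]
    simp only [← Matrix.sum_mul, ← Matrix.mul_sum, hL, Matrix.mul_one, hD]
  rw [Finset.sum_congr rfl fun j _ => h3 j, hK]

theorem sum_conjTranspose_kronecker_mul {α β γ δ J J' : Type} [Fintype β] [Fintype δ] [Fintype J]
    [Fintype J'] [DecidableEq α] [DecidableEq γ] {K : J → Matrix β α ℂ}
    {L : J' → Matrix δ γ ℂ} (hK : ∑ j, (K j)ᴴ * K j = 1) (hL : ∑ j, (L j)ᴴ * L j = 1) :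
    ∑ j : J × J', (kroneckerMap (· * ·) (K j.1) (L j.2))ᴴ * kroneckerMap (· * ·) (K j.1) (L j.2) =
      1 := by
  have h1 : ∀ j : J × J', (kroneckerMap (· * ·) (K j.1) (L j.2))ᴴ *
      kroneckerMap (· * ·) (K j.1) (L j.2) =
      kroneckerMap (· * ·) ((K j.1)ᴴ * K j.1) ((L j.2)ᴴ * L j.2) := fun j => by
    rw [mul_kronecker_mul, conjTranspose_kronecker]
  rw [← one_kronecker_one, ← hK, ← hL, Finset.sum_congr rfl fun j _ => h1 j]
  ext ⟨x, z⟩ ⟨y, w⟩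
  simp only [Matrix.sum_apply, kroneckerMap_apply, Finset.sum_mul_sum, Fintype.sum_prod_type]

theorem trace_single_mul_conj [DecidableEq β] (K : Matrix β α ℂ) (b : β) (X : Matrix α α ℂ) :
    (Matrix.single b b 1 * (K * X * Kᴴ)).trace = ∑ x, ∑ y, K b x * X x y * star (K b y) := by
  rw [Matrix.trace_single_mul, one_smul, Matrix.mul_apply]
  simp only [Matrix.mul_apply, Finset.sum_mul, Matrix.conjTranspose_apply]
  exact Finset.sum_comm

theorem krausForm_single [DecidableEq α] [DecidableEq β] (K : J → Matrix β α ℂ) (b : β) (a : α) :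
    krausForm K (Matrix.single b b 1) (Matrix.single a a 1) = ∑ j, K j b a * star (K j b a) := by
  refine Finset.sum_congr rfl fun j _ => (trace_single_mul_conj (K j) b _).trans ?_
  rw [Finset.sum_eq_single a, Finset.sum_eq_single a]
  · simp
  · intro y _ hy
    simp [hy.symm]
  · exact fun h => absurd (Finset.mem_univ _) h
  · intro x _ hx
    simp [hx.symm]
  · exact fun h => absurd (Finset.mem_univ _) h

theorem stochastic_of_krausForm [DecidableEq α] [DecidableEq β] {K : J → Matrix β α ℂ}
    (hK : ∑ j, (K j)ᴴ * K j = 1) {M : Matrix β α ℝ}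
    (hM : ∀ b a, (M b a : ℂ) = krausForm K (Matrix.single b b 1) (Matrix.single a a 1)) :
    Stochastic M := by
  have h1 : ∀ b a, M b a = ∑ j, Complex.normSq (K j b a) := by
    intro b a
    refine Complex.ofReal_injective ((hM b a).trans ((krausForm_single K b a).trans ?_))
    rw [Complex.ofReal_sum]
    exact Finset.sum_congr rfl fun j _ => Complex.mul_conj _
  refine ⟨fun b a => ?_, fun a => ?_⟩
  · rw [h1]
    exact Finset.sum_nonneg fun _ _ => Complex.normSq_nonneg _
  · refine Complex.ofReal_injective ?_
    have h2 := congrFun (congrFun hK a) a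
    rw [Matrix.sum_apply, Matrix.one_apply_eq] at h2
    refine Eq.trans ?_ h2
    simp only [h1, Complex.ofReal_sum, Matrix.mul_apply, Complex.normSq_eq_conj_mul_self]
    exact Finset.sum_comm

/-- The Kraus operators are the matrix units, weighted by the square roots of the transition
probabilities. -/
theorem exists_krausForm_of_stochastic [DecidableEq α] [DecidableEq β] {M : Matrix β α ℝ}
    (hM : Stochastic M) : ∃ (J : Type) (_ : Fintype J) (K : J → Matrix β α ℂ),
      ∑ j, (K j)ᴴ * K j = 1 ∧
      ∀ b a, (M b a : ℂ) = krausForm K (Matrix.single b b 1) (Matrix.single a a 1) := by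
  obtain ⟨h0, h1⟩ := hM
  have h3 : ∀ b a, star ((√(M b a) : ℝ) : ℂ) * ((√(M b a) : ℝ) : ℂ) = M b a := fun b a => by
    rw [Complex.star_def, Complex.conj_ofReal, ← Complex.ofReal_mul, Real.mul_self_sqrt (h0 _ _)]
  refine ⟨β × α, inferInstance, fun j => Matrix.single j.1 j.2 ((√(M j.1 j.2) : ℝ) : ℂ), ?_,
    fun b a => ?_⟩
  · simp only [Matrix.conjTranspose_single, Matrix.single_mul_single_same, h3,
      Fintype.sum_prod_type_right]
    ext x y
    simp only [Matrix.sum_apply, Matrix.single_apply]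
    rw [Finset.sum_eq_single x]
    · by_cases h : x = y
      · subst h
        simp only [and_self, if_true, Matrix.one_apply_eq]
        rw [← Complex.ofReal_sum, h1, Complex.ofReal_one]
      · simp [h]
    · intro z _ hz
      simp [hz]
    · exact fun h => absurd (Finset.mem_univ _) h
  · rw [krausForm_single, Finset.sum_eq_single (b, a)]
    · rw [Matrix.single_apply_same, mul_comm, h3]
    · rintro ⟨y, x⟩ - h
      rw [Matrix.single_apply, if_neg fun h' => h (Prod.ext h'.1 h'.2), zero_mul]
    · exact fun h => absurd (Finset.mem_univ _) h

/-- Kraus operators of a family of operations that is controlled by a classical system. -/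
def controlKraus {α β X : Type} [DecidableEq X] {J : X → Type} (K : ∀ x, J x → Matrix β α ℂ)
    (j : Σ x, J x) : Matrix β (X × α) ℂ :=
  Matrix.of fun y p => if p.1 = j.1 then K j.1 j.2 y p.2 else 0

theorem krausForm_control {X : Type} [Fintype X] [DecidableEq X] {J : X → Type}
    [∀ x, Fintype (J x)] (K : ∀ x, J x → Matrix β α ℂ) (B : Matrix β β ℂ) (A : Matrix α α ℂ)
    (c : X) :
    krausForm (controlKraus K) B (kroneckerMap (· * ·) (Matrix.single c c 1) A) =
      krausForm (K c) B A := by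
  have h1 : ∀ x (k : J x), controlKraus K ⟨x, k⟩ *
      (kroneckerMap (· * ·) (Matrix.single c c 1) A) * (controlKraus K ⟨x, k⟩)ᴴ =
        if c = x then K x k * A * (K x k)ᴴ else 0 := by
    intro x k
    ext y z
    simp only [controlKraus, Matrix.mul_apply, Matrix.of_apply, Fintype.sum_prod_type,
      kroneckerMap_apply, Matrix.single_apply, Matrix.conjTranspose_apply]
    split_ifs with h
    · subst h
      simp [ite_and, Matrix.mul_apply]
    · refine Finset.sum_eq_zero fun x' _ => Finset.sum_eq_zero fun z' _ => ?_
      by_cases h' : x' = x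
      · subst h'
        simp [h]
      · simp [h']
  rw [krausForm, Fintype.sum_sigma]
  simp only [h1]
  rw [Finset.sum_eq_single c]
  · simp [krausForm]
  · intro x _ hx
    simp [hx.symm]
  · exact fun h => absurd (Finset.mem_univ _) h

theorem sum_conjTranspose_controlKraus_mul {α β X : Type} [Fintype β] [Fintype X] [DecidableEq X]
    [DecidableEq α] {J : X → Type} [∀ x, Fintype (J x)] {K : ∀ x, J x → Matrix β α ℂ}
    (hK : ∀ x, ∑ j, (K x j)ᴴ * K x j = 1) :
    ∑ j, (controlKraus K j)ᴴ * controlKraus K j = 1 := by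
  ext ⟨x, z⟩ ⟨y, w⟩
  have h1 : ∀ c, ∑ j, ∑ b, star (controlKraus K ⟨c, j⟩ b (x, z)) * controlKraus K ⟨c, j⟩ b (y, w) =
      if x = c ∧ y = c ∧ z = w then 1 else 0 := by
    intro c
    by_cases h : x = c ∧ y = c
    · obtain ⟨rfl, rfl⟩ := h
      have h2 := congrFun (congrFun (hK y) z) w
      simp only [Matrix.sum_apply, Matrix.mul_apply, Matrix.conjTranspose_apply,
        Matrix.one_apply] at h2
      simpa [controlKraus] using h2
    · rw [if_neg fun h' => h ⟨h'.1, h'.2.1⟩]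
      refine Finset.sum_eq_zero fun j _ => Finset.sum_eq_zero fun b _ => ?_
      by_cases h3 : x = c
      · simp [controlKraus, show ¬ y = c from fun h' => h ⟨h3, h'⟩]
      · simp [controlKraus, h3]
  rw [Matrix.sum_apply, Fintype.sum_sigma]
  simp only [Matrix.mul_apply, Matrix.conjTranspose_apply, h1]
  rw [Matrix.one_apply, Finset.sum_eq_single x]
  · simp only [true_and, Prod.ext_iff, eq_comm (a := y)]
  · intro c _ hc
    rw [if_neg fun h => hc h.1.symm]
  · exact fun h => absurd (Finset.mem_univ _) h

end Kraus

/-! ### Closure properties and unit effects of quantum theory. -/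

section Quantum

open Matrix

variable {ι κ : Type} [Fintype ι] [Fintype κ] {s : ι → quantumSystems.Sys}
  {t : κ → quantumSystems.Sys}

/-- Allows arbitrary finite index types for the Kraus operators and for the bases of the Hilbert
spaces, such as product types. -/
theorem mem_QT_of_krausForm {α β J : Type} [Fintype α] [Fintype β] [Fintype J] [DecidableEq α]
    (φ : HBas s ≃ α) (φ' : HBas t ≃ β) {A : Bas s → Matrix α α ℂ} {B : Bas t → Matrix β β ℂ}
    (hA : ∀ a, hermProd s a = (A a).submatrix φ φ)
    (hB : ∀ b, hermProd t b = (B b).submatrix φ' φ') (K : J → Matrix β α ℂ)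
    (hK : ∑ j, (K j)ᴴ * K j = 1) {M : Proc s t}
    (hM : ∀ b a, (M b a : ℂ) = krausForm K (B b) (A a)) : M ∈ QT.Chan s t := by
  refine ⟨Fintype.card J, fun j => (K ((Fintype.equivFin J).symm j)).submatrix φ' φ, ?_,
    fun b a => ?_⟩
  · refine sum_conjTranspose_submatrix_mul φ φ' (K := fun j => K ((Fintype.equivFin J).symm j)) ?_
    exact ((Fintype.equivFin J).symm.sum_comp fun j => (K j)ᴴ * K j).trans hK
  · rw [hM, hA, hB, ← krausForm_equiv (Fintype.equivFin J).symm, ← krausForm_submatrix φ φ']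
    rfl

theorem exists_kraus {M : Proc s t} (hM : M ∈ QT.Chan s t) :
    ∃ (J : Type) (_ : Fintype J) (K : J → Matrix (HBas t) (HBas s) ℂ),
      ∑ k, (K k)ᴴ * K k = 1 ∧ ∀ b a, (M b a : ℂ) = krausForm K (hermProd t b) (hermProd s a) := by
  obtain ⟨m, K, hK, hM⟩ := hM
  exact ⟨Fin m, inferInstance, K, hK, hM⟩

theorem ofReal_re_krausForm {J : Type} [Fintype J] (K : J → Matrix (HBas t) (HBas s) ℂ) (b : Bas t)
    (a : Bas s) : ((krausForm K (hermProd t b) (hermProd s a)).re : ℂ) =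
      krausForm K (hermProd t b) (hermProd s a) :=
  Complex.conj_eq_iff_re.1
    (star_krausForm K (conjTranspose_hermProd b) (conjTranspose_hermProd a))

theorem hermProd_elim {ι κ : Type} [Fintype ι] [Fintype κ] {s : ι → quantumSystems.Sys}
    {t : κ → quantumSystems.Sys} (a : Bas (Sum.elim s t)) :
    hermProd (Sum.elim s t) a = (kroneckerMap (· * ·) (hermProd s fun i => a (.inl i))
      (hermProd t fun k => a (.inr k))).submatrix
        (Equiv.sumPiEquivProdPi fun i => Fin (hdim (Sum.elim s t i) + 1))
        (Equiv.sumPiEquivProdPi fun i => Fin (hdim (Sum.elim s t i) + 1)) :=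
  Matrix.ext fun _ _ => Fintype.prod_sum_type _

theorem QT_par {ι' κ' : Type} [Fintype ι'] [Fintype κ'] {s' : ι' → quantumSystems.Sys}
    {t' : κ' → quantumSystems.Sys} {M : Proc s t} {N : Proc s' t'} (hM : M ∈ QT.Chan s t)
    (hN : N ∈ QT.Chan s' t') : Proc.par M N ∈ QT.Chan (Sum.elim s s') (Sum.elim t t') := by
  obtain ⟨J, _, K, hK, hM⟩ := exists_kraus hM
  obtain ⟨J', _, L, hL, hN⟩ := exists_kraus hN
  refine mem_QT_of_krausForm _ _ hermProd_elim hermProd_elim _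
    (sum_conjTranspose_kronecker_mul hK hL) fun b a => ?_
  rw [krausForm_kronecker]
  exact (Complex.ofReal_mul _ _).trans (congrArg₂ (· * ·) (hM _ _) (hN _ _))

theorem QT_comp {μ : Type} [Fintype μ] {r : μ → quantumSystems.Sys} {M : Proc s t} {N : Proc t r}
    (hM : M ∈ QT.Chan s t) (hN : N ∈ QT.Chan t r) : Proc.comp N M ∈ QT.Chan s r := by
  obtain ⟨J, _, K, hK, hM⟩ := exists_kraus hM
  obtain ⟨J', _, L, hL, hN⟩ := exists_kraus hN
  refine mem_QT_of_krausForm (Equiv.refl _) (Equiv.refl _) (A := hermProd s) (B := hermProd r)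
    (fun _ => rfl) (fun _ => rfl) _
    (sum_conjTranspose_comp_mul hK hL sum_dephase_conjTranspose_mul) fun c a => ?_
  refine Eq.trans ?_ (krausForm_comp K L (dephase t) (hermProd t) sum_dephase _ _).symm
  rw [comp_apply]
  simp only [Complex.ofReal_sum, Complex.ofReal_mul, hM, hN]

/-- The Kraus operator is the identity between relabelled bases, and orthonormality turns its
coordinates into a permutation matrix. -/
theorem QT_relabel (e : κ ≃ ι) (s : ι → quantumSystems.Sys) :
    Proc.relabel e s ∈ QT.Chan s (fun k => s (e k)) := by
  let φ : HBas s ≃ HBas (fun k => s (e k)) :=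
    (Equiv.piCongrLeft (fun i => Fin (hdim (s i) + 1)) e).symm
  refine mem_QT_of_krausForm (s := s) (t := fun k => s (e k)) φ (Equiv.refl _) (B := hermProd _)
    (A := fun a => hermProd _ fun k => a (e k))
    (fun a => Matrix.ext fun x y => ?_) (fun _ => rfl) (fun _ : Unit => 1) (by simp) fun b a => ?_
  · exact (e.prod_comp fun i => herm (s i) (a i) (x i) (y i)).symm
  · rw [krausForm, Fintype.sum_unique, Matrix.one_mul, conjTranspose_one, Matrix.mul_one,
      trace_hermProd_mul]
    by_cases h : ∀ k, b k = a (e k)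
    · exact (congrArg Complex.ofReal (if_pos h)).trans
        (Complex.ofReal_one.trans (if_pos (funext h)).symm)
    · exact (congrArg Complex.ofReal (if_neg h)).trans
        (Complex.ofReal_zero.trans (if_neg fun h' => h (congrFun h')).symm)

theorem hermProd_cl (n : ι → ℕ) (a : ∀ i, Fin (n i + 1)) :
    hermProd (fun i => (.cl (n i) : quantumSystems.Sys)) a =
      (Matrix.single a a 1 : Matrix (∀ i, Fin (n i + 1)) (∀ i, Fin (n i + 1)) ℂ) := by
  refine Matrix.ext fun x y => ?_
  refine (Finset.prod_congr rfl fun i _ => herm_cl _ _ _ _).trans ?_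
  refine Eq.trans ?_ (Matrix.single_apply _ _ _ _ _).symm
  by_cases h : x = a ∧ y = a
  · rw [if_pos ⟨h.1.symm, h.2.symm⟩]
    exact Finset.prod_eq_one fun i _ => if_pos ⟨congrFun h.1 i, congrFun h.2 i⟩
  · rw [if_neg fun h' => h ⟨h'.1.symm, h'.2.symm⟩]
    obtain ⟨i, hi⟩ : ∃ i, ¬ (x i = a i ∧ y i = a i) := by
      by_contra! h'
      exact h ⟨funext fun i => (h' i).1, funext fun i => (h' i).2⟩
    exact Finset.prod_eq_zero (Finset.mem_univ i) (if_neg hi)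

theorem QT_classical (n : ι → ℕ) (m : κ → ℕ) :
    QT.Chan (fun i => .cl (n i)) (fun k => .cl (m k)) = {M | Stochastic M} := by
  ext M
  constructor
  · intro hM
    obtain ⟨J, _, K, hK, hM⟩ := exists_kraus (s := fun i => (.cl (n i) : quantumSystems.Sys))
      (t := fun k => (.cl (m k) : quantumSystems.Sys)) hM
    exact stochastic_of_krausForm (α := ∀ i, Fin (n i + 1)) (β := ∀ k, Fin (m k + 1)) hK
      (M := fun b a => M b a) fun b a =>
        (hM b a).trans (congrArg₂ (krausForm K) (hermProd_cl m b) (hermProd_cl n a))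
  · intro hM
    obtain ⟨J, _, K, hK, hM⟩ := exists_krausForm_of_stochastic (α := ∀ i, Fin (n i + 1))
      (β := ∀ k, Fin (m k + 1)) (M := fun b a => M b a) hM
    exact mem_QT_of_krausForm (s := fun i => (.cl (n i) : quantumSystems.Sys))
      (t := fun k => (.cl (m k) : quantumSystems.Sys)) (Equiv.refl _)
      (Equiv.refl _) (A := fun a => Matrix.single (a : ∀ i, Fin (n i + 1)) a 1)
      (B := fun b => Matrix.single (b : ∀ k, Fin (m k + 1)) b 1) (hermProd_cl n) (hermProd_cl m) K hK hM

theorem diagHerm_eq_single {n : ℕ} (c x y : Fin n) :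
    diagHerm c x y = (Matrix.single c c 1 : Matrix (Fin n) (Fin n) ℂ) x y := by
  simp only [diagHerm, Matrix.single_apply, eq_comm]

/-- Coordinates of the composite of a classical system and another system. -/
def hbasControl (n : ℕ) (s : ι → quantumSystems.Sys) :
    HBas (Sum.elim (one (.cl n)) s) ≃ Fin (n + 1) × HBas s :=
  (Equiv.sumPiEquivProdPi fun i => Fin (hdim (Sum.elim (one (.cl n)) s i) + 1)).trans
    ((Equiv.funUnique Unit (Fin (n + 1))).prodCongr (Equiv.refl _))

/-- The value of the classical system in a composite. -/
def controlVal {n : ℕ} (a : Bas (Sum.elim (one (.cl n)) s)) : Fin (n + 1) := a (.inl ())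

theorem hermProd_control (n : ℕ) (a : Bas (Sum.elim (one (.cl n)) s)) :
    hermProd (Sum.elim (one (.cl n)) s) a =
      (kroneckerMap (· * ·) (Matrix.single (controlVal a) (controlVal a) 1)
        (hermProd s fun i => a (.inr i))).submatrix (hbasControl n s) (hbasControl n s) := by
  refine Matrix.ext fun x y => (Fintype.prod_sum_type _).trans (congrArg (· * _) ?_)
  exact (Fintype.prod_unique _).trans ((herm_cl n (controlVal a) _ _).trans
    (diagHerm_eq_single _ _ _))

theorem QT_control {n : ℕ} {E : Fin (n + 1) → Proc s t} (hE : ∀ x, E x ∈ QT.Chan s t) :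
    Proc.control E ∈ QT.Chan (Sum.elim (one (.cl n)) s) t := by
  choose J hJ K hK hM using fun x => exists_kraus (hE x)
  exact mem_QT_of_krausForm (s := Sum.elim (one (.cl n)) s) (hbasControl n s) (Equiv.refl _)
    (A := fun a => kroneckerMap (· * ·) (Matrix.single (controlVal a) (controlVal a) 1)
        (hermProd s fun i => a (.inr i))) (B := hermProd t) (hermProd_control n) (fun _ => rfl)
    (controlKraus K) (sum_conjTranspose_controlKraus_mul hK) fun b a =>
      (hM _ _ _).trans (krausForm_control K _ _ _).symm

theorem hermProd_triv (b : Bas quantumSystems.triv) : hermProd quantumSystems.triv b = 1 :=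
  Matrix.ext fun x y => (Fintype.prod_empty _).trans
    ((congrArg _ (Subsingleton.elim x y)).trans (Matrix.one_apply_eq _)).symm

/-- Trace preservation leaves the trace as the only deterministic effect. -/
theorem QT_effect_eq {V : Proc s quantumSystems.triv}
    (hV : V ∈ QT.Chan s quantumSystems.triv) (b : Bas quantumSystems.triv) (a : Bas s) :
    (V b a : ℂ) = (hermProd s a).trace := by
  obtain ⟨J, _, K, hK, hM⟩ := exists_kraus hV
  rw [hM, hermProd_triv]
  exact krausForm_one hK _

theorem QT_discard (s : ι → quantumSystems.Sys) :
    ∃! U : Proc s quantumSystems.triv, U ∈ QT.Chan s quantumSystems.triv := by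
  let K : HBas s → Matrix (HBas quantumSystems.triv) (HBas s) ℂ :=
    fun u => Matrix.of fun _ x => if x = u then 1 else 0
  have hK : ∑ j, (K j)ᴴ * K j = 1 := by
    ext x y
    simp [Matrix.sum_apply, Matrix.mul_apply, K, Matrix.one_apply]
  refine ⟨fun b a => (krausForm K (hermProd _ b) (hermProd s a)).re,
    mem_QT_of_krausForm (Equiv.refl _) (Equiv.refl _) (A := hermProd s) (B := hermProd _)
      (fun _ => rfl) (fun _ => rfl) K hK fun b a => ofReal_re_krausForm K b a, fun V hV => ?_⟩
  refine proc_ext fun b a => Complex.ofReal_injective ((QT_effect_eq hV b a).trans ?_)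
  exact (QT_effect_eq (mem_QT_of_krausForm (Equiv.refl _) (Equiv.refl _) (A := hermProd s)
    (B := hermProd _) (fun _ => rfl) (fun _ => rfl) K hK fun b a => ofReal_re_krausForm K b a)
      b a).symm

end Quantum

/-! ### Pure states and measurements -/

section Rayleigh

open Matrix

variable {α β : Type} [Fintype α] [Fintype β]

/-- The value of the sesquilinear form of `A` at `ψ`. -/
def rayleigh (A : Matrix α α ℂ) (ψ : α → ℂ) : ℂ := ∑ z, ∑ w, star (ψ z) * A z w * ψ w

theorem rayleigh_submatrix {α β : Type} [Fintype α] {_ : Fintype β} (e : β ≃ α)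
    (A : Matrix α α ℂ) (ψ : α → ℂ) :
    rayleigh (A.submatrix e e) (ψ ∘ e) = rayleigh A ψ := by
  simp only [rayleigh, Matrix.submatrix_apply, Function.comp_apply]
  rw [e.sum_comp fun z => ∑ w, star (ψ z) * A z (e w) * ψ (e w)]
  exact Finset.sum_congr rfl fun z _ => e.sum_comp fun w => star (ψ z) * A z w * ψ w

theorem star_rayleigh {A : Matrix α α ℂ} (hA : Aᴴ = A) (ψ : α → ℂ) :
    star (rayleigh A ψ) = rayleigh A ψ := by
  simp only [rayleigh, star_sum, star_mul, star_star]
  rw [Finset.sum_comm]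
  refine Finset.sum_congr rfl fun z _ => Finset.sum_congr rfl fun w _ => ?_
  rw [← Matrix.conjTranspose_apply, hA]
  ring

theorem rayleigh_kronecker (A : Matrix α α ℂ) (B : Matrix β β ℂ) (φ : α → ℂ) (χ : β → ℂ) :
    rayleigh (kroneckerMap (· * ·) A B) (fun p => φ p.1 * χ p.2) =
      rayleigh A φ * rayleigh B χ := by
  simp only [rayleigh, Fintype.sum_prod_type, Finset.sum_mul_sum, kroneckerMap_apply, star_mul]
  refine Finset.sum_congr rfl fun x _ => Finset.sum_congr rfl fun y _ =>
    Finset.sum_congr rfl fun z _ => Finset.sum_congr rfl fun w _ => by ring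

theorem krausForm_state [DecidableEq α] (B : Matrix α α ℂ) (ψ : α → ℂ) :
    krausForm (fun _ : Unit => Matrix.of fun z (_ : Unit) => ψ z) B 1 = rayleigh B ψ := by
  simp only [krausForm, Fintype.sum_unique, Matrix.trace, Matrix.diag, Matrix.mul_apply,
    Matrix.mul_one, Matrix.of_apply, Matrix.conjTranspose_apply, rayleigh]
  exact Finset.sum_congr rfl fun z _ => Finset.sum_congr rfl fun w _ => by ring

/-- Kraus operators of a measurement with rank-one effects. -/
def rankOneKraus {J X : Type} [DecidableEq X] (ℓ : J → X) (φ : J → α → ℂ) (j : J) :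
    Matrix (Unit → X) α ℂ :=
  Matrix.of fun y z => if ℓ j = y () then star (φ j z) else 0

theorem krausForm_rankOneKraus {J X : Type} [Fintype J] [Fintype X] [DecidableEq X] (ℓ : J → X)
    (φ : J → α → ℂ) (A : Matrix α α ℂ) (b : Unit → X) :
    krausForm (rankOneKraus ℓ φ) (Matrix.single b b 1) A =
      ∑ j, if ℓ j = b () then rayleigh A (φ j) else 0 := by
  refine Finset.sum_congr rfl fun j _ => (trace_single_mul_conj _ b A).trans ?_
  simp only [rankOneKraus, Matrix.of_apply, rayleigh]
  split_ifs
  · simp only [star_star]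
  · simp

theorem sum_conjTranspose_rankOneKraus_mul {α : Type} [DecidableEq α] {J X : Type} [Fintype J]
    [Fintype X] [DecidableEq X] (ℓ : J → X) {φ : J → α → ℂ}
    (hφ : ∀ z w, ∑ j, φ j z * star (φ j w) = if z = w then 1 else 0) :
    ∑ j, (rankOneKraus ℓ φ j)ᴴ * rankOneKraus ℓ φ j = 1 := by
  ext z w
  rw [Matrix.one_apply, ← hφ, Matrix.sum_apply]
  refine Finset.sum_congr rfl fun j _ => ?_
  rw [Matrix.mul_apply, Finset.sum_eq_single fun _ => ℓ j]
  · simp [rankOneKraus]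
  · intro y _ hy
    have h1 : ¬ ℓ j = y () := fun h => hy (funext fun _ => h.symm)
    simp [rankOneKraus, h1]
  · exact fun h => absurd (Finset.mem_univ _) h

/-- A unit vector, and vectors whose projectors add up to the orthogonal complement. -/
def complete [DecidableEq α] (ψ : α → ℂ) : Option α → α → ℂ
  | none => ψ
  | some u => fun z => (if z = u then 1 else 0) - ψ z * star (ψ u)

/-- With `P` the projector onto `ψ`, the other vectors are `(1 - P) e_u`, and their rank-one
operators add up to `(1 - P)² = 1 - P`. No orthonormal basis has to be constructed. -/
theorem sum_complete [DecidableEq α] {ψ : α → ℂ} (hψ : ∑ z, star (ψ z) * ψ z = 1) (z w : α) :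
    ∑ j, complete ψ j z * star (complete ψ j w) = if z = w then 1 else 0 := by
  have h1 : ∀ u, complete ψ (some u) z * star (complete ψ (some u) w) =
      (if z = u then if w = u then 1 else 0 else 0) - (if z = u then ψ u * star (ψ w) else 0) -
        (if w = u then ψ z * star (ψ u) else 0) + ψ z * star (ψ w) * (star (ψ u) * ψ u) := by
    intro u
    simp only [complete, star_sub, star_mul, star_star, apply_ite star, star_one, star_zero]
    split_ifs with h h' h' <;> (try subst h) <;> (try subst h') <;> ring
  rw [Fintype.sum_option, Finset.sum_congr rfl fun u _ => h1 u, Finset.sum_add_distrib,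
    Finset.sum_sub_distrib, Finset.sum_sub_distrib, ← Finset.mul_sum, hψ]
  simp only [Finset.sum_ite_eq, Finset.mem_univ, if_true, complete, eq_comm (a := w),
    Finset.sum_ite_eq']
  ring

/-- The Born rule in coordinates: by completeness, the scalar product of the coordinate vectors of
two pure states is their transition probability. -/
theorem sum_rayleigh_mul {γ : Type} [Fintype γ] [DecidableEq α] {E : γ → Matrix α α ℂ}
    (hE : ∀ x y z w, ∑ c, E c x y * E c z w = if x = w ∧ y = z then 1 else 0) (φ ψ : α → ℂ) :
    ∑ c, rayleigh (E c) φ * rayleigh (E c) ψ =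
      (Complex.normSq (∑ z, star (φ z) * ψ z) : ℂ) := by
  have h1 : ∀ c, rayleigh (E c) φ * rayleigh (E c) ψ = ∑ x, ∑ y, ∑ z, ∑ w,
      star (φ x) * φ y * star (ψ z) * ψ w * (E c x y * E c z w) := by
    intro c
    rw [rayleigh, Finset.sum_mul]
    refine Finset.sum_congr rfl fun x _ => ?_
    rw [Finset.sum_mul]
    refine Finset.sum_congr rfl fun y _ => ?_
    rw [rayleigh, Finset.mul_sum]
    refine Finset.sum_congr rfl fun z _ => ?_
    rw [Finset.mul_sum]
    exact Finset.sum_congr rfl fun w _ => by ring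
  have h2 : ∀ f : α → α → α → α → γ → ℂ,
      ∑ c, ∑ x, ∑ y, ∑ z, ∑ w, f x y z w c = ∑ x, ∑ y, ∑ z, ∑ w, ∑ c, f x y z w c := by
    intro f
    rw [Finset.sum_comm]
    refine Finset.sum_congr rfl fun x _ => ?_
    rw [Finset.sum_comm]
    refine Finset.sum_congr rfl fun y _ => ?_
    rw [Finset.sum_comm]
    exact Finset.sum_congr rfl fun z _ => Finset.sum_comm
  rw [Finset.sum_congr rfl fun c _ => h1 c, h2]
  simp only [← Finset.mul_sum, hE, ite_and, mul_ite, mul_one, mul_zero]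
  rw [← Complex.mul_conj, map_sum, Finset.sum_mul_sum]
  refine Finset.sum_congr rfl fun x _ => Finset.sum_congr rfl fun y _ => ?_
  rw [Finset.sum_eq_single y]
  · simp only [if_true, Finset.sum_ite_eq, Finset.mem_univ, map_mul, starRingEnd_apply, star_star]
    ring
  · intro z _ hz
    simp [hz.symm]
  · exact fun h => absurd (Finset.mem_univ _) h

end Rayleigh

/-! ### Coordinates of pure states and rank-one measurements. -/

section Expect

open Matrix

variable {ι κ : Type} [Fintype ι] [Fintype κ] {s : ι → quantumSystems.Sys}
  {t : κ → quantumSystems.Sys}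

/-- The coordinates of the pure state with the vector `ψ`. -/
def expect (s : ι → quantumSystems.Sys) (ψ : HBas s → ℂ) (b : Bas s) : ℝ :=
  (rayleigh (hermProd s b) ψ).re

theorem ofReal_expect (ψ : HBas s → ℂ) (b : Bas s) :
    (expect s ψ b : ℂ) = rayleigh (hermProd s b) ψ :=
  Complex.conj_eq_iff_re.1 (star_rayleigh (conjTranspose_hermProd b) ψ)

theorem pureState_mem {ψ : HBas s → ℂ} (hψ : ∑ z, star (ψ z) * ψ z = 1) :
    (fun b _ => expect s ψ b : Proc quantumSystems.triv s) ∈ QT.Chan quantumSystems.triv s := by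
  refine mem_QT_of_krausForm (s := quantumSystems.triv) (α := Unit) (J := Unit)
    (Equiv.ofUnique _ _) (Equiv.refl _) (A := fun _ => 1) (B := hermProd s)
    (fun a => (hermProd_triv a).trans (submatrix_one_equiv _).symm) (fun _ => rfl)
    (fun _ => Matrix.of fun z _ => ψ z) ?_ fun b a =>
      (ofReal_expect ψ b).trans (krausForm_state _ _).symm
  ext x y
  simpa [Matrix.mul_apply] using hψ

/-- The value of a classical system. -/
def outcome {S : Systems.{u}} {n : ℕ} (b : Bas (one (.cl n : S.Sys))) : Fin (n + 1) := b ()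

/-- The measurement whose effects are sums of the rank-one operators with the vectors `φ j`. -/
def rankOneMeasurement {J : Type} [Fintype J] {n : ℕ} (ℓ : J → Fin (n + 1)) (φ : J → HBas s → ℂ) :
    Proc s (one (.cl n)) :=
  fun b a => ∑ j, if ℓ j = outcome b then expect s (φ j) a else 0

theorem rankOneMeasurement_mem {J : Type} [Fintype J] {n : ℕ} (ℓ : J → Fin (n + 1))
    {φ : J → HBas s → ℂ} (hφ : ∀ z w, ∑ j, φ j z * star (φ j w) = if z = w then 1 else 0) :
    rankOneMeasurement ℓ φ ∈ QT.Chan s (one (.cl n)) := by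
  refine mem_QT_of_krausForm (t := one (.cl n)) (β := Unit → Fin (n + 1)) (Equiv.refl _)
    (Equiv.refl _) (A := hermProd s)
    (B := fun b => Matrix.single (b : Unit → Fin (n + 1)) b 1) (fun _ => rfl)
    (hermProd_cl fun _ => n) (rankOneKraus ℓ φ) (sum_conjTranspose_rankOneKraus_mul ℓ hφ)
    fun b a => ?_
  refine Eq.trans ?_ (krausForm_rankOneKraus ℓ φ (hermProd s a) b).symm
  simp only [rankOneMeasurement, Complex.ofReal_sum, apply_ite Complex.ofReal, ofReal_expect,
    Complex.ofReal_zero]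
  rfl

/-- The test for `ψ`: outcome 0 belongs to `ψ`, and all other vectors of `complete ψ` are lumped
into outcome 1. -/
theorem exists_measurement {ψ : HBas s → ℂ} (hψ : ∑ z, star (ψ z) * ψ z = 1) :
    ∃ M ∈ QT.Chan s (one (.cl 1)), ∀ a, M (fun _ => (0 : Fin 2)) a = expect s ψ a := by
  let ℓ : Option (HBas s) → Fin (1 + 1) := fun j => j.elim 0 fun _ => 1
  refine ⟨_, rankOneMeasurement_mem ℓ (sum_complete hψ), fun a => ?_⟩
  refine (Fintype.sum_option _).trans ?_
  refine (congrArg₂ (· + ·) (if_pos rfl) (Finset.sum_eq_zero fun u _ => if_neg ?_)).trans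
    (add_zero _)
  exact fun h : (1 : Fin 2) = 0 => absurd h (by decide)

theorem diagCoeff_eq_one {a : quantumSystems.Sys} (h : ∃ q, a = .gpt q)
    (x y : Fin (hdim a + 1)) : diagCoeff a x y = 1 := by
  obtain ⟨q, rfl⟩ := h
  rfl

theorem sum_hermProd_mul_of_gpt (hs : ∀ i, ∃ q, s i = .gpt q) (x y z w : HBas s) :
    ∑ c, hermProd s c x y * hermProd s c z w = if x = w ∧ y = z then 1 else 0 := by
  rw [sum_hermProd_mul]
  exact if_congr Iff.rfl (Finset.prod_eq_one fun i _ => diagCoeff_eq_one (hs i) _ _) rfl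

theorem sum_expect_mul_expect (hs : ∀ i, ∃ q, s i = .gpt q) (φ ψ : HBas s → ℂ) :
    ∑ c, expect s φ c * expect s ψ c = Complex.normSq (∑ z, star (φ z) * ψ z) := by
  refine Complex.ofReal_injective (Eq.trans ?_
    (sum_rayleigh_mul (sum_hermProd_mul_of_gpt hs) φ ψ))
  simp only [Complex.ofReal_sum, Complex.ofReal_mul, ofReal_expect]

/-- A vector of a composite system. -/
def uncurryHBas {ι κ : Type} {s : ι → quantumSystems.Sys} {t : κ → quantumSystems.Sys}
    (Ψ : HBas s × HBas t → ℂ) : HBas (Sum.elim s t) → ℂ :=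
  Ψ ∘ Equiv.sumPiEquivProdPi fun i => Fin (hdim (Sum.elim s t i) + 1)

theorem sum_uncurryHBas {ι κ : Type} [Fintype ι] [Fintype κ] {s : ι → quantumSystems.Sys}
    {t : κ → quantumSystems.Sys} {_ : Fintype (HBas (Sum.elim s t))} (f : HBas s × HBas t → ℂ) :
    ∑ z : HBas (Sum.elim s t), uncurryHBas f z = ∑ x, ∑ y, f (x, y) := by
  rw [← Fintype.sum_prod_type']
  exact Fintype.sum_equiv (κ := HBas s × HBas t)
    (Equiv.sumPiEquivProdPi fun i => Fin (hdim (Sum.elim s t i) + 1)) _ _ fun _ => rfl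

theorem expect_uncurry (Ψ : HBas s × HBas t → ℂ) (a : Bas s) (b : Bas t) :
    expect (Sum.elim s t) (uncurryHBas Ψ) (joinBas a b) =
      (rayleigh (kroneckerMap (· * ·) (hermProd s a) (hermProd t b)) Ψ).re := by
  rw [expect, hermProd_elim]
  exact congrArg Complex.re (rayleigh_submatrix (α := HBas s × HBas t) _ _ _)

theorem expect_mul_expect (φ : HBas s → ℂ) (χ : HBas t → ℂ) (a : Bas s) (b : Bas t) :
    expect s φ a * expect t χ b =
      expect (Sum.elim s t) (uncurryHBas fun p => φ p.1 * χ p.2) (joinBas a b) := by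
  rw [expect_uncurry, rayleigh_kronecker, ← ofReal_expect, ← ofReal_expect, ← Complex.ofReal_mul,
    Complex.ofReal_re]

end Expect

/-! ### Quantum theory is a generalized probabilistic theory -/

section SingleSystem

variable {ι : Type} [Unique ι] {q : ℕ}

/-- A vector of a single quantum system. -/
def ket (ι : Type) [Unique ι] (q : ℕ) (ψ : Fin (q + 1) → ℂ) :
    HBas (fun _ : ι => (.gpt q : quantumSystems.Sys)) → ℂ :=
  fun z => ψ (z default)

theorem sum_apply_default {ι α : Type} [Unique ι] [Fintype α] {_ : Fintype (ι → α)}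
    (ψ : α → ℂ) : ∑ z : ι → α, ψ (z default) = ∑ x, ψ x :=
  Fintype.sum_equiv (Equiv.funUnique ι α) _ _ fun _ => rfl

theorem sum_ket {i : Fintype (HBas (fun _ : ι => (.gpt q : quantumSystems.Sys)))}
    (ψ : Fin (q + 1) → ℂ) : ∑ z, ket ι q ψ z = ∑ x, ψ x :=
  @sum_apply_default ι (Fin (q + 1)) _ _ i ψ

theorem forall_ket_iff {p : Fin (q + 1) → Fin (q + 1) → ℂ}
    (hp : ∀ x y, p x y = if x = y then 1 else 0)
    (z w : HBas (fun _ : ι => (.gpt q : quantumSystems.Sys))) :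
    p (z default) (w default) = if z = w then 1 else 0 := by
  by_cases h : z = w
  · exact (hp _ _).trans ((if_pos (congrFun h _)).trans (if_pos h).symm)
  · refine (hp _ _).trans ((if_neg fun h' => h (funext fun i => ?_)).trans (if_neg h).symm)
    obtain rfl := Unique.eq_default i
    exact h'

/-- The coordinates of a pure state. -/
def pairVec {n : ℕ} (ψ : Fin n → ℂ) (c : Fin n × Fin n) : ℝ :=
  (star (ψ c.1) * ψ c.2).re - (star (ψ c.1) * ψ c.2).im

theorem re_rayleigh_pairHerm {n : ℕ} (ψ : Fin n → ℂ) (c : Fin n × Fin n) :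
    (rayleigh (pairHerm c) ψ).re = pairVec ψ c := by
  have h1 : rayleigh (pairHerm c) ψ = (1 + Complex.I) / 2 * (star (ψ c.1) * ψ c.2) +
      (1 - Complex.I) / 2 * (star (ψ c.2) * ψ c.1) := by
    simp only [rayleigh, pairHerm, mul_add, add_mul, Finset.sum_add_distrib]
    refine congrArg₂ (· + ·) ?_ ?_
    · rw [Finset.sum_eq_single c.1, Finset.sum_eq_single c.2]
      · simp only [and_self, if_true]
        ring
      · intro w _ hw
        simp [hw.symm]
      · exact fun h => absurd (Finset.mem_univ _) h
      · intro w _ hw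
        simp [hw.symm]
      · exact fun h => absurd (Finset.mem_univ _) h
    · rw [Finset.sum_eq_single c.2, Finset.sum_eq_single c.1]
      · simp only [and_self, if_true]
        ring
      · intro w _ hw
        simp [hw.symm]
      · exact fun h => absurd (Finset.mem_univ _) h
      · intro w _ hw
        simp [hw.symm]
      · exact fun h => absurd (Finset.mem_univ _) h
  rw [h1, pairVec]
  simp only [Complex.star_def, Complex.add_re, Complex.mul_re, Complex.mul_im, Complex.conj_re,
    Complex.conj_im, Complex.div_ofNat_re, Complex.div_ofNat_im, Complex.add_im, Complex.sub_re,
    Complex.sub_im, Complex.one_re, Complex.one_im, Complex.I_re, Complex.I_im]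
  ring

theorem expect_ket [Fintype ι] (ψ : Fin (q + 1) → ℂ) (c : Fin (q + 1) × Fin (q + 1)) :
    expect (fun _ : ι => .gpt q) (ket ι q ψ) (fun _ => c) = pairVec ψ c := by
  rw [← re_rayleigh_pairHerm]
  have h1 : hermProd (fun _ : ι => (.gpt q : quantumSystems.Sys)) (fun _ => c) =
      Matrix.submatrix (pairHerm c) (Equiv.funUnique ι (Fin (q + 1)))
        (Equiv.funUnique ι (Fin (q + 1))) :=
    Matrix.ext fun x y => (Fintype.prod_unique _).trans (herm_gpt q c _ _)
  exact congrArg Complex.re ((congrArg (rayleigh · _) h1).trans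
    (rayleigh_submatrix (Equiv.funUnique ι (Fin (q + 1))) (pairHerm c) ψ))

theorem sum_star_ket {_ : Fintype (HBas (fun _ : ι => (.gpt q : quantumSystems.Sys)))}
    (φ ψ : Fin (q + 1) → ℂ) :
    ∑ z, star (ket ι q φ z) * ket ι q ψ z = ∑ x, star (φ x) * ψ x :=
  sum_ket fun x => star (φ x) * ψ x

/-- Polarization: basis vectors and superpositions of two of them yield all coordinate vectors. This
settles both spanning axioms, since pure states and rank-one effects have the same coordinates. -/
theorem span_pairVec (n : ℕ) :
    Submodule.span ℝ {v | ∃ ψ : Fin n → ℂ, ∑ x, star (ψ x) * ψ x = 1 ∧ v = pairVec ψ} = ⊤ := by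
  set S := Submodule.span ℝ {v | ∃ ψ : Fin n → ℂ, ∑ x, star (ψ x) * ψ x = 1 ∧ v = pairVec ψ}
    with hS
  have h1 : ∀ x, Pi.single (x, x) 1 ∈ S := by
    intro x
    refine Submodule.subset_span ⟨Pi.single x 1, ?_, ?_⟩
    · rw [Finset.sum_eq_single x]
      · simp
      · intro y _ hy
        simp [hy]
      · exact fun h => absurd (Finset.mem_univ _) h
    · funext ⟨a, b⟩
      by_cases ha : a = x <;> by_cases hb : b = x <;> simp [pairVec, ha, hb]
  -- A number of modulus `1/√2` with rational parts, which normalizes the superpositions without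
  -- square roots.
  let c : ℂ := (1 + Complex.I) / 2
  have hc : star c * c = 1 / 2 := by
    simp only [c, Complex.star_def, map_div₀, map_add, map_one, Complex.conj_I, map_ofNat]
    linear_combination -(1 / 4) * Complex.I_mul_I
  have h2 : ∀ x y, x ≠ y → ∀ u : ℂ, star u * u = 1 →
      pairVec (fun z => c * ((if z = x then 1 else 0) + if z = y then u else 0)) ∈ S := by
    intro x y hxy u hu
    refine Submodule.subset_span ⟨_, ?_, rfl⟩
    have h3 : ∀ z, star (c * ((if z = x then 1 else 0) + if z = y then u else 0)) *
        (c * ((if z = x then 1 else 0) + if z = y then u else 0)) =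
        (if z = x then 1 / 2 else 0) + if z = y then 1 / 2 else 0 := by
      intro z
      rw [star_mul', mul_mul_mul_comm, hc]
      by_cases hx : z = x
      · subst hx
        simp [hxy]
      · by_cases hy : z = y
        · simp [hy, show ¬ y = x from hxy.symm]
          exact hu
        · simp [hx, hy]
    rw [Finset.sum_congr rfl fun z _ => h3 z, Finset.sum_add_distrib]
    simp only [Finset.sum_ite_eq', Finset.mem_univ, if_true]
    norm_num
  have h4 : ∀ p : Fin n × Fin n, Pi.single p 1 ∈ S := by
    rintro ⟨x, y⟩
    by_cases hxy : x = y
    · subst hxy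
      exact h1 x
    -- For the phases `1` and `-i`, the coordinate at `(x, y)` is 1/2 both times, and that at `(y,
    -- x)` is 1/2 and -1/2. The diagonal parts of the sum are removed by the basis states.
    · have h5 := S.sub_mem (S.sub_mem (S.add_mem (h2 x y hxy 1 (by simp))
        (h2 x y hxy (-Complex.I) (by simp))) (h1 x)) (h1 y)
      convert h5 using 1
      have h6 : ∀ v w : ℂ, star (c * v) * (c * w) = 1 / 2 * (star v * w) := by
        intro v w
        rw [star_mul', mul_mul_mul_comm, hc]
      funext ⟨a, b⟩
      simp only [pairVec, Pi.add_apply, Pi.sub_apply, Pi.single_apply, Prod.mk.injEq, h6]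
      by_cases ha : a = x
      · subst ha
        by_cases hb : b = a
        · subst hb
          simp [hxy]
          norm_num
        · by_cases hb' : b = y
          · subst hb'
            simp [hxy, hb]
            norm_num
          · simp [hxy, hb, hb']
      · by_cases ha' : a = y
        · subst ha'
          by_cases hb : b = x
          · subst hb
            simp [ha, hxy]
          · by_cases hb' : b = a
            · subst hb'
              simp [ha]
              norm_num
            · simp [ha, hb, hb']
        · simp [ha, ha']
  rw [eq_top_iff, ← (Pi.basisFun ℝ (Fin n × Fin n)).span_eq]
  refine Submodule.span_le.2 ?_
  rintro _ ⟨p, rfl⟩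
  rw [Pi.basisFun_apply]
  exact h4 p

end SingleSystem

theorem isGPT_QT : IsGPT QT where
  relabel e s := QT_relabel e s
  comp s t r M hM N hN := QT_comp hM hN
  par s t s' t' M hM N hN := QT_par hM hN
  classical n m := QT_classical n m
  control s t n E hE := QT_control hE
  discard s := QT_discard s
  states_span q := by
    refine top_le_iff.1 ((span_pairVec (Nat.succ q)).symm.le.trans (Submodule.span_mono ?_))
    rintro v ⟨ψ, hψ, rfl⟩
    exact ⟨_, pureState_mem (ψ := ket Unit q ψ) ((sum_star_ket ψ ψ).trans hψ),
      fun j => (expect_ket ψ j).symm⟩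
  effects_span q := by
    refine top_le_iff.1 ((span_pairVec (Nat.succ q)).symm.le.trans (Submodule.span_mono ?_))
    rintro v ⟨ψ, hψ, rfl⟩
    obtain ⟨M, hM, h⟩ := exists_measurement (ψ := ket Unit q ψ) ((sum_star_ket ψ ψ).trans hψ)
    exact ⟨1, (0 : Fin 2), M, hM, fun j => ((h fun _ => j).trans (expect_ket ψ j)).symm⟩

/-! ### Time reversal -/

section TimeReversal

open Matrix

/-- The matrix of a map between the elements of a basis. -/
def mapMatrix {α : Type} (f : α → α) : Matrix α α ℝ := fun b a => if b = f a then 1 else 0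

theorem mapMatrix_id {α : Type} {_ : DecidableEq α} {f : α → α} (hf : ∀ a, f a = a) :
    mapMatrix f = 1 := by
  refine Matrix.ext fun b a => ?_
  rw [mapMatrix, hf, Matrix.one_apply]
  congr

theorem mapMatrix_mul {α : Type} [Fintype α] {f g h : α → α} (hf : ∀ a, f (g a) = h a) :
    mapMatrix f * mapMatrix g = mapMatrix h := by
  ext b a
  rw [Matrix.mul_apply, Finset.sum_eq_single (g a)]
  · simp only [mapMatrix, hf, if_true, mul_one]
  · intro c _ hc
    simp only [mapMatrix, if_neg hc, mul_zero]
  · exact fun h => absurd (Finset.mem_univ _) h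

/-- The action of time reversal on the elements of the basis. -/
def reversal {n : ℕ} (g : Multiplicative (ZMod 2)) (c : Fin n × Fin n) : Fin n × Fin n :=
  if g = 1 then c else (c.2, c.1)

theorem reversal_one {n : ℕ} (c : Fin n × Fin n) : reversal 1 c = c := if_pos rfl

theorem reversal_reversal {n : ℕ} (g h : Multiplicative (ZMod 2)) (c : Fin n × Fin n) :
    reversal g (reversal h c) = reversal (g * h) c := by
  have h1 : ∀ g h : Multiplicative (ZMod 2), g ≠ 1 → h ≠ 1 → g * h = 1 := by decide
  by_cases hg : g = 1
  · simp [reversal, hg]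
  · by_cases hh : h = 1
    · simp [reversal, hh]
    · simp [reversal, hg, hh, h1 g h hg hh]

theorem timeReversal_eq (g : Multiplicative (ZMod 2)) (q : ℕ) :
    timeReversal g q = mapMatrix (reversal (n := q + 1) g) := rfl

theorem timeReversal_one (q : QT.Q) : timeReversal 1 q = 1 :=
  (timeReversal_eq 1 q).trans (mapMatrix_id reversal_one)

/-- Transposition of the basis of Hermitian operators. -/
def swapIx : ∀ a : quantumSystems.Sys, a.Ix → a.Ix
  | .cl _, x => x
  | .gpt _, x => (x.2, x.1)

/-- Transposition of the product basis of Hermitian operators. -/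
def swapBas {ι : Type} {s : ι → quantumSystems.Sys} (b : Bas s) : Bas s :=
  fun i => swapIx (s i) (b i)

theorem swapIx_swapIx : ∀ (a : quantumSystems.Sys) (x : a.Ix), swapIx a (swapIx a x) = x
  | .cl _, _ => rfl
  | .gpt _, _ => rfl

theorem swapBas_swapBas {ι : Type} {s : ι → quantumSystems.Sys} (b : Bas s) :
    swapBas (swapBas b) = b := funext fun i => swapIx_swapIx (s i) (b i)

theorem diagHerm_comm {n : ℕ} (c x y : Fin n) : diagHerm c x y = diagHerm c y x := by
  simp only [diagHerm, and_comm]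

theorem herm_swapIx : ∀ (a : quantumSystems.Sys) (c : a.Ix) (x y : Fin (hdim a + 1)),
    herm a (swapIx a c) x y = herm a c y x
  | .cl n, c, x, y => (herm_cl n c x y).trans
      ((diagHerm_comm (n := n + 1) c x y).trans (herm_cl n c y x).symm)
  | .gpt q, c, x, y => (herm_gpt q (c.2, c.1) x y).trans
      ((pairHerm_swap _ _ _).trans (herm_gpt q c y x).symm)

variable {ι κ : Type} [Fintype ι] [Fintype κ] {s : ι → quantumSystems.Sys}
  {t : κ → quantumSystems.Sys}

theorem hermProd_swapBas (c : Bas s) (x y : HBas s) :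
    hermProd s (swapBas c) x y = hermProd s c y x :=
  Finset.prod_congr rfl fun _ _ => herm_swapIx _ _ _ _

theorem hermProd_swapBas_eq_map (c : Bas s) :
    hermProd s (swapBas c) = (hermProd s c).map star :=
  Matrix.ext fun x y => (hermProd_swapBas c x y).trans (star_hermProd c x y).symm

theorem krausForm_map_star {α β J : Type} [Fintype α] [Fintype β] [Fintype J]
    (K : J → Matrix β α ℂ) (B : Matrix β β ℂ) (A : Matrix α α ℂ) :
    krausForm (fun j => (K j).map star) (B.map star) (A.map star) = star (krausForm K B A) := by
  simp only [krausForm, star_sum, Matrix.trace, Matrix.diag, Matrix.mul_apply, Matrix.map_apply,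
    star_mul', Matrix.conjTranspose_apply]

theorem sum_conjTranspose_map_star_mul {α β J : Type} [Fintype β] [Fintype J] [DecidableEq α]
    {K : J → Matrix β α ℂ} (hK : ∑ j, (K j)ᴴ * K j = 1) :
    ∑ j, ((K j).map star)ᴴ * (K j).map star = 1 := by
  ext x y
  have h1 := congrArg star (congrFun (congrFun hK x) y)
  simp only [Matrix.sum_apply, Matrix.mul_apply, Matrix.conjTranspose_apply, star_sum, star_mul',
    Matrix.one_apply, apply_ite star, star_one, star_zero] at h1
  simpa only [Matrix.sum_apply, Matrix.mul_apply, Matrix.conjTranspose_apply, Matrix.map_apply,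
    Matrix.one_apply] using h1

theorem sysAct_timeReversal {g : Multiplicative (ZMod 2)} (hg : g ≠ 1) :
    ∀ (a : quantumSystems.Sys) (b c : a.Ix),
      sysAct (S := QT.toSystems) timeReversal g a b c = if b = swapIx a c then 1 else 0
  | .cl n, b, c => (Matrix.one_apply (n := Fin (n + 1))).trans (by congr)
  | .gpt q, b, c => by
    refine (congrFun (congrFun (timeReversal_eq g q) b) c).trans ?_
    exact if_congr (Eq.congr_right (if_neg hg)) rfl rfl

theorem act_timeReversal_one (s : ι → QT.Sys) :
    act (S := QT.toSystems) timeReversal (1 : Multiplicative (ZMod 2)) s = idProc s := by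
  refine act_of_sysAct_one (S := QT.toSystems) _ fun i => ?_
  cases s i with
  | cl n => exact sysAct_cl (S := QT.toSystems) _ ⟨n, rfl⟩
  | gpt q => exact (timeReversal_one q).trans (by congr!)

theorem act_timeReversal {g : Multiplicative (ZMod 2)} (hg : g ≠ 1) (b c : Bas s) :
    act (S := QT.toSystems) timeReversal g s b c = if b = swapBas c then 1 else 0 := by
  refine (Finset.prod_congr rfl fun i _ => sysAct_timeReversal hg (s i) (b i) (c i)).trans ?_
  by_cases h : b = swapBas c
  · subst h
    rw [if_pos rfl]
    exact Finset.prod_eq_one fun i _ => if_pos rfl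
  · rw [if_neg h]
    obtain ⟨i, hi⟩ := Function.ne_iff.1 h
    exact Finset.prod_eq_zero (Finset.mem_univ i) (if_neg hi)

theorem act_timeReversal_comp {ι κ : Type} [Fintype κ] {s : ι → quantumSystems.Sys}
    {t : κ → quantumSystems.Sys} {g : Multiplicative (ZMod 2)} (hg : g ≠ 1) (M : Proc s t)
    (b : Bas t) (a : Bas s) :
    Proc.comp (act (S := QT.toSystems) timeReversal g t) M b a = M (swapBas b) a := by
  refine (comp_apply (S := quantumSystems) _ _ _ _).trans ?_
  rw [Finset.sum_eq_single (swapBas b)]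
  · rw [act_timeReversal hg, swapBas_swapBas, if_pos rfl, one_mul]
  · intro c _ hc
    rw [act_timeReversal hg, if_neg, zero_mul]
    rintro rfl
    exact hc (swapBas_swapBas c).symm
  · exact fun h => absurd (Finset.mem_univ _) h

theorem comp_act_timeReversal {ι κ : Type} [Fintype ι] {s : ι → quantumSystems.Sys}
    {t : κ → quantumSystems.Sys} {g : Multiplicative (ZMod 2)} (hg : g ≠ 1) (M : Proc s t)
    (b : Bas t) (a : Bas s) :
    Proc.comp M (act (S := QT.toSystems) timeReversal g s) b a = M b (swapBas a) := by
  refine (comp_apply (S := quantumSystems) _ _ _ _).trans ?_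
  rw [Finset.sum_eq_single (swapBas a)]
  · rw [act_timeReversal hg, if_pos rfl, mul_one]
  · intro c _ hc
    rw [act_timeReversal hg, if_neg hc, mul_zero]
  · exact fun h => absurd (Finset.mem_univ _) h

/-- Transposing the basis is entrywise complex conjugation, so the complex conjugates of the Kraus
operators represent the conjugated channel. -/
theorem swap_mem_QT {M : Proc s t} (hM : M ∈ QT.Chan s t) :
    (fun b a => M (swapBas b) (swapBas a) : Proc s t) ∈ QT.Chan s t := by
  obtain ⟨J, _, K, hK, hM⟩ := exists_kraus hM
  refine mem_QT_of_krausForm (Equiv.refl _) (Equiv.refl _) (A := hermProd s) (B := hermProd t)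
    (fun _ => rfl) (fun _ => rfl) _ (sum_conjTranspose_map_star_mul hK) fun b a => ?_
  refine (hM _ _).trans ?_
  rw [hermProd_swapBas_eq_map, hermProd_swapBas_eq_map]
  refine Eq.trans ?_ (star_krausForm _ (conjTranspose_hermProd b) (conjTranspose_hermProd a))
  refine Eq.trans ?_ (krausForm_map_star _ _ _)
  refine congrArg (krausForm · _ _) (funext fun j => Matrix.ext fun x y => ?_)
  exact (star_star _).symm

theorem isSymmetry_timeReversal : IsSymmetry QT timeReversal where
  map_one := timeReversal_one
  map_mul g h q := (mapMatrix_mul (reversal_reversal g h)).symm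
  conj g {ι κ} _ _ s t M hM := by
    by_cases hg : g = 1
    · subst hg
      have h1 : Proc.comp (act (S := QT.toSystems) timeReversal (1 : Multiplicative (ZMod 2)) t)
          (Proc.comp M (act (S := QT.toSystems) timeReversal (1 : Multiplicative (ZMod 2))⁻¹ s)) =
          M := by
        rw [inv_one, act_timeReversal_one, act_timeReversal_one]
        exact (id_comp (S := quantumSystems) _).trans (comp_id (S := quantumSystems) M)
      exact QT.mem_of_eq hM fun b a => congrFun (congrFun h1 b) a
    · refine QT.mem_of_eq (swap_mem_QT hM) fun b a => ?_
      exact (act_timeReversal_comp hg _ _ _).trans (comp_act_timeReversal (inv_ne_one.2 hg) _ _ _)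

end TimeReversal

/-! ### Time reversal of one half of an entangled pair. -/

section Entangled

open Matrix

variable {ι : Type} [Fintype ι] {s : ι → quantumSystems.Sys}

theorem rayleigh_kronecker_diagonal {α : Type} [Fintype α] [DecidableEq α]
    (A B : Matrix α α ℂ) (c : ℂ) :
    rayleigh (kroneckerMap (· * ·) A B) (fun p => if p.1 = p.2 then c else 0) =
      star c * c * ∑ z, ∑ w, A z w * B z w := by
  simp only [rayleigh, Fintype.sum_prod_type, kroneckerMap_apply, apply_ite star, star_zero,
    ite_mul, zero_mul, mul_ite, mul_zero, Finset.mul_sum]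
  refine Finset.sum_congr rfl fun z _ => ?_
  rw [Finset.sum_eq_single z]
  · refine Finset.sum_congr rfl fun w _ => ?_
    rw [Finset.sum_eq_single w]
    · rw [if_pos rfl, if_pos rfl]
      ring
    · intro w' _ hw
      rw [if_neg hw.symm]
    · exact fun h => absurd (Finset.mem_univ _) h
  · intro z' _ hz
    refine Finset.sum_eq_zero fun w _ => Finset.sum_eq_zero fun w' _ => ?_
    rw [if_neg hz.symm, ite_self]
  · exact fun h => absurd (Finset.mem_univ _) h

/-- The vector `c * ∑ x, |x x⟩`. -/
def diagonalVec (s : ι → quantumSystems.Sys) (c : ℂ) : HBas (Sum.elim s s) → ℂ :=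
  uncurryHBas fun p => if p.1 = p.2 then c else 0

theorem sum_star_diagonalVec {_ : Fintype (HBas (Sum.elim s s))} (c : ℂ) :
    ∑ z, star (diagonalVec s c z) * diagonalVec s c z = Fintype.card (HBas s) * (star c * c) := by
  refine (sum_uncurryHBas fun p => star (if p.1 = p.2 then c else 0) *
    if p.1 = p.2 then c else 0).trans ?_
  have h1 : ∀ x y : HBas s, (star (if x = y then c else 0) * if x = y then c else 0) =
      if x = y then star c * c else 0 := by
    intro x y
    split_ifs
    · rfl
    · exact mul_zero _
  simp only [h1, Finset.sum_ite_eq, Finset.mem_univ, if_true, Finset.sum_const, nsmul_eq_mul,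
    Finset.card_univ]

/-- In coordinates the vector `∑ x, |x x⟩` is the transposition; reversal of one side turns it into
a multiple of the identity. -/
theorem expect_diagonalVec (c : ℂ) (a b : Bas s) :
    expect (Sum.elim s s) (diagonalVec s c) (joinBas a b) =
      Complex.normSq c * if a = swapBas b then 1 else 0 := by
  refine (expect_uncurry _ a b).trans ?_
  rw [rayleigh_kronecker_diagonal]
  have h1 : ∑ z, ∑ w, hermProd s a z w * hermProd s b z w =
      (hermProd s a * hermProd s (swapBas b)).trace :=
    Finset.sum_congr rfl fun z _ => Finset.sum_congr rfl fun w _ =>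
      congrArg (_ * ·) (hermProd_swapBas b w z).symm
  rw [h1, trace_hermProd_mul, mul_comm (star c), Complex.star_def, Complex.mul_conj]
  split_ifs
  · rw [mul_one, mul_one, Complex.ofReal_re]
  · simp

/-- By completeness the operators `E ⊗ E` add up to the swap, whose eigenvalue on antisymmetric
vectors is -1. -/
theorem sum_expect_antisymmetric (hs : ∀ i, ∃ q, s i = .gpt q) {f : HBas s × HBas s → ℂ}
    (hf : ∀ x y, f (y, x) = -f (x, y)) (h1 : ∑ x, ∑ y, star (f (x, y)) * f (x, y) = 1) :
    ∑ a, expect (Sum.elim s s) (uncurryHBas f) (joinBas a a) = -1 := by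
  have h2 : ∑ a, rayleigh (kroneckerMap (· * ·) (hermProd s a) (hermProd s a)) f = -1 := by
    have h3 : ∀ x y, ∑ z, ∑ w, star (f (x, y)) *
        (∑ a, hermProd s a x z * hermProd s a y w) * f (z, w) =
        -(star (f (x, y)) * f (x, y)) := by
      intro x y
      simp only [sum_hermProd_mul_of_gpt hs]
      rw [Finset.sum_eq_single y, Finset.sum_eq_single x]
      · rw [if_pos ⟨rfl, rfl⟩, mul_one, hf x y, mul_neg]
      · intro w _ hw
        rw [if_neg fun h => hw h.1.symm, mul_zero, zero_mul]
      · exact fun h => absurd (Finset.mem_univ _) h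
      · intro z _ hz
        refine Finset.sum_eq_zero fun w _ => ?_
        rw [if_neg fun h => hz h.2, mul_zero, zero_mul]
      · exact fun h => absurd (Finset.mem_univ _) h
    rw [← h1]
    simp only [← Finset.sum_neg_distrib, ← h3, rayleigh, Fintype.sum_prod_type, kroneckerMap_apply,
      Finset.mul_sum, Finset.sum_mul]
    rw [Finset.sum_comm]
    refine Finset.sum_congr rfl fun x _ => ?_
    rw [Finset.sum_comm]
    refine Finset.sum_congr rfl fun y _ => ?_
    rw [Finset.sum_comm]
    refine Finset.sum_congr rfl fun z _ => ?_
    exact Finset.sum_comm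
  refine (Finset.sum_congr rfl fun a _ => expect_uncurry f a a).trans ?_
  rw [← Complex.re_sum, h2]
  rfl

theorem expect_swapBas (ψ : HBas s → ℂ) (a : Bas s) :
    expect s ψ (swapBas a) = expect s (fun z => star (ψ z)) a := by
  refine congrArg Complex.re ?_
  simp only [rayleigh, hermProd_swapBas, star_star]
  rw [Finset.sum_comm]
  exact Finset.sum_congr rfl fun z _ => Finset.sum_congr rfl fun w _ => by ring

theorem comp_rankOneMeasurement (hs : ∀ i, ∃ q, s i = .gpt q) {J : Type} [Fintype J] {n : ℕ}
    (ℓ : J → Fin (n + 1)) (φ : J → HBas s → ℂ) (ψ : HBas s → ℂ) (b : Bas (one (.cl n)))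
    (a : Bas quantumSystems.triv) :
    Proc.comp (rankOneMeasurement ℓ φ) (fun c _ => expect s ψ c) b a =
      ∑ j, if ℓ j = outcome b then Complex.normSq (∑ z, star (φ j z) * ψ z) else 0 := by
  refine (comp_apply _ _ _ _).trans ?_
  simp only [rankOneMeasurement, Finset.sum_mul, ite_mul, zero_mul]
  rw [Finset.sum_comm]
  refine Finset.sum_congr rfl fun j _ => ?_
  rw [← sum_expect_mul_expect hs]
  split_ifs
  · rfl
  · exact Finset.sum_const_zero

theorem comp_par_id_apply {S : Systems.{u}} {ι κ μ : Type} [Fintype ι] [Fintype κ] {s : ι → S.Sys}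
    {t : κ → S.Sys} {r : μ → S.Sys} (N : Proc s s) (M : Proc r (Sum.elim t s)) (a : Bas t)
    (b : Bas s) (c : Bas r) : Proc.comp (Proc.par (idProc t) N) M (joinBas a b) c =
      Proc.comp N (fun b c => M (joinBas a b) c) b c := by
  refine (comp_apply _ _ _ _).trans ((sum_joinBas _).trans
    (Eq.trans ?_ (comp_apply _ _ _ _).symm))
  rw [Finset.sum_eq_single a]
  · refine Finset.sum_congr rfl fun b' _ => ?_
    rw [par_joinBas, idProc, if_pos rfl, one_mul]
  · intro a' _ ha
    refine Finset.sum_eq_zero fun b' _ => ?_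
    rw [par_joinBas, idProc, if_neg ha.symm, zero_mul, zero_mul]
  · exact fun h => absurd (Finset.mem_univ _) h

theorem comp_apply_joinBas {S : Systems.{u}} {ι κ μ ν : Type} [Fintype ι] [Fintype κ]
    {s : ι → S.Sys} {t : κ → S.Sys} {r : μ → S.Sys} {q : ν → S.Sys} [Fintype (Bas s)]
    [Fintype (Bas t)] (N : Proc (Sum.elim s t) q) (M : Proc r (Sum.elim s t)) (b : Bas q)
    (c : Bas r) : Proc.comp N M b c = ∑ x, ∑ y, N b (joinBas x y) * M (joinBas x y) c :=
  (comp_apply _ _ _ _).trans (sum_joinBas _)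

theorem sum_mul_ite_eq {α : Type} [Fintype α] [DecidableEq α] (e : α → α → ℝ) (k : ℝ) :
    ∑ a, ∑ b, e a b * (k * if a = b then 1 else 0) = k * ∑ a, e a a := by
  simp only [mul_ite, mul_one, mul_zero, Finset.sum_ite_eq, Finset.mem_univ, if_true,
    Finset.mul_sum]
  exact Finset.sum_congr rfl fun a _ => mul_comm _ _

/-- The partial transpose of the maximally entangled state is proportional to the swap operator, so
testing it for an antisymmetric vector gives a negative number. -/
theorem exists_measurement_reversal {g : Multiplicative (ZMod 2)} (hg : g ≠ 1)
    (hs : ∀ i, ∃ q, s i = .gpt q) (c : ℂ) {f : HBas s × HBas s → ℂ}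
    (hf : ∀ x y, f (y, x) = -f (x, y)) (h1 : ∑ x, ∑ y, star (f (x, y)) * f (x, y) = 1) :
    ∃ L ∈ QT.Chan (Sum.elim s s) (one (.cl 1)),
      Proc.comp L (Proc.comp (Proc.par (idProc s) (act (S := QT.toSystems) timeReversal g s))
        fun b _ => expect (Sum.elim s s) (diagonalVec s c) b) (fun _ => (0 : Fin 2))
        (trivBas : Bas quantumSystems.triv) = -Complex.normSq c := by
  obtain ⟨L, hL, hL1⟩ := exists_measurement (s := Sum.elim s s) (ψ := uncurryHBas f)
    ((sum_uncurryHBas fun p => star (f p) * f p).trans h1)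
  refine ⟨L, hL, ?_⟩
  have h2 : ∀ a b, Proc.comp (Proc.par (idProc s) (act (S := QT.toSystems) timeReversal g s))
      (fun b _ => expect (Sum.elim s s) (diagonalVec s c) b) (joinBas a b)
        (trivBas : Bas quantumSystems.triv) = Complex.normSq c * if a = b then 1 else 0 :=
    fun a b => (comp_par_id_apply (S := quantumSystems) _ _ _ _ _).trans
      ((act_timeReversal_comp hg _ _ _).trans ((expect_diagonalVec c a (swapBas b)).trans
        (congrArg (fun b => Complex.normSq c * if a = b then 1 else 0) (swapBas_swapBas b))))
  refine (comp_apply_joinBas (S := quantumSystems) _ _ _ _).trans ?_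
  refine (Finset.sum_congr rfl fun a _ => Finset.sum_congr rfl fun b _ =>
    congrArg₂ (· * ·) (hL1 (joinBas a b)) (h2 a b)).trans ?_
  refine (sum_mul_ite_eq (fun a b => expect (Sum.elim s s) (uncurryHBas f) (joinBas a b)) _).trans
    ((congrArg (Complex.normSq c * ·) (sum_expect_antisymmetric hs hf h1)).trans ?_)
  ring

end Entangled

/-! ### Time reversal is strongly nonphysical and has a perfect reference frame. -/

section TimeReversalProperties

/-- The two-dimensional quantum system. -/
abbrev qubit : Unit → quantumSystems.Sys := one (.gpt (1 : ℕ))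

theorem qubit_gpt (i : Unit) : ∃ q, qubit i = .gpt q := ⟨(1 : ℕ), rfl⟩

/-- The vector of the singlet state. -/
def singlet : Fin 2 → Fin 2 → ℂ := ![![0, ⟨1 / 2, 1 / 2⟩], ![⟨-1 / 2, -1 / 2⟩, 0]]

theorem singlet_swap (x y : Fin 2) : singlet y x = -singlet x y := by
  fin_cases x <;> fin_cases y <;> simp [singlet, Complex.ext_iff] <;> norm_num

theorem sum_singlet : ∑ x, ∑ y, star (singlet x y) * singlet x y = 1 := by
  simp only [Fin.sum_univ_two, singlet]
  apply Complex.ext <;> simp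
  norm_num

/-- A complex number of modulus `1 / √2`. -/
def halfUnit : ℂ := ⟨1 / 2, 1 / 2⟩

theorem normSq_halfUnit : Complex.normSq halfUnit = 1 / 2 := by
  simp [halfUnit, Complex.normSq_apply]
  norm_num

theorem sum_star_diagonalVec_qubit {_ : Fintype (HBas (Sum.elim qubit qubit))} :
    ∑ z, star (diagonalVec qubit halfUnit z) * diagonalVec qubit halfUnit z = 1 := by
  refine (sum_star_diagonalVec halfUnit).trans ?_
  have h1 : star halfUnit * halfUnit = 1 / 2 := by
    apply Complex.ext <;> simp [halfUnit]
    norm_num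
  have h2 : ((Fintype.card (Unit → Fin 2) : ℕ) : ℂ) * (star halfUnit * halfUnit) = 1 := by
    rw [h1]
    simp
  refine Eq.trans ?_ h2
  congr!

theorem stronglyNonphysical_timeReversal : StronglyNonphysical QT timeReversal := by
  let g : Multiplicative (ZMod 2) := Multiplicative.ofAdd 1
  have hg : g ≠ 1 := by decide
  refine ⟨g, (1 : ℕ), fun h => ?_⟩
  obtain ⟨L, hL, hL1⟩ := exists_measurement_reversal hg qubit_gpt halfUnit
    (f := fun p => singlet (p.1 ()) (p.2 ())) (fun x y => singlet_swap _ _)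
    ((Finset.sum_congr rfl fun x _ => sum_ket (ι := Unit) (q := 1) fun y =>
      star (singlet (x ()) y) * singlet (x ()) y).trans
        ((sum_ket (ι := Unit) (q := 1) fun x => ∑ y, star (singlet x y) * singlet x y).trans
          sum_singlet))
  -- Prepare a maximally entangled pair, reverse its second qubit, and test for the singlet: the
  -- alleged probability is -1/2.
  have h1 := h (fun _ : Unit => 1) _ (.comp _ _ _ _ _ (.comp _ _ _ _ _
      (.base _ _ _ (pureState_mem (ψ := diagonalVec qubit halfUnit) sum_star_diagonalVec_qubit))
      (.par _ _ _ _ _ _ (.base _ _ _ (isGPT_QT.isProcessTheory.id_mem _)) .new))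
      (.base _ _ _ hL)) (fun _ => (0 : Fin 2)) trivBas
  have h2 := h1.1.trans_eq hL1
  rw [normSq_halfUnit] at h2
  norm_num at h2

/-- The eigenvectors of the Pauli matrix that is odd under time reversal. -/
def oddVec : Fin 2 → Fin 2 → ℂ :=
  ![![⟨1 / 2, 1 / 2⟩, ⟨-1 / 2, 1 / 2⟩], ![⟨1 / 2, 1 / 2⟩, ⟨1 / 2, -1 / 2⟩]]

theorem sum_oddVec_mul (z w : Fin 2) :
    ∑ j, oddVec j z * star (oddVec j w) = if z = w then 1 else 0 := by
  fin_cases z <;> fin_cases w <;> simp [oddVec, Fin.sum_univ_two, Complex.ext_iff] <;> norm_num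

theorem normSq_sum_oddVec (j : Fin 2) :
    Complex.normSq (∑ z, star (oddVec j z) * oddVec 0 z) = if j = 0 then 1 else 0 := by
  fin_cases j <;> simp [oddVec, Fin.sum_univ_two, Complex.normSq_apply] <;> norm_num

theorem normSq_sum_oddVec_star (j : Fin 2) :
    Complex.normSq (∑ z, star (oddVec j z) * star (oddVec 0 z)) = if j = 1 then 1 else 0 := by
  fin_cases j <;> simp [oddVec, Fin.sum_univ_two, Complex.normSq_apply] <;> norm_num

theorem hasPerfectReferenceFrame_timeReversal : HasPerfectReferenceFrame QT timeReversal := by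
  let r : Fin 1 → quantumSystems.Sys := fun _ => .gpt (1 : ℕ)
  have hr : ∀ i, ∃ q, r i = .gpt q := fun _ => ⟨(1 : ℕ), rfl⟩
  -- Up to phases these are `(1, i)/√2` and `(1, -i)/√2`. Conjugation exchanges the two rays, so
  -- measuring in this basis distinguishes the orbit of the first.
  let φ : Fin 2 → HBas r → ℂ := fun j => ket (Fin 1) 1 (oddVec j)
  let label : Multiplicative (ZMod 2) → Fin 2 := fun g => if g = 1 then 0 else 1
  have hω : ∑ z, star (oddVec 0 z) * oddVec 0 z = 1 := by
    simp only [Fin.sum_univ_two, oddVec]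
    apply Complex.ext <;> simp <;> norm_num
  have hM : ∀ (ψ : Fin 2 → ℂ) (k : Fin 2) (y : Fin 2),
      (∀ j, Complex.normSq (∑ z, star (oddVec j z) * ψ z) = if j = k then 1 else 0) →
      Proc.comp (rankOneMeasurement (n := 1) id φ) (fun c _ => expect r (ket (Fin 1) 1 ψ) c)
        (fun _ => y) trivBas = if y = k then 1 else 0 := by
    intro ψ k y hψ
    refine (comp_rankOneMeasurement hr _ _ _ _ _).trans ?_
    rw [Finset.sum_eq_single y]
    · refine (if_pos rfl).trans (Eq.trans ?_ (hψ y))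
      exact congrArg Complex.normSq (sum_star_ket (oddVec y) ψ)
    · exact fun j _ hj => if_neg hj
    · exact fun h => absurd (Finset.mem_univ _) h
  refine ⟨1, r, 1, label, _, pureState_mem (ψ := φ 0) ((sum_star_ket _ _).trans hω), _,
    rankOneMeasurement_mem (n := 1) id (φ := φ)
    (forall_ket_iff (p := fun z w => ∑ j, oddVec j z * star (oddVec j w)) sum_oddVec_mul),
    fun g y => ?_, fun g h hgh => ?_⟩
  · by_cases hg : g = 1
    · have h1 : label g = 0 := if_pos hg
      rw [h1]
      refine Eq.trans ?_ (hM (oddVec 0) 0 y normSq_sum_oddVec)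
      refine congrFun (congrFun (congrArg (Proc.comp _) ?_) _) _
      subst hg
      exact (congrArg (Proc.comp · _) (act_timeReversal_one r)).trans
        (id_comp (S := quantumSystems) _)
    · have h1 : label g = 1 := if_neg hg
      rw [h1]
      refine Eq.trans ?_ (hM (fun z => star (oddVec 0 z)) 1 y normSq_sum_oddVec_star)
      refine congrFun (congrFun (congrArg (Proc.comp _) (proc_ext fun b a => ?_)) _) _
      exact (act_timeReversal_comp hg _ _ _).trans (expect_swapBas _ _)
  · have h1 : ∀ g h : Multiplicative (ZMod 2), label g = label h → g = h := by decide
    rw [h1 g h hgh]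

end TimeReversalProperties

/-! ### The Bell inequality of Clauser, Horne, Shimony and Holt -/

section CHSH

/-- The expectation value of the product of two outcomes with values `1` and `-1`. -/
def correlator (Q : Fin 2 → Fin 2 → Fin 2 → Fin 2 → ℝ) (i j : Fin 2) : ℝ :=
  Q 0 0 i j - Q 0 1 i j - Q 1 0 i j + Q 1 1 i j

/-- The combination of correlators in the inequality. -/
def chsh (Q : Fin 2 → Fin 2 → Fin 2 → Fin 2 → ℝ) : ℝ :=
  correlator Q 0 0 + correlator Q 0 1 + correlator Q 1 0 - correlator Q 1 1

theorem chsh_le_two_of_abs_le {a b a' b' : ℝ} (ha : |a| ≤ 1) (hb : |b| ≤ 1) (ha' : |a'| ≤ 1)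
    (hb' : |b'| ≤ 1) : a * a' + a * b' + b * a' - b * b' ≤ 2 := by
  have h1 : a * (a' + b') ≤ |a' + b'| :=
    (le_abs_self _).trans ((abs_mul _ _).trans_le (mul_le_of_le_one_left (abs_nonneg _) ha))
  have h2 : b * (a' - b') ≤ |a' - b'| :=
    (le_abs_self _).trans ((abs_mul _ _).trans_le (mul_le_of_le_one_left (abs_nonneg _) hb))
  have h3 : |a' + b'| + |a' - b'| ≤ 2 := by
    rw [abs_le] at ha' hb'
    rcases abs_cases (a' + b') with h | h <;> rcases abs_cases (a' - b') with h' | h' <;> linarith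
  linarith

/-- Given the hidden values `a` and `b`, the correlators are products of local expectations in [-1,
1]; the pointwise bound is then averaged over `ρ`. -/
theorem chsh_le_two_of_local {α β : Type} [Fintype α] [Fintype β] {M : Fin 2 → Fin 2 → α → ℝ}
    {N : Fin 2 → Fin 2 → β → ℝ} {ρ : α → β → ℝ} (hM : ∀ i x a, 0 ≤ M i x a)
    (hM1 : ∀ i a, ∑ x, M i x a = 1) (hN : ∀ i x a, 0 ≤ N i x a) (hN1 : ∀ i a, ∑ x, N i x a = 1)
    (hρ : ∀ a b, 0 ≤ ρ a b) (hρ1 : ∑ a, ∑ b, ρ a b = 1) :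
    chsh (fun x y i j => ∑ a, ∑ b, M i x a * N j y b * ρ a b) ≤ 2 := by
  have key : ∀ {x y : ℝ}, 0 ≤ x → 0 ≤ y → x + y = 1 → |x - y| ≤ 1 := by
    intro x y hx hy h
    rw [abs_le]
    constructor <;> linarith
  have h1 : ∀ i a, |M i 0 a - M i 1 a| ≤ 1 := fun i a =>
    key (hM i 0 a) (hM i 1 a) ((Fin.sum_univ_two _).symm.trans (hM1 i a))
  have h2 : ∀ i a, |N i 0 a - N i 1 a| ≤ 1 := fun i a =>
    key (hN i 0 a) (hN i 1 a) ((Fin.sum_univ_two _).symm.trans (hN1 i a))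
  have h3 : chsh (fun x y i j => ∑ a, ∑ b, M i x a * N j y b * ρ a b) = ∑ a, ∑ b,
      ((M 0 0 a - M 0 1 a) * (N 0 0 b - N 0 1 b) + (M 0 0 a - M 0 1 a) * (N 1 0 b - N 1 1 b) +
        (M 1 0 a - M 1 1 a) * (N 0 0 b - N 0 1 b) -
        (M 1 0 a - M 1 1 a) * (N 1 0 b - N 1 1 b)) * ρ a b := by
    simp only [chsh, correlator, ← Finset.sum_add_distrib, ← Finset.sum_sub_distrib]
    exact Finset.sum_congr rfl fun a _ => Finset.sum_congr rfl fun b _ => by ring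
  have h4 : (2 : ℝ) = ∑ a, ∑ b, 2 * ρ a b := by
    simp only [← Finset.mul_sum, hρ1, mul_one]
  rw [h3, h4]
  exact Finset.sum_le_sum fun a _ => Finset.sum_le_sum fun b _ =>
    mul_le_mul_of_nonneg_right (chsh_le_two_of_abs_le (h1 0 a) (h1 1 a) (h2 0 b) (h2 1 b)) (hρ a b)

theorem BellForm.chsh_le_two {Q : Fin 2 → Fin 2 → Fin 2 → Fin 2 → ℝ}
    (h : BellForm CPT (nx := 1) (ny := 1) (ni := 1) (nj := 1) Q) : chsh Q ≤ 2 := by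
  obtain ⟨k, l, s, t, ρ, M, N, hρ, hM, hN, hQ⟩ := h
  have h1 : Q = fun x y i j => ∑ a, ∑ b, M i (fun _ => x) a * N j (fun _ => y) b *
      ρ (joinBas a b) trivBas :=
    funext₄ fun x y i j => (hQ x y i j).trans (bellProb_eq _ _ _ _ _)
  rw [h1]
  exact chsh_le_two_of_local (M := fun i x a => M i (fun _ => x) a)
    (N := fun j y b => N j (fun _ => y) b) (ρ := fun a b => ρ (joinBas a b) trivBas)
    (fun i x a => (hM i).1 _ _)
    (fun i a => (sum_one fun x => M i x a).symm.trans ((sum_univ_congr _ _ _).trans ((hM i).2 a)))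
    (fun j y b => (hN j).1 _ _)
    (fun j b => (sum_one fun y => N j y b).symm.trans ((sum_univ_congr _ _ _).trans ((hN j).2 b)))
    (fun a b => hρ.1 _ _)
    ((sum_joinBas fun b => ρ b trivBas).symm.trans ((sum_univ_congr _ _ _).trans (hρ.2 trivBas)))

theorem rankOneMeasurement_id {ι : Type} [Fintype ι] {s : ι → quantumSystems.Sys} {n : ℕ}
    (φ : Fin (n + 1) → HBas s → ℂ) (x : Fin (n + 1)) (a : Bas s) :
    rankOneMeasurement id φ (fun _ => x) a = expect s (φ x) a :=
  (Finset.sum_eq_single x (fun _ _ h => if_neg h) fun h => absurd (Finset.mem_univ _) h).trans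
    (if_pos rfl)

/-- The Born rule for product vectors on the composite: up to conjugation, their overlap with `∑ x,
|x x⟩` is the bilinear product of the two local vectors. -/
theorem bellProb_diagonalVec {ι : Type} [Fintype ι] {s : ι → quantumSystems.Sys}
    (hs : ∀ i, ∃ q, s i = .gpt q) (c : ℂ) {nx ny : ℕ} (φ : Fin (nx + 1) → HBas s → ℂ)
    (χ : Fin (ny + 1) → HBas s → ℂ) (x : Fin (nx + 1)) (y : Fin (ny + 1)) :
    bellProb (fun b _ => expect (Sum.elim s s) (diagonalVec s c) b) (rankOneMeasurement id φ)
      (rankOneMeasurement id χ) x y = Complex.normSq c * Complex.normSq (∑ z, φ x z * χ y z) := by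
  refine (bellProb_eq _ _ _ _ _).trans ?_
  have h1 : ∀ a b, rankOneMeasurement id φ (fun _ => x) a * rankOneMeasurement id χ (fun _ => y) b =
      expect (Sum.elim s s) (uncurryHBas fun p => φ x p.1 * χ y p.2) (joinBas a b) := fun a b =>
    (congrArg₂ (· * ·) (rankOneMeasurement_id _ _ _) (rankOneMeasurement_id _ _ _)).trans
      (expect_mul_expect _ _ _ _)
  refine (Finset.sum_congr rfl fun a _ => Finset.sum_congr rfl fun b _ =>
    congrArg (· * _) (h1 a b)).trans ?_
  refine (sum_joinBas fun d => expect (Sum.elim s s) (uncurryHBas fun p => φ x p.1 * χ y p.2) d *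
    expect (Sum.elim s s) (diagonalVec s c) d).symm.trans ?_
  have hs' : ∀ i, ∃ q, Sum.elim s s i = .gpt q := by
    rintro (i | i)
    · exact hs i
    · exact hs i
  refine (sum_univ_congr _ _ _).trans ((sum_expect_mul_expect hs' _ _).trans ?_)
  rw [mul_comm (Complex.normSq c), ← Complex.normSq_conj (∑ z, φ x z * χ y z),
    ← Complex.normSq_mul, map_sum (starRingEnd ℂ), Finset.sum_mul]
  refine congrArg Complex.normSq ?_
  refine (sum_uncurryHBas fun p => star (φ x p.1 * χ y p.2) * if p.1 = p.2 then c else 0).trans ?_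
  simp only [mul_ite, mul_zero, Finset.sum_ite_eq, Finset.mem_univ, if_true]
  rfl

/-- Eigenvectors of the Pauli matrices `Z` and `X`. -/
def leftVec : Fin 2 → Fin 2 → Fin 2 → ℂ :=
  ![![![1, 0], ![0, 1]], ![![⟨1 / 2, 1 / 2⟩, ⟨1 / 2, 1 / 2⟩], ![⟨1 / 2, 1 / 2⟩, ⟨-1 / 2, -1 / 2⟩]]]

/-- Eigenvectors of `(3 Z + 4 X) / 5` and `(3 Z - 4 X) / 5`. -/
def rightVec : Fin 2 → Fin 2 → Fin 2 → ℂ :=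
  ![![![⟨4 / 5, 2 / 5⟩, ⟨2 / 5, 1 / 5⟩], ![⟨2 / 5, 1 / 5⟩, ⟨-4 / 5, -2 / 5⟩]],
    ![![⟨4 / 5, 2 / 5⟩, ⟨-2 / 5, -1 / 5⟩], ![⟨2 / 5, 1 / 5⟩, ⟨4 / 5, 2 / 5⟩]]]

theorem sum_leftVec_mul (i z w : Fin 2) :
    ∑ j, leftVec i j z * star (leftVec i j w) = if z = w then 1 else 0 := by
  fin_cases i <;> fin_cases z <;> fin_cases w <;>
    simp [leftVec, Fin.sum_univ_two, Complex.ext_iff] <;> norm_num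

theorem sum_rightVec_mul (i z w : Fin 2) :
    ∑ j, rightVec i j z * star (rightVec i j w) = if z = w then 1 else 0 := by
  fin_cases i <;> fin_cases z <;> fin_cases w <;>
    simp [rightVec, Fin.sum_univ_two, Complex.ext_iff] <;> norm_num

/-- The correlators are scalar products of Bloch vectors in the Z-X plane: 3/5, 3/5, 4/5 and -4/5.
The angles of the 3-4-5 triangle and phases such as `(2 + i)/√5` keep all entries rational, at the
price of staying below the quantum maximum `2√2`. -/
theorem chsh_eq : chsh (fun x y i j => 1 / 2 *
    Complex.normSq (∑ z, leftVec i x z * rightVec j y z)) = 14 / 5 := by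
  simp only [chsh, correlator, Fin.sum_univ_two, leftVec, rightVec, Complex.normSq_apply]
  simp
  norm_num

theorem exists_bellForm_QT_two_lt_chsh : ∃ Q : Fin 2 → Fin 2 → Fin 2 → Fin 2 → ℝ,
    BellForm QT (nx := 1) (ny := 1) (ni := 1) (nj := 1) Q ∧ 2 < chsh Q := by
  let φ : Fin 2 → Fin 2 → HBas qubit → ℂ := fun i x => ket Unit 1 (leftVec i x)
  let χ : Fin 2 → Fin 2 → HBas qubit → ℂ := fun i x => ket Unit 1 (rightVec i x)
  refine ⟨_, bellForm_of (ni := 1) (nj := 1) (nx := 1) (ny := 1) isGPT_QT.isProcessTheory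
    (pureState_mem (sum_star_diagonalVec_qubit))
    (fun i => rankOneMeasurement_mem id (φ := φ i)
      (forall_ket_iff (p := fun z w => ∑ j, leftVec i j z * star (leftVec i j w))
        (sum_leftVec_mul i)))
    (fun i => rankOneMeasurement_mem id (φ := χ i)
      (forall_ket_iff (p := fun z w => ∑ j, rightVec i j z * star (rightVec i j w))
        (sum_rightVec_mul i))), ?_⟩
  have h1 : (2 : ℝ) < 14 / 5 := by norm_num
  refine h1.trans_eq (chsh_eq.symm.trans (congrArg chsh (funext₄ fun x y i j => ?_)))
  refine Eq.trans ?_ (bellProb_diagonalVec qubit_gpt halfUnit (φ i) (χ j) x y).symm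
  rw [normSq_halfUnit]
  exact congrArg (1 / 2 * Complex.normSq ·)
    (sum_ket (ι := Unit) (q := 1) fun z => leftVec i x z * rightVec j y z).symm

theorem admitsGap_CPT_QT_bell : AdmitsGap CPT QT Bell := by
  refine ssubset_iff_subset_not_subset.2
    ⟨realizable_CPT_bell_subset isGPT_QT.isProcessTheory, fun h => ?_⟩
  obtain ⟨Q, hQ, h1⟩ := exists_bellForm_QT_two_lt_chsh
  exact absurd (hQ.of_realizable_subset isGPT_QT.isProcessTheory isGPT_CPT.isProcessTheory
    h).chsh_le_two h1.not_ge

end CHSH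

end Swirl

end

theorem mainTheorem11 :
    -- the algebraic witness
    Algebraic PBR ∧
    (∀ (T : Theory.{u}) (_ : IsGPT T) (G : Type) [Group G] [Fintype G]
        (F : G → ∀ q : T.Q, Matrix (T.Idx q) (T.Idx q) ℝ) (_ : IsSymmetry T F),
      ¬ AllowsSharedReferenceFrame T F PBR ∧
      ¬ AdmitsGap (symmetrized T F) T PBR ∧
      realizable (symmetrized T F) PBR = realizable T PBR) ∧
    -- the witness with two districts
    (Nat.card (Quotient DoubleBell.fragments) = 2 ∧
      ∀ d, Nonempty ((DoubleBell.district d).Iso Bell)) ∧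
    (∀ (T : Theory.{u}) (_ : IsGPT T) (G : Type) [Group G] [Fintype G]
        (F : G → ∀ q : T.Q, Matrix (T.Idx q) (T.Idx q) ℝ) (_ : IsSymmetry T F),
      ¬ AllowsSharedReferenceFrame T F DoubleBell ∧
      (AdmitsGap CPT T DoubleBell ↔ AdmitsGap CPT T Bell) ∧
      (HasPerfectReferenceFrame T F →
        ¬ AdmitsGap (symmetrized T F) T DoubleBell ∧
        realizable (symmetrized T F) DoubleBell = realizable T DoubleBell)) ∧
    -- quantum theory with time reversal satisfies all hypotheses
    (IsGPT QT ∧ IsSymmetry QT timeReversal ∧ StronglyNonphysical QT timeReversal ∧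
      HasPerfectReferenceFrame QT timeReversal ∧ AdmitsGap CPT QT DoubleBell) ∧
    -- hence the condition is not sufficient, even for strongly nonphysical symmetries
    (¬ ∀ (T : Theory.{0}) (_ : IsGPT T) (G : Type) [Group G] [Fintype G]
        (F : G → ∀ q : T.Q, Matrix (T.Idx q) (T.Idx q) ℝ) (_ : IsSymmetry T F)
        (_ : StronglyNonphysical T F) (C : CausalStructure),
      ¬ AllowsSharedReferenceFrame T F C → AdmitsGap (symmetrized T F) T C) ∧
    -- nor is it in conjunction with a gap between classical probability theory and the theory
    (¬ ∀ (T : Theory.{0}) (_ : IsGPT T) (G : Type) [Group G] [Fintype G]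
        (F : G → ∀ q : T.Q, Matrix (T.Idx q) (T.Idx q) ℝ) (_ : IsSymmetry T F)
        (_ : StronglyNonphysical T F) (C : CausalStructure),
      AdmitsGap CPT T C → ¬ AllowsSharedReferenceFrame T F C →
        AdmitsGap (symmetrized T F) T C) := by
  have h1 : ∀ (T : Theory.{u}) (_ : IsGPT T) (G : Type) [Group G] [Fintype G]
      (F : G → ∀ q : T.Q, Matrix (T.Idx q) (T.Idx q) ℝ) (_ : IsSymmetry T F),
      realizable (symmetrized T F) PBR = realizable T PBR := fun T hT G _ _ F hF =>
    realizable_pbr_eq (hT.isProcessTheory.symmetrized) hT.isProcessTheory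
  have hQT := isGPT_QT
  have hF := isSymmetry_timeReversal
  have hR := hasPerfectReferenceFrame_timeReversal
  have hgap : AdmitsGap CPT QT DoubleBell :=
    (admitsGap_CPT_doubleBell_iff hQT).2 admitsGap_CPT_QT_bell
  refine ⟨algebraic_pbr, fun T hT G _ _ F hF =>
      ⟨not_allowsSharedReferenceFrame_pbr hT hF, fun h => h.ne (h1 T hT G F hF), h1 T hT G F hF⟩,
    ⟨card_fragments, nonempty_district_iso_bell⟩, fun T hT G _ _ F hF =>
      ⟨not_allowsSharedReferenceFrame_doubleBell hT hF, admitsGap_CPT_doubleBell_iff hT, fun hR =>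
        ⟨fun h => h.ne (realizable_symmetrized_doubleBell hT.isProcessTheory hF hR),
          realizable_symmetrized_doubleBell hT.isProcessTheory hF hR⟩⟩,
    ⟨hQT, hF, stronglyNonphysical_timeReversal, hR, hgap⟩, fun h => ?_, fun h => ?_⟩
  · exact (h QT hQT _ timeReversal hF stronglyNonphysical_timeReversal PBR
      (not_allowsSharedReferenceFrame_pbr hQT hF)).ne
        (realizable_pbr_eq (hQT.isProcessTheory.symmetrized) hQT.isProcessTheory)
  · exact (h QT hQT _ timeReversal hF stronglyNonphysical_timeReversal DoubleBell hgap
      (not_allowsSharedReferenceFrame_doubleBell hQT hF)).ne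
        (realizable_symmetrized_doubleBell hQT.isProcessTheory hF hR)
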